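/- Let $n\ge 3$, $r=\lfloor\frac{n+2}{2}\rfloor$, and let $\mathfrak g=\mathfrak{so}(2,n)$, with maximal compact subalgebra $\mathfrak k_n=\mathfrak{so}(2)\oplus\mathfrak{so}(n)$. Take the standard compact Cartan subalgebra $\mathfrak h\subset\mathfrak k_n^{\mathbb C}$ with coordinates $e_1,\dots,e_r$ ($e_1$ belonging to $\mathfrak{so}(2)$ and $e_2,\dots,e_r$ to $\mathfrak{so}(n)$), and the positive roots $e_i\pm e_j$ $(1\le i<j\le r)$ of $\mathfrak g^{\mathbb C}$, together with $e_j$ $(1\le j\le r)$ if $n$ is odd; on $\mathfrak k_n^{\mathbb C}$ use the induced positive system. For $E_0>0$ real let $D(E_0,0,\dots,0)$ be the irreducible $\mathfrak g$-module with highest weight $(-E_0,0,\dots,0)$, and let $\chi(\mu_1)\otimes\pi(\mu_2,\dots,\mu_r)$ be the irreducible $\mathfrak k_n$-module with highest weight $(\mu_1,\dots,\mu_r)$. Then, as $\mathfrak k_n$-modules (algebraic direct sums): (i) if $E_0\notin\bigl\{\frac n2-j : 1\le j\le\lfloor\frac{n-1}{2}\rfloor\bigr\}$, then $$D(E_0,0,\dots,0)\big|_{\mathfrak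 k_n}\;\cong\;\bigoplus_{l=0}^\infty\bigoplus_{k=0}^\infty\chi\bigl(-(E_0+l+2k)\bigr)\otimes\pi(l,0,\dots,0);$$ (ii) if $E_0=\frac n2-j$ for some $j\in\{1,\dots,\lfloor\frac{n-1}{2}\rfloor\}$, then $$D(E_0,0,\dots,0)\big|_{\mathfrak k_n}\;\cong\;\bigoplus_{l=0}^\infty\bigoplus_{k=0}^{j-1}\chi\bigl(-(E_0+l+2k)\bigr)\otimes\pi(l,0,\dots,0).$$ -/

import Mathlib

open scoped DirectSum

attribute [local instance 100] LieRing.ofAssociativeRing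

noncomputable section

/-! ## Irreducible highest weight modules

`L` is a complex Lie algebra, `npos` the nilpotent radical of a Borel subalgebra (a subspace), and
`H` a basis of the Cartan subalgebra. -/

section HighestWeight

variable {L : Type} [LieRing L] [LieAlgebra ℂ L]

/-- The left ideal of `U(L)` generated by `npos` and by the elements `H i - wt i`. -/
def vermaIdeal (npos : Submodule ℂ L) {I : Type} (H : I → L) (wt : I → ℂ) :
    Submodule (UniversalEnvelopingAlgebra ℂ L) (UniversalEnvelopingAlgebra ℂ L) :=
  Submodule.span (UniversalEnvelopingAlgebra ℂ L)
    ({u | ∃ x ∈ npos, u = UniversalEnvelopingAlgebra.ι ℂ x} ∪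
      {u | ∃ i : I, u = UniversalEnvelopingAlgebra.ι ℂ (H i) -
        algebraMap ℂ (UniversalEnvelopingAlgebra ℂ L) (wt i)})

/-- The Verma module of highest weight `wt`. -/
abbrev Verma (npos : Submodule ℂ L) {I : Type} (H : I → L) (wt : I → ℂ) : Type :=
  UniversalEnvelopingAlgebra ℂ L ⧸ vermaIdeal npos H wt

/-- The largest proper submodule of the Verma module: the sum of all its proper submodules. -/
def Verma.radical (npos : Submodule ℂ L) {I : Type} (H : I → L) (wt : I → ℂ) :
    Submodule (UniversalEnvelopingAlgebra ℂ L) (Verma npos H wt) :=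
  sSup {N | N ≠ ⊤}

/-- The irreducible `L`-module of highest weight `wt`: the irreducible quotient of the
Verma module. -/
def IrrHW (npos : Submodule ℂ L) {I : Type} (H : I → L) (wt : I → ℂ) : Type :=
  Verma npos H wt ⧸ Verma.radical npos H wt

variable (npos : Submodule ℂ L) {I : Type} (H : I → L) (wt : I → ℂ)

instance : AddCommGroup (IrrHW npos H wt) :=
  inferInstanceAs (AddCommGroup (Verma npos H wt ⧸ Verma.radical npos H wt))

instance : Module (UniversalEnvelopingAlgebra ℂ L) (IrrHW npos H wt) :=
  inferInstanceAs (Module (UniversalEnvelopingAlgebra ℂ L)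
    (Verma npos H wt ⧸ Verma.radical npos H wt))

instance : Module ℂ (IrrHW npos H wt) :=
  inferInstanceAs (Module ℂ (Verma npos H wt ⧸ Verma.radical npos H wt))

instance : IsScalarTower ℂ (UniversalEnvelopingAlgebra ℂ L) (IrrHW npos H wt) :=
  inferInstanceAs (IsScalarTower ℂ (UniversalEnvelopingAlgebra ℂ L)
    (Verma npos H wt ⧸ Verma.radical npos H wt))

/-- `L` acts through `L → U(L)`. -/
instance : LieRingModule L (IrrHW npos H wt) where
  bracket x m := UniversalEnvelopingAlgebra.ι ℂ x • m
  add_lie x y m := by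
    exact (congrArg (· • m) (map_add (UniversalEnvelopingAlgebra.ι ℂ) x y)).trans (add_smul _ _ m)
  lie_add x m m' := smul_add _ m m'
  leibniz_lie x y m := by
    change UniversalEnvelopingAlgebra.ι ℂ x • (UniversalEnvelopingAlgebra.ι ℂ y • m) =
      UniversalEnvelopingAlgebra.ι ℂ ⁅x, y⁆ • m +
        UniversalEnvelopingAlgebra.ι ℂ y • (UniversalEnvelopingAlgebra.ι ℂ x • m)
    rw [LieHom.map_lie, Ring.lie_def, sub_smul, mul_smul, mul_smul, sub_add_cancel]

instance : LieModule ℂ L (IrrHW npos H wt) where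
  smul_lie t x m := by
    change UniversalEnvelopingAlgebra.ι ℂ (t • x) • m = t • (UniversalEnvelopingAlgebra.ι ℂ x • m)
    rw [map_smul, smul_assoc]
  lie_smul t x m := by
    change UniversalEnvelopingAlgebra.ι ℂ x • (t • m) = t • (UniversalEnvelopingAlgebra.ι ℂ x • m)
    rw [← algebraMap_smul (UniversalEnvelopingAlgebra ℂ L) t m, ← mul_smul,
      ← Algebra.commutes, mul_smul, algebraMap_smul]

end HighestWeight

/-! ## The Lie algebra `so(2,n)`

Coordinates of `ℂ^{2+n}`: `Sum.inl 0, Sum.inl 1` are `y^{-1}, y^0`, and `Sum.inr b` is `y^{b+1}`. -/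

/-- The complexification of `so(2,n)`: the complex matrices that are skew for the form
`η = diag(1, 1, -1, …, -1)`. -/
abbrev soC (n : ℕ) : LieSubalgebra ℂ (Matrix (Fin 2 ⊕ Fin n) (Fin 2 ⊕ Fin n) ℂ) :=
  LieAlgebra.Orthogonal.so' (Fin 2) (Fin n) ℂ

/-- The rank `[(n+2)/2]` of `soC n`. -/
abbrev soRank (n : ℕ) : ℕ := (n + 2) / 2

/-- The isotropic basis `x_j` (`|j| ≤ r`, with `j = 0` for `n` odd only):
`x_{±1} = (i/√2)(y^{-1} ± i y^0)`, `x_{±j} = (1/√2)(y^{2j-3} ± i y^{2j-2})` for `2 ≤ j ≤ r`, and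
`x_0 = y^n` if `n` is odd; it satisfies `η(x_j, x_k) = -1` if `j = -k` and `0` otherwise. -/
def isoVec (n : ℕ) (j : ℤ) : Fin 2 ⊕ Fin n → ℂ
  | Sum.inl a =>
      if j.natAbs = 1 then Complex.I / (Real.sqrt 2 : ℂ) * (if a = 0 then 1 else (j : ℂ) * Complex.I)
      else 0
  | Sum.inr b =>
      if 2 ≤ j.natAbs then
        1 / (Real.sqrt 2 : ℂ) *
          (if (b : ℕ) + 4 = 2 * j.natAbs then 1
            else if (b : ℕ) + 3 = 2 * j.natAbs then (j.sign : ℂ) * Complex.I else 0)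
      else if j = 0 ∧ Odd n ∧ (b : ℕ) + 1 = n then 1 else 0

/-- The endomorphism `w ↦ η(v, w) u - η(u, w) v`, as a matrix. -/
def wedge {n : ℕ} (u v : Fin 2 ⊕ Fin n → ℂ) : Matrix (Fin 2 ⊕ Fin n) (Fin 2 ⊕ Fin n) ℂ :=
  (Matrix.vecMulVec u v - Matrix.vecMulVec v u) * LieAlgebra.Orthogonal.indefiniteDiagonal _ _ ℂ

theorem wedge_mem {n : ℕ} (u v : Fin 2 ⊕ Fin n → ℂ) : wedge u v ∈ soC n := by
  change wedge u v ∈ skewAdjointMatricesLieSubalgebra _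
  rw [mem_skewAdjointMatricesLieSubalgebra, mem_skewAdjointMatricesSubmodule,
    Matrix.IsSkewAdjoint, Matrix.IsAdjointPair]
  have hη : (LieAlgebra.Orthogonal.indefiniteDiagonal (Fin 2) (Fin n) ℂ).transpose =
      LieAlgebra.Orthogonal.indefiniteDiagonal (Fin 2) (Fin n) ℂ := by
    simp [LieAlgebra.Orthogonal.indefiniteDiagonal]
  simp only [wedge, Matrix.transpose_mul, Matrix.transpose_sub, Matrix.transpose_vecMulVec, hη]
  noncomm_ring

/-- The basis elements `X_{jk} = x_j ∧ x_k` of the complexification of `so(2,n)`. -/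
def Xel (n : ℕ) (j k : ℤ) : soC n := ⟨wedge (isoVec n j) (isoVec n k), wedge_mem _ _⟩

/-- The basis `H_j = X_{-j,j}`, `1 ≤ j ≤ r`, of the Cartan subalgebra (`i = j - 1`). -/
def Hel (n : ℕ) (i : Fin (soRank n)) : soC n := Xel n (-((i : ℤ) + 1)) ((i : ℤ) + 1)

/-- The sum `n⁺` of the root spaces of the positive roots `e_j + e_k`, `e_j - e_k`
(`1 ≤ j < k ≤ r`) and, for `n` odd, `e_j` (`1 ≤ j ≤ r`); they are spanned by `X_{jk}`, `X_{j,-k}`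
and `X_{0j}`. -/
def nPos (n : ℕ) : Submodule ℂ (soC n) :=
  Submodule.span ℂ
    ({x | ∃ j k : ℤ, 1 ≤ j ∧ j < k ∧ k ≤ soRank n ∧ (x = Xel n j k ∨ x = Xel n j (-k))} ∪
      {x | Odd n ∧ ∃ j : ℤ, 1 ≤ j ∧ j ≤ soRank n ∧ x = Xel n 0 j})

/-- The complexification of the maximal compact subalgebra `so(2) ⊕ so(n)` of `so(2,n)`: the
block diagonal matrices. -/
def kC (n : ℕ) : LieSubalgebra ℂ (soC n) where
  carrier := {A | ∀ (a : Fin 2) (b : Fin n),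
    A.1 (Sum.inl a) (Sum.inr b) = 0 ∧ A.1 (Sum.inr b) (Sum.inl a) = 0}
  add_mem' := by
    intro A B hA hB a b
    simp [(hA a b).1, (hA a b).2, (hB a b).1, (hB a b).2]
  zero_mem' := by
    intro a b
    simp
  smul_mem' := by
    intro c A hA a b
    simp [(hA a b).1, (hA a b).2]
  lie_mem' := by
    intro A B hA hB a b
    simp only [LieSubalgebra.coe_bracket, Ring.lie_def, Matrix.sub_apply, Matrix.mul_apply,
      Fintype.sum_sum_type]
    constructor <;> simp [(hA _ _).1, (hA _ _).2, (hB _ _).1, (hB _ _).2]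

theorem Hel_mem_kC (n : ℕ) (i : Fin (soRank n)) : Hel n i ∈ kC n := by
  have key : ∀ (a : Fin 2) (b : Fin n) (j k : ℤ), j.natAbs = k.natAbs →
      isoVec n j (Sum.inl a) * isoVec n k (Sum.inr b) = 0 := by
    intro a b j k hjk
    by_cases h1 : j.natAbs = 1
    · have h2 : ¬ 2 ≤ k.natAbs := by omega
      have h3 : k ≠ 0 := by omega
      simp [isoVec, h2, h3]
    · simp [isoVec, h1]
  have hab : (-((i : ℤ) + 1)).natAbs = ((i : ℤ) + 1).natAbs := Int.natAbs_neg _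
  intro a b
  have e1 := key a b _ _ hab
  have e2 := key a b _ _ hab.symm
  constructor
  · simp only [Hel, Xel, wedge, LieAlgebra.Orthogonal.indefiniteDiagonal, Matrix.mul_diagonal,
      Matrix.sub_apply, Matrix.vecMulVec_apply, e1, e2, sub_zero, zero_mul]
  · simp only [Hel, Xel, wedge, LieAlgebra.Orthogonal.indefiniteDiagonal, Matrix.mul_diagonal,
      Matrix.sub_apply, Matrix.vecMulVec_apply]
    rw [mul_comm (isoVec n _ (Sum.inr b)), mul_comm (isoVec n _ (Sum.inr b)), e1, e2]
    simp

/-- `L(wt)`: the irreducible `so(2,n)`-module of highest weight `wt = (wt_1, …, wt_r)`. -/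
abbrev Lmod (n : ℕ) (wt : Fin (soRank n) → ℂ) : Type :=
  IrrHW (nPos n) (Hel n) wt

/-- `K(wt)`: the irreducible `so(2) ⊕ so(n)`-module `χ(wt_1) ⊗ π(wt_2, …, wt_r)` of highest weight
`wt`, with respect to the Cartan subalgebra above and the positive compact roots. -/
abbrev Kmod (n : ℕ) (wt : Fin (soRank n) → ℂ) : Type :=
  IrrHW ((nPos n).comap (kC n).incl.toLinearMap) (fun i => (⟨Hel n i, Hel_mem_kC n i⟩ : kC n)) wt

/-- The weight `(a, b, 0, …, 0)`. -/
def twoWt (n : ℕ) (a b : ℂ) : Fin (soRank n) → ℂ :=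
  fun i => if (i : ℕ) = 0 then a else if (i : ℕ) = 1 then b else 0

/-- `D(E₀, 0, …, 0)`: the irreducible `so(2,n)`-module of highest weight `(-E₀, 0, …, 0)`. -/
abbrev Dmod (n : ℕ) (E₀ : ℝ) : Type := Lmod n (twoWt n (-(E₀ : ℂ)) 0)

/-- `χ(-(E₀ + l + 2k)) ⊗ π(l, 0, …, 0)`. -/
abbrev KType (n : ℕ) (E₀ : ℝ) (l k : ℕ) : Type :=
  Kmod n (twoWt n (-((E₀ : ℂ) + l + 2 * k)) l)

end

/-! ### Highest weight modules: recognising the irreducible quotient of a Verma module -/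

section HighestWeightUniqueness

variable {L : Type} [LieRing L] [LieAlgebra ℂ L]
  (npos : Submodule ℂ L) {I : Type} (H : I → L) (wt : I → ℂ)

/-! Both sides are realised inside `ℂ[X_1, …, X_n]`. The complexified Lie algebra acts on functions
that are homogeneous of degree `-E` on the null cone of `η`; restricted to the section `nullVec` of
the cone, this is the representation `confRep` on polynomials. There `X_{1,u}` acts by constant
coefficient derivatives, `X_{-1,u}` by the second order fields `conf`, `H_1` by `-(euler + E)`, and
`so(n)` by rotations. The constant `1` is a highest weight vector of weight `(-E, 0, …, 0)`.

Write `r²` for `rsq` and `H_l` for the harmonic polynomials of degree `l`. Differentiation sends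
`r^{2k} H_l` into `r^{2k-2} H_{l+1} + r^{2k} H_{l-1}`, and `conf` sends it into `r^{2k} H_{l+1} +
r^{2k+2} H_{l-1}`. By `conf_rsq_pow_mul` the coefficients of the latter are `2(k + l + E)`, nonzero
for `E > 0`, and a multiple of `2k + 2E + 2 - n`. The second vanishes for all `l` at once exactly
when `E = n/2 - (k+1)`. If this never happens for a natural number `k`, all powers of `r²` are
reached from `1`; if `E = n/2 - j`, the rows `k < j` form an invariant subspace. That space
(`polyModule`) is irreducible: derivatives bring any nonzero element down to a constant
(`one_mem_of_pderiv_mem`), and `conf` climbs back up from `1` (`rsq_pow_mul_mem_of_one_mem`).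

Each `r^{2k} H_l` is an irreducible `kC n`-module (`layer_irreducible`, resting on
`harm_irreducible`) with highest weight vector `hwVec`, and a single operator with distinct
eigenvalues on these spaces makes their sum direct (`iSupIndep_layer`). The abstract modules are
matched with the concrete ones by `IrrHW.exists_linearMap_of_highestWeight`: an irreducible module
containing a vector of the right highest weight is the irreducible quotient of the Verma module. -/

/-- The generating vector of the Verma module. -/
def Verma.vec : Verma npos H wt := Submodule.Quotient.mk 1

theorem Verma.mk_eq_smul_vec (u : UniversalEnvelopingAlgebra ℂ L) :
    (Submodule.Quotient.mk u : Verma npos H wt) = u • Verma.vec npos H wt := by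
  rw [Verma.vec, ← Submodule.Quotient.mk_smul, smul_eq_mul, mul_one]

theorem Verma.npos_smul_vec {x : L} (hx : x ∈ npos) :
    UniversalEnvelopingAlgebra.ι ℂ x • Verma.vec npos H wt = 0 := by
  rw [← Verma.mk_eq_smul_vec, Submodule.Quotient.mk_eq_zero]
  exact Submodule.subset_span (Or.inl ⟨x, hx, rfl⟩)

theorem Verma.cartan_smul_vec (i : I) :
    UniversalEnvelopingAlgebra.ι ℂ (H i) • Verma.vec npos H wt = wt i • Verma.vec npos H wt := by
  rw [← algebraMap_smul (UniversalEnvelopingAlgebra ℂ L) (wt i), ← sub_eq_zero, ← sub_smul,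
    ← Verma.mk_eq_smul_vec, Submodule.Quotient.mk_eq_zero]
  exact Submodule.subset_span (Or.inr ⟨i, rfl⟩)

/-- Needed for a grading element `δ`, which is only a combination of the `H i`; its eigenvalue
itself never matters. -/
theorem Verma.exists_weight {δ : L} (hδ : δ ∈ Submodule.span ℂ (Set.range H)) :
    ∃ c : ℂ, UniversalEnvelopingAlgebra.ι ℂ δ • Verma.vec npos H wt =
      c • Verma.vec npos H wt := by
  induction hδ using Submodule.span_induction with
  | mem x hx =>
    obtain ⟨i, rfl⟩ := hx
    exact ⟨_, Verma.cartan_smul_vec npos H wt i⟩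
  | zero => exact ⟨0, by simp⟩
  | add x y _ _ hx hy =>
    obtain ⟨a, ha⟩ := hx
    obtain ⟨b, hb⟩ := hy
    exact ⟨a + b, by rw [map_add, add_smul, ha, hb, add_smul]⟩
  | smul t x _ hx =>
    obtain ⟨a, ha⟩ := hx
    exact ⟨t * a, by rw [map_smul, smul_assoc, ha, mul_smul]⟩

/-- Application of a word in `L` to the generating vector of the Verma module. -/
def Verma.word (ys : List L) : Verma npos H wt :=
  (ys.map (UniversalEnvelopingAlgebra.ι ℂ)).prod • Verma.vec npos H wt

theorem Verma.word_nil : Verma.word npos H wt [] = Verma.vec npos H wt := by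
  simp [Verma.word]

theorem Verma.word_cons (y : L) (ys : List L) :
    Verma.word npos H wt (y :: ys) =
      UniversalEnvelopingAlgebra.ι ℂ y • Verma.word npos H wt ys := by
  simp [Verma.word, mul_smul]

theorem UniversalEnvelopingAlgebra.ι_smul_ι_smul {M : Type} [AddCommGroup M]
    [Module (UniversalEnvelopingAlgebra ℂ L) M] (x y : L) (m : M) :
    UniversalEnvelopingAlgebra.ι ℂ x • UniversalEnvelopingAlgebra.ι ℂ y • m =
      UniversalEnvelopingAlgebra.ι ℂ ⁅x, y⁆ • m +
        UniversalEnvelopingAlgebra.ι ℂ y • UniversalEnvelopingAlgebra.ι ℂ x • m := by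
  rw [LieHom.map_lie, Ring.lie_def, sub_smul, mul_smul, mul_smul, sub_add_cancel]

/-- The universal enveloping algebra is generated by `L`. -/
theorem UniversalEnvelopingAlgebra.smul_mem_of_forall_ι_smul_mem {M : Type} [AddCommGroup M]
    [Module ℂ M] [Module (UniversalEnvelopingAlgebra ℂ L) M]
    [IsScalarTower ℂ (UniversalEnvelopingAlgebra ℂ L) M] (S : Submodule ℂ M)
    (hS : ∀ (x : L), ∀ m ∈ S, UniversalEnvelopingAlgebra.ι ℂ x • m ∈ S)
    (u : UniversalEnvelopingAlgebra ℂ L) {m : M} (hm : m ∈ S) : u • m ∈ S := by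
  have hsurj : Function.Surjective (UniversalEnvelopingAlgebra.mkAlgHom ℂ L) :=
    fun u => Quotient.exists_rep u
  obtain ⟨t, rfl⟩ := hsurj u
  induction t using TensorAlgebra.induction generalizing m with
  | algebraMap r =>
    rw [AlgHom.commutes, algebraMap_smul]
    exact S.smul_mem r hm
  | ι x => exact hS x m hm
  | mul a b ha hb =>
    rw [map_mul, mul_smul]
    exact ha (hb hm)
  | add a b ha hb =>
    rw [map_add, add_smul]
    exact S.add_mem (ha hm) (hb hm)

variable {npos H} {Y : Set L}
  (hspan : Submodule.span ℂ ((npos : Set L) ∪ Set.range H ∪ Y) = ⊤)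

include hspan

/-- The Verma module is spanned by the words in `Y`. -/
theorem Verma.span_word_eq_top :
    Submodule.span ℂ (Verma.word npos H wt '' {ys | ∀ y ∈ ys, y ∈ Y}) = ⊤ := by
  set B := Submodule.span ℂ (Verma.word npos H wt '' {ys | ∀ y ∈ ys, y ∈ Y}) with hB
  have hY : ∀ y ∈ Y, ∀ m ∈ B, UniversalEnvelopingAlgebra.ι ℂ y • m ∈ B := by
    intro y hy m hm
    induction hm using Submodule.span_induction with
    | mem m hm =>
      obtain ⟨ys, hys, rfl⟩ := hm
      refine Submodule.subset_span ⟨y :: ys, ?_, Verma.word_cons npos H wt y ys⟩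
      intro z hz
      rcases List.mem_cons.1 hz with rfl | hz
      exacts [hy, hys _ hz]
    | zero => simp
    | add a b _ _ ha hb => rw [smul_add]; exact B.add_mem ha hb
    | smul t a _ ha => rw [smul_comm]; exact B.smul_mem t ha
  -- Induction on the length of the word, for all `x` at once, since moving `x` past a letter
  -- produces a commutator that is again arbitrary. On the empty word `hspan` plays the part of the
  -- triangular decomposition.
  have key : ∀ ys : List L, (∀ y ∈ ys, y ∈ Y) → ∀ x : L,
      UniversalEnvelopingAlgebra.ι ℂ x • Verma.word npos H wt ys ∈ B := by
    intro ys
    induction ys with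
    | nil =>
      intro _ x
      have hx : x ∈ Submodule.span ℂ ((npos : Set L) ∪ Set.range H ∪ Y) := by rw [hspan]; trivial
      have h1 : Verma.vec npos H wt ∈ B :=
        Submodule.subset_span ⟨[], by simp, Verma.word_nil npos H wt⟩
      rw [Verma.word_nil]
      induction hx using Submodule.span_induction with
      | mem x hx =>
        rcases hx with (hx | ⟨i, rfl⟩) | hx
        · rw [Verma.npos_smul_vec npos H wt hx]
          exact B.zero_mem
        · rw [Verma.cartan_smul_vec]
          exact B.smul_mem _ h1
        · exact hY x hx _ h1
      | zero => simp
      | add a b _ _ ha hb => rw [map_add, add_smul]; exact B.add_mem ha hb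
      | smul t a _ ha => rw [map_smul, smul_assoc]; exact B.smul_mem t ha
    | cons y ys ih =>
      intro hys x
      rw [Verma.word_cons, UniversalEnvelopingAlgebra.ι_smul_ι_smul]
      have hys' : ∀ y ∈ ys, y ∈ Y := fun z hz => hys z (List.mem_cons_of_mem _ hz)
      exact B.add_mem (ih hys' _) (hY y (hys y List.mem_cons_self) _ (ih hys' x))
  have hL : ∀ (x : L), ∀ m ∈ B, UniversalEnvelopingAlgebra.ι ℂ x • m ∈ B := by
    intro x m hm
    induction hm using Submodule.span_induction with
    | mem m hm =>
      obtain ⟨ys, hys, rfl⟩ := hm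
      exact key ys hys x
    | zero => simp
    | add a b _ _ ha hb => rw [smul_add]; exact B.add_mem ha hb
    | smul t a _ ha => rw [smul_comm]; exact B.smul_mem t ha
  rw [eq_top_iff]
  intro m _
  obtain ⟨u, rfl⟩ := Submodule.Quotient.mk_surjective _ m
  rw [Verma.mk_eq_smul_vec]
  exact UniversalEnvelopingAlgebra.smul_mem_of_forall_ι_smul_mem B hL u
    (Submodule.subset_span ⟨[], by simp, Verma.word_nil npos H wt⟩)

variable {δ : L} (hδ : δ ∈ Submodule.span ℂ (Set.range H))
  (hY : ∀ y ∈ Y, ∃ m : ℕ, 1 ≤ m ∧ ⁅δ, y⁆ = -(m : ℂ) • y)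

include hδ hY

/-- A nonzero Verma module has a largest proper submodule. -/
theorem Verma.radical_ne_top (hne : Verma.vec npos H wt ≠ 0) :
    Verma.radical npos H wt ≠ ⊤ := by
  obtain ⟨c, hc⟩ := Verma.exists_weight npos H wt hδ
  let T : Module.End ℂ (Verma npos H wt) :=
    Algebra.lsmul ℂ ℂ (Verma npos H wt) (UniversalEnvelopingAlgebra.ι ℂ δ)
  have hT : ∀ m, T m = UniversalEnvelopingAlgebra.ι ℂ δ • m := fun m => rfl
  -- All eigenspaces of `δ` except that of the generating vector. The goal is that every proper
  -- submodule lies in `M'`; then so does their sum, while the generating vector does not.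
  let M' : Submodule ℂ (Verma npos H wt) := ⨆ a ≠ c, T.eigenspace a
  have hvec : Verma.vec npos H wt ∈ T.eigenspace c := Module.End.mem_eigenspace_iff.2 hc
  have hdisj : Disjoint (T.eigenspace c) M' := Module.End.eigenspaces_iSupIndep T c
  have hnot : Verma.vec npos H wt ∉ M' := fun h =>
    hne (Submodule.disjoint_def.1 hdisj _ hvec h)
  -- words are weight vectors
  have hword : ∀ ys : List L, (∀ y ∈ ys, y ∈ Y) → ∃ m : ℕ, (ys ≠ [] → 1 ≤ m) ∧
      T (Verma.word npos H wt ys) = (c - m) • Verma.word npos H wt ys := by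
    intro ys
    induction ys with
    | nil =>
      intro _
      refine ⟨0, fun h => absurd rfl h, ?_⟩
      rw [Verma.word_nil, hT, hc]
      simp
    | cons y ys ih =>
      intro hys
      obtain ⟨m, -, hm⟩ := ih fun z hz => hys z (List.mem_cons_of_mem _ hz)
      obtain ⟨k, hk, hky⟩ := hY y (hys y List.mem_cons_self)
      refine ⟨k + m, fun _ => by omega, ?_⟩
      rw [hT] at hm ⊢
      rw [Verma.word_cons, UniversalEnvelopingAlgebra.ι_smul_ι_smul, hm, hky, map_smul, smul_assoc,
        smul_comm _ (c - (m : ℂ)), ← add_smul]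
      congr 1
      push_cast
      ring
  have hdec : ∀ m : Verma npos H wt, ∃ a : ℂ, ∃ m' ∈ M', m = a • Verma.vec npos H wt + m' := by
    intro m
    have hm : m ∈ Submodule.span ℂ (Verma.word npos H wt '' {ys | ∀ y ∈ ys, y ∈ Y}) := by
      rw [Verma.span_word_eq_top wt hspan]; trivial
    induction hm using Submodule.span_induction with
    | mem m hm =>
      obtain ⟨ys, hys, rfl⟩ := hm
      by_cases hnil : ys = []
      · subst hnil
        exact ⟨1, 0, M'.zero_mem, by rw [Verma.word_nil]; simp⟩
      · obtain ⟨k, hk, hky⟩ := hword ys hys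
        have hk1 := hk hnil
        refine ⟨0, _, ?_, (by rw [zero_smul, zero_add])⟩
        have hne' : c - (k : ℂ) ≠ c := by
          intro h
          have : (k : ℂ) = 0 := by linear_combination -h
          rw [Nat.cast_eq_zero] at this
          omega
        exact Submodule.mem_iSup_of_mem (c - (k : ℂ)) (Submodule.mem_iSup_of_mem hne'
          (Module.End.mem_eigenspace_iff.2 hky))
    | zero => exact ⟨0, 0, M'.zero_mem, by simp⟩
    | add x y _ _ hx hy =>
      obtain ⟨a, x', hx', rfl⟩ := hx
      obtain ⟨b, y', hy', rfl⟩ := hy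
      exact ⟨a + b, x' + y', M'.add_mem hx' hy', by rw [add_smul]; abel⟩
    | smul t x _ hx =>
      obtain ⟨a, x', hx', rfl⟩ := hx
      exact ⟨t * a, t • x', M'.smul_mem t hx', by rw [smul_add, mul_smul]⟩
  -- Such a polynomial in `δ` kills the `M'`-part of a vector and keeps a nonzero multiple of the
  -- generating vector, so a submodule with an element outside `M'` contains the generator.
  have hann : ∀ m ∈ M', ∃ p : Polynomial ℂ, p.eval c ≠ 0 ∧ Polynomial.aeval T p m = 0 := by
    intro m hm
    refine Submodule.iSup_induction (fun a => ⨆ (_ : a ≠ c), T.eigenspace a)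
      (motive := fun m => ∃ p : Polynomial ℂ, p.eval c ≠ 0 ∧ Polynomial.aeval T p m = 0) hm ?_ ?_ ?_
    · intro a x hx
      by_cases hac : a = c
      · simp only [hac, ne_eq, not_true_eq_false, iSup_false, Submodule.mem_bot] at hx
        exact ⟨1, by simp, by simp [hx]⟩
      · simp only [ne_eq, hac, not_false_eq_true, iSup_pos] at hx
        refine ⟨Polynomial.X - Polynomial.C a, ?_, ?_⟩
        · simpa [sub_eq_zero] using Ne.symm hac
        · rw [Module.End.mem_eigenspace_iff] at hx
          simp [hx, Module.algebraMap_end_apply]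
    · exact ⟨1, by simp, by simp⟩
    · rintro x y ⟨p, hp, hpx⟩ ⟨q, hq, hqy⟩
      refine ⟨p * q, by simp [hp, hq], ?_⟩
      rw [map_add, map_mul, Module.End.mul_apply, Module.End.mul_apply, hqy, map_zero, add_zero,
        ← Module.End.mul_apply, ← map_mul, mul_comm, map_mul, Module.End.mul_apply, hpx, map_zero]
  have haevec : ∀ p : Polynomial ℂ,
      Polynomial.aeval T p (Verma.vec npos H wt) = p.eval c • Verma.vec npos H wt := by
    intro p
    by_cases hz : Verma.vec npos H wt = 0
    · rw [hz]; simp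
    · exact Module.End.aeval_apply_of_hasEigenvector ⟨hvec, hz⟩
  have hle : ∀ N : Submodule (UniversalEnvelopingAlgebra ℂ L) (Verma npos H wt), N ≠ ⊤ →
      N.restrictScalars ℂ ≤ M' := by
    intro N hN m hm
    have hmN : m ∈ N := hm
    obtain ⟨a, m', hm', rfl⟩ := hdec m
    by_cases ha : a = 0
    · simpa [ha] using hm'
    exfalso
    apply hN
    obtain ⟨p, hp, hpm⟩ := hann m' hm'
    have hstab : ∀ x ∈ N, Polynomial.aeval T p x ∈ N := by
      intro x hx
      rw [Polynomial.aeval_algHom_apply]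
      exact N.smul_mem _ hx
    have h1 := hstab _ hmN
    rw [map_add, hpm, add_zero, map_smul, haevec] at h1
    have h2 : Verma.vec npos H wt ∈ N := by
      have h3 := (N.restrictScalars ℂ).smul_mem (a * p.eval c)⁻¹ h1
      rwa [smul_smul, smul_smul, mul_assoc, inv_mul_cancel₀ (mul_ne_zero ha hp), one_smul] at h3
    rw [eq_top_iff]
    intro x _
    obtain ⟨u, rfl⟩ := Submodule.Quotient.mk_surjective _ x
    rw [Verma.mk_eq_smul_vec]
    exact N.smul_mem u h2
  intro htop
  apply hnot
  have : Verma.vec npos H wt ∈ Verma.radical npos H wt := by rw [htop]; trivial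
  have hsub : ∀ x ∈ Verma.radical npos H wt, x ∈ M' := by
    intro x hx
    rw [Verma.radical, sSup_eq_iSup'] at hx
    refine Submodule.iSup_induction _ (motive := fun x => x ∈ M') hx ?_ M'.zero_mem
      (fun _ _ => M'.add_mem)
    rintro ⟨N, hN⟩ x hx
    exact hle N hN hx
  exact hsub _ this

/-- An irreducible module with a highest weight vector is the irreducible highest weight module. -/
theorem IrrHW.exists_linearMap_of_highestWeight {P : Type} [AddCommGroup P] [Module ℂ P]
    (ρ : L →ₗ⁅ℂ⁆ Module.End ℂ P) (W : Submodule ℂ P) (hW : ∀ x, ∀ m ∈ W, ρ x m ∈ W)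
    (hirr : ∀ N ≤ W, (∀ x, ∀ m ∈ N, ρ x m ∈ N) → N ≠ ⊥ → N = W)
    {v : P} (hv : v ∈ W) (hv0 : v ≠ 0) (hnv : ∀ x ∈ npos, ρ x v = 0)
    (hHv : ∀ i, ρ (H i) v = wt i • v) :
    ∃ e : IrrHW npos H wt →ₗ[ℂ] P, Function.Injective e ∧ LinearMap.range e = W ∧
      ∀ (x : L) m, e ⁅x, m⁆ = ρ x (e m) := by
  let φ : UniversalEnvelopingAlgebra ℂ L →ₐ[ℂ] Module.End ℂ P :=
    UniversalEnvelopingAlgebra.lift ℂ ρ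
  have hφι : ∀ x, φ (UniversalEnvelopingAlgebra.ι ℂ x) = ρ x :=
    UniversalEnvelopingAlgebra.lift_ι_apply' ℂ ρ
  -- The annihilator of `v`. The proof consists in showing that it equals the preimage `R` of the
  -- radical; then `u ↦ u v` descends to an injection of the irreducible quotient.
  let K : Submodule (UniversalEnvelopingAlgebra ℂ L) (UniversalEnvelopingAlgebra ℂ L) :=
    { carrier := {u | φ u v = 0}
      add_mem' := by
        intro a b ha hb
        simp only [Set.mem_ofPred_eq] at ha hb ⊢
        rw [map_add, LinearMap.add_apply, ha, hb, add_zero]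
      zero_mem' := by simp
      smul_mem' := by
        intro a b hb
        simp only [Set.mem_ofPred_eq, smul_eq_mul, map_mul, Module.End.mul_apply] at hb ⊢
        rw [hb, map_zero] }
  have hKmem : ∀ u, u ∈ K ↔ φ u v = 0 := fun u => Iff.rfl
  have hIK : vermaIdeal npos H wt ≤ K := by
    refine Submodule.span_le.2 ?_
    rintro u (⟨x, hx, rfl⟩ | ⟨i, rfl⟩)
    · exact (congrArg (· v) (hφι x)).trans (hnv x hx)
    · change φ _ v = 0
      rw [map_sub, hφι, AlgHom.commutes, LinearMap.sub_apply, hHv, Module.algebraMap_end_apply,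
        sub_self]
  have h1K : (1 : UniversalEnvelopingAlgebra ℂ L) ∉ K := by
    rw [hKmem, map_one]
    exact hv0
  have hvec : Verma.vec npos H wt ≠ 0 := by
    intro h
    rw [Verma.vec, Submodule.Quotient.mk_eq_zero] at h
    exact h1K (hIK h)
  have hR := Verma.radical_ne_top wt hspan hδ hY hvec
  have hle1 : ∀ u ∈ K, (Submodule.Quotient.mk u : Verma npos H wt) ∈ Verma.radical npos H wt := by
    intro u hu
    have hN : K.map (vermaIdeal npos H wt).mkQ ≠ ⊤ := by
      intro h
      apply h1K
      have h1 : Submodule.Quotient.mk 1 ∈ K.map (vermaIdeal npos H wt).mkQ := by rw [h]; trivial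
      obtain ⟨k, hk, hk1⟩ := h1
      have := hIK ((Submodule.Quotient.eq _).1 hk1)
      simpa using K.sub_mem hk this
    exact (le_sSup (a := K.map (vermaIdeal npos H wt).mkQ) hN : _ ≤ Verma.radical npos H wt)
      ⟨u, hu, rfl⟩
  let Ψ : UniversalEnvelopingAlgebra ℂ L →ₗ[ℂ] P := (LinearMap.applyₗ v).comp φ.toLinearMap
  have hΨ : ∀ u, Ψ u = φ u v := fun u => rfl
  have hΨι : ∀ x u, Ψ (UniversalEnvelopingAlgebra.ι ℂ x * u) = ρ x (Ψ u) := by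
    intro x u
    rw [hΨ, hΨ, map_mul, hφι, Module.End.mul_apply]
  have hΨW : ∀ u, Ψ u ∈ W := by
    intro u
    have h := UniversalEnvelopingAlgebra.smul_mem_of_forall_ι_smul_mem (W.comap Ψ)
      (fun x m hm => by
        rw [Submodule.mem_comap, smul_eq_mul, hΨι]
        exact hW x _ hm) u (m := 1) (by
        rw [Submodule.mem_comap, hΨ, map_one]
        exact hv)
    simpa using h
  let R : Submodule (UniversalEnvelopingAlgebra ℂ L) (UniversalEnvelopingAlgebra ℂ L) :=
    (Verma.radical npos H wt).comap (vermaIdeal npos H wt).mkQ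
  have hKR : K ≤ R := hle1
  have h1R : (1 : UniversalEnvelopingAlgebra ℂ L) ∉ R := by
    intro h
    apply hR
    rw [eq_top_iff]
    intro x _
    obtain ⟨u, rfl⟩ := Submodule.Quotient.mk_surjective _ x
    rw [Verma.mk_eq_smul_vec]
    exact Submodule.smul_mem _ u h
  have hRK : R ≤ K := by
    -- `R v` is a submodule of the irreducible `W`. If it were nonzero it would contain `v = u v`
    -- with `u ∈ R`; then `1 - u ∈ K ≤ R` would put `1` in `R`.
    have hbot : (R.restrictScalars ℂ).map Ψ = ⊥ := by
      by_contra hne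
      have heq := hirr ((R.restrictScalars ℂ).map Ψ)
        (by rintro _ ⟨u, -, rfl⟩; exact hΨW u)
        (by
          rintro x _ ⟨u, hu, rfl⟩
          exact ⟨_, R.smul_mem (UniversalEnvelopingAlgebra.ι ℂ x) hu, hΨι x u⟩) hne
      rw [← heq] at hv
      obtain ⟨u, hu, huv⟩ := hv
      apply h1R
      have h2 : 1 - u ∈ K := by
        rw [hKmem, ← hΨ, map_sub, huv, hΨ, map_one]
        exact sub_self v
      simpa using R.add_mem (hKR h2) hu
    intro u hu
    rw [hKmem, ← hΨ, ← Submodule.mem_bot ℂ, ← hbot]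
    exact ⟨u, hu, rfl⟩
  let π : UniversalEnvelopingAlgebra ℂ L →ₗ[ℂ] IrrHW npos H wt :=
    ((Verma.radical npos H wt).mkQ.comp (vermaIdeal npos H wt).mkQ).restrictScalars ℂ
  have hπs : Function.Surjective π :=
    (Submodule.mkQ_surjective _).comp (Submodule.mkQ_surjective _)
  have hπ0 : ∀ u, π u = 0 ↔ Ψ u = 0 := by
    intro u
    have h1 : π u = 0 ↔ u ∈ R := Submodule.Quotient.mk_eq_zero _
    exact h1.trans ⟨fun h => hRK h, fun h => hKR h⟩
  have hπι : ∀ x u, π (UniversalEnvelopingAlgebra.ι ℂ x * u) = ⁅x, π u⁆ := fun x u => rfl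
  have hker : LinearMap.ker π ≤ LinearMap.ker Ψ := fun u hu => (hπ0 u).1 hu
  let e : IrrHW npos H wt →ₗ[ℂ] P :=
    ((LinearMap.ker π).liftQ Ψ hker).comp (π.quotKerEquivOfSurjective hπs).symm.toLinearMap
  have he : ∀ u, e (π u) = Ψ u := by
    intro u
    have : (π.quotKerEquivOfSurjective hπs).symm (π u) = Submodule.Quotient.mk u := by
      rw [LinearEquiv.symm_apply_eq]
      rfl
    change (LinearMap.ker π).liftQ Ψ hker ((π.quotKerEquivOfSurjective hπs).symm (π u)) = _
    rw [this]
    rfl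
  have hint : ∀ (x : L) m, e ⁅x, m⁆ = ρ x (e m) := by
    intro x m
    obtain ⟨u, rfl⟩ := hπs m
    rw [← hπι, he, he, hΨι]
  refine ⟨e, ?_, ?_, hint⟩
  · rw [injective_iff_map_eq_zero]
    intro m hm
    obtain ⟨u, rfl⟩ := hπs m
    rw [he] at hm
    exact (hπ0 u).2 hm
  · have hev : v ∈ LinearMap.range e := ⟨π 1, by rw [he, hΨ, map_one]; rfl⟩
    refine hirr _ ?_ ?_ ?_
    · rintro _ ⟨m, rfl⟩
      obtain ⟨u, rfl⟩ := hπs m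
      rw [he]
      exact hΨW u
    · rintro x _ ⟨m, rfl⟩
      exact ⟨_, hint x m⟩
    · intro h
      rw [h] at hev
      exact hv0 hev

end HighestWeightUniqueness

/-! ### Harmonic polynomials and the action of derivatives and special conformal fields -/

section HarmonicPolynomials

open MvPolynomial

variable {n : ℕ}

theorem C_two : (C 2 : MvPolynomial (Fin n) ℂ) = 2 := map_ofNat C 2

theorem sum_derivation_apply {ι : Type} (s : Finset ι)
    (d : ι → Derivation ℂ (MvPolynomial (Fin n) ℂ) (MvPolynomial (Fin n) ℂ))
    (f : MvPolynomial (Fin n) ℂ) : (∑ i ∈ s, d i) f = ∑ i ∈ s, d i f := by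
  classical
  induction s using Finset.induction_on with
  | empty => simp
  | insert a s ha ih => rw [Finset.sum_insert ha, Finset.sum_insert ha, Derivation.add_apply, ih]

/-- The quadric `∑ X_b ^ 2`. -/
noncomputable def rsq (n : ℕ) : MvPolynomial (Fin n) ℂ := ∑ b, X b * X b

/-- The Laplace operator. -/
noncomputable def lap (n : ℕ) : MvPolynomial (Fin n) ℂ →ₗ[ℂ] MvPolynomial (Fin n) ℂ :=
  ∑ b, (pderiv b).toLinearMap.comp (pderiv b).toLinearMap

/-- The Euler operator. -/
noncomputable def euler (n : ℕ) : Derivation ℂ (MvPolynomial (Fin n) ℂ) (MvPolynomial (Fin n) ℂ) :=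
  mkDerivation ℂ X

theorem lap_apply (f : MvPolynomial (Fin n) ℂ) : lap n f = ∑ b, pderiv b (pderiv b f) := by
  simp [lap]

@[simp]
theorem euler_X (b : Fin n) : euler n (X b) = X b := mkDerivation_X _ _ _

theorem pderiv_pderiv_comm (a b : Fin n) (f : MvPolynomial (Fin n) ℂ) :
    pderiv a (pderiv b f) = pderiv b (pderiv a f) := by
  have h : ⁅(pderiv a : Derivation ℂ (MvPolynomial (Fin n) ℂ) (MvPolynomial (Fin n) ℂ)),
      (pderiv b : Derivation ℂ (MvPolynomial (Fin n) ℂ) (MvPolynomial (Fin n) ℂ))⁆ = 0 := by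
    refine derivation_ext fun c => ?_
    rw [Derivation.commutator_apply]
    simp [pderiv_X, Pi.single_apply, apply_ite]
  have := congrArg (· f) h
  simpa [Derivation.commutator_apply, sub_eq_zero] using this

theorem pderiv_euler (b : Fin n) (f : MvPolynomial (Fin n) ℂ) :
    pderiv b (euler n f) = euler n (pderiv b f) + pderiv b f := by
  have h : ⁅(pderiv b : Derivation ℂ (MvPolynomial (Fin n) ℂ) (MvPolynomial (Fin n) ℂ)),
      euler n⁆ = pderiv b := by
    refine derivation_ext fun c => ?_
    rw [Derivation.commutator_apply]
    simp [pderiv_X, Pi.single_apply, apply_ite]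
  have := congrArg (· f) h
  rw [Derivation.commutator_apply] at this
  linear_combination this

theorem euler_apply (f : MvPolynomial (Fin n) ℂ) : euler n f = ∑ b, X b * pderiv b f := by
  have h : euler n = ∑ b, (X b : MvPolynomial (Fin n) ℂ) • pderiv b := by
    refine derivation_ext fun c => ?_
    rw [sum_derivation_apply]
    simp [pderiv_X, Pi.single_apply]
  rw [h, sum_derivation_apply]
  rfl

theorem coeff_euler (f : MvPolynomial (Fin n) ℂ) (m : Fin n →₀ ℕ) :
    coeff m (euler n f) = (m.degree : ℂ) * coeff m f := by
  induction f using MvPolynomial.induction_on' with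
  | monomial d a =>
    rw [euler_apply]
    simp_rw [X_mul_pderiv_monomial]
    rw [← Finset.sum_smul, coeff_smul, coeff_monomial]
    split_ifs with h
    · subst h
      rw [Finsupp.degree_eq_sum, nsmul_eq_mul]
    · simp
  | add p q hp hq => rw [map_add, coeff_add, hp, hq, coeff_add, mul_add]

theorem euler_eigen_coeff {f : MvPolynomial (Fin n) ℂ} {c : ℂ} (hf : euler n f = c • f)
    (m : Fin n →₀ ℕ) (hm : coeff m f ≠ 0) : (m.degree : ℂ) = c := by
  have := congrArg (coeff m) hf
  rw [coeff_euler, coeff_smul, smul_eq_mul] at this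
  exact mul_right_cancel₀ hm this

theorem isHomogeneous_of_euler {f : MvPolynomial (Fin n) ℂ} {l : ℕ}
    (hf : euler n f = (l : ℂ) • f) : f.IsHomogeneous l := by
  intro m hm
  have := euler_eigen_coeff hf m hm
  rw [Nat.cast_inj] at this
  rw [← this, Finsupp.degree_eq_weight_one]
  rfl

theorem eq_C_of_euler_zero {f : MvPolynomial (Fin n) ℂ} (hf : euler n f = 0) :
    f = C (coeff 0 f) := by
  have h := isHomogeneous_of_euler (f := f) (l := 0) (by simpa using hf)
  rw [← totalDegree_zero_iff_isHomogeneous] at h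
  exact totalDegree_eq_zero_iff_eq_C.1 h

theorem pderiv_rsq (b : Fin n) : pderiv b (rsq n) = 2 * X b := by
  simp [rsq, Derivation.leibniz, pderiv_X, Pi.single_apply, two_mul, Finset.sum_add_distrib]

theorem euler_rsq : euler n (rsq n) = 2 * rsq n := by
  simp [rsq, Derivation.leibniz, two_mul, Finset.sum_add_distrib]

theorem euler_rsq_pow (k : ℕ) : euler n (rsq n ^ k) = (2 * k : ℂ) • rsq n ^ k := by
  induction k with
  | zero => simp
  | succ k ih =>
    rw [pow_succ, Derivation.leibniz, ih, euler_rsq]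
    simp only [smul_eq_mul, smul_eq_C_mul]
    simp [C_two]
    ring

theorem rsq_ne_zero (hn : 0 < n) : rsq n ≠ 0 := by
  intro h
  have := congrArg (pderiv (⟨0, hn⟩ : Fin n)) (congrArg (pderiv (⟨0, hn⟩ : Fin n)) h)
  rw [pderiv_rsq, show (2 : MvPolynomial (Fin n) ℂ) = C 2 from C_two.symm, pderiv_C_mul] at this
  rw [pderiv_X_self, mul_one] at this
  simp at this

theorem lap_pderiv (b : Fin n) (f : MvPolynomial (Fin n) ℂ) :
    lap n (pderiv b f) = pderiv b (lap n f) := by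
  simp_rw [lap_apply, map_sum, pderiv_pderiv_comm _ b]

theorem lap_X_mul (b : Fin n) (f : MvPolynomial (Fin n) ℂ) :
    lap n (X b * f) = X b * lap n f + 2 * pderiv b f := by
  have h : ∀ c, pderiv c (pderiv c (X b * f)) =
      X b * pderiv c (pderiv c f) + if c = b then 2 * pderiv c f else 0 := by
    intro c
    by_cases hc : c = b
    · subst hc
      simp [Derivation.leibniz]
      ring
    · simp [Derivation.leibniz, pderiv_X_of_ne (Ne.symm hc), hc]
  simp_rw [lap_apply, h, Finset.sum_add_distrib, Finset.mul_sum]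
  simp

/-- The `sl₂` relation `[Δ, r²] = 4 euler + 2n`, obtained by summing the commutators of `Δ` with
each `X_b²`. It determines the constants of the harmonic projection and of the Casimir operator. -/
theorem lap_rsq_mul (f : MvPolynomial (Fin n) ℂ) :
    lap n (rsq n * f) = rsq n * lap n f + 4 * euler n f + (2 * n : ℂ) • f := by
  have h : ∀ b, lap n (X b * X b * f) =
      X b * X b * lap n f + 4 * (X b * pderiv b f) + (2 : ℂ) • f := by
    intro b
    rw [mul_assoc, lap_X_mul, lap_X_mul, Derivation.leibniz]
    simp [smul_eq_C_mul, C_two]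
    ring
  rw [rsq, Finset.sum_mul, map_sum]
  simp_rw [h, Finset.sum_add_distrib]
  rw [← Finset.sum_mul, ← Finset.mul_sum, ← euler_apply]
  simp [smul_eq_C_mul, C_two]
  ring

/-- Harmonic polynomials that are homogeneous of degree `l`. -/
noncomputable def harm (n l : ℕ) : Submodule ℂ (MvPolynomial (Fin n) ℂ) where
  carrier := {h | euler n h = (l : ℂ) • h ∧ lap n h = 0}
  add_mem' := by
    rintro a b ⟨ha, ha'⟩ ⟨hb, hb'⟩
    exact ⟨by rw [map_add, ha, hb, smul_add], by rw [map_add, ha', hb', add_zero]⟩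
  zero_mem' := by simp
  smul_mem' := by
    rintro c a ⟨ha, ha'⟩
    exact ⟨by rw [Derivation.map_smul, ha, smul_comm], by rw [map_smul, ha', smul_zero]⟩

theorem mem_harm {l : ℕ} {h : MvPolynomial (Fin n) ℂ} :
    h ∈ harm n l ↔ euler n h = (l : ℂ) • h ∧ lap n h = 0 := Iff.rfl

theorem one_mem_harm : (1 : MvPolynomial (Fin n) ℂ) ∈ harm n 0 := by
  simp [mem_harm, lap_apply]

theorem finiteDimensional_of_le_harm {l : ℕ} {N : Submodule ℂ (MvPolynomial (Fin n) ℂ)}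
    (hN : N ≤ harm n l) : FiniteDimensional ℂ N := by
  have : FiniteDimensional ℂ (homogeneousSubmodule (Fin n) ℂ l) :=
    Module.Finite.of_fg (homogeneousSubmodule_fg (Fin n) ℂ l)
  exact Submodule.finiteDimensional_of_le
    (S₂ := homogeneousSubmodule (Fin n) ℂ l) fun h hh => isHomogeneous_of_euler (hN hh).1

theorem pderiv_mem_harm {l : ℕ} {h : MvPolynomial (Fin n) ℂ} (hh : h ∈ harm n (l + 1))
    (b : Fin n) : pderiv b h ∈ harm n l := by
  constructor
  · have := pderiv_euler b h
    rw [hh.1, Derivation.map_smul] at this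
    rw [← sub_eq_iff_eq_add] at this
    rw [← this]
    push_cast
    rw [add_smul, one_smul, add_sub_cancel_right]
  · rw [lap_pderiv, hh.2, map_zero]

theorem pderiv_harm_zero {h : MvPolynomial (Fin n) ℂ} (hh : h ∈ harm n 0) (b : Fin n) :
    pderiv b h = 0 := by
  rw [eq_C_of_euler_zero (f := h) (by simpa using hh.1), pderiv_C]

theorem euler_pderiv_harm {l : ℕ} {h : MvPolynomial (Fin n) ℂ} (hh : h ∈ harm n l) (b : Fin n) :
    euler n (pderiv b h) = (l - 1 : ℂ) • pderiv b h := by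
  cases l with
  | zero => rw [pderiv_harm_zero hh]; simp
  | succ l => rw [(pderiv_mem_harm hh b).1]; push_cast; rw [add_sub_cancel_right]

theorem harm_coeff_ne_zero (hn : 3 ≤ n) (l : ℕ) : (n + 2 * l - 2 : ℂ) ≠ 0 := by
  have : (n + 2 * l - 2 : ℂ) = ((n - 2 + 2 * l : ℕ) : ℂ) := by
    rw [Nat.cast_add, Nat.cast_sub (by omega)]
    push_cast
    ring
  rw [this]
  exact Nat.cast_ne_zero.2 (by omega)

/-- The harmonic projection of `X_b h`. -/
noncomputable def harmX (l : ℕ) (b : Fin n) (h : MvPolynomial (Fin n) ℂ) :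
    MvPolynomial (Fin n) ℂ :=
  X b * h - (n + 2 * l - 2 : ℂ)⁻¹ • (rsq n * pderiv b h)

/-- The constant is forced: `Δ(X_b h) = 2 ∂_b h`, and since `∂_b h` is harmonic of degree `l - 1`,
`Δ(r² ∂_b h) = (4(l - 1) + 2n) ∂_b h = 2(n + 2l - 2) ∂_b h`. -/
theorem harmX_mem (hn : 3 ≤ n) {l : ℕ} {h : MvPolynomial (Fin n) ℂ} (hh : h ∈ harm n l)
    (b : Fin n) : harmX l b h ∈ harm n (l + 1) := by
  have hc := harm_coeff_ne_zero hn l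
  constructor
  · rw [harmX, map_sub, Derivation.map_smul, Derivation.leibniz, Derivation.leibniz, hh.1,
      euler_pderiv_harm hh, euler_rsq, euler_X]
    simp only [smul_eq_mul, smul_eq_C_mul]
    simp
    ring
  · rw [harmX, map_sub, map_smul, lap_X_mul, lap_rsq_mul, hh.2, lap_pderiv, hh.2,
      euler_pderiv_harm hh]
    have : (4 : MvPolynomial (Fin n) ℂ) * (l - 1 : ℂ) • pderiv b h + (2 * n : ℂ) • pderiv b h =
        (n + 2 * l - 2 : ℂ) • (2 * pderiv b h) := by
      simp only [smul_eq_C_mul]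
      simp [C_two]
      ring
    rw [map_zero, mul_zero, mul_zero, zero_add, zero_add, this, smul_smul, inv_mul_cancel₀ hc,
      one_smul, sub_self]

/-- The span of the spaces `|x|^{2k} H_l` with `k ∈ J`. -/
noncomputable def polyModule (n : ℕ) (J : Set ℕ) : Submodule ℂ (MvPolynomial (Fin n) ℂ) :=
  Submodule.span ℂ {f | ∃ k ∈ J, ∃ l, ∃ h ∈ harm n l, f = rsq n ^ k * h}

theorem rsq_pow_mul_mem {J : Set ℕ} {k l : ℕ} (hk : k ∈ J) {h : MvPolynomial (Fin n) ℂ}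
    (hh : h ∈ harm n l) : rsq n ^ k * h ∈ polyModule n J :=
  Submodule.subset_span ⟨k, hk, l, h, hh, rfl⟩

theorem rsq_pow_mul_pderiv_mem {J : Set ℕ} {k l : ℕ} (hk : k ∈ J) {h : MvPolynomial (Fin n) ℂ}
    (hh : h ∈ harm n l) (b : Fin n) : rsq n ^ k * pderiv b h ∈ polyModule n J := by
  cases l with
  | zero => rw [pderiv_harm_zero hh, mul_zero]; exact Submodule.zero_mem _
  | succ l => exact rsq_pow_mul_mem hk (pderiv_mem_harm hh b)

/-- Leibniz, with `X_b h` replaced by its harmonic projection plus the `r²`-correction. This is a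
formal identity, so `h` need not be harmonic; the exponent `k + 1` avoids truncated subtraction. -/
theorem pderiv_rsq_pow_succ_mul {k l : ℕ} (b : Fin n) (h : MvPolynomial (Fin n) ℂ) :
    pderiv b (rsq n ^ (k + 1) * h) = (2 * (k + 1) : ℂ) • (rsq n ^ k * harmX l b h) +
      (2 * (k + 1) * (n + 2 * l - 2 : ℂ)⁻¹ + 1) • (rsq n ^ (k + 1) * pderiv b h) := by
  rw [pderiv_mul, pderiv_pow, pderiv_rsq, harmX]
  simp only [smul_eq_C_mul, map_mul, map_add, map_one, Nat.add_sub_cancel]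
  simp [C_two]
  ring

/-- A derivative lowers the power of `r²` by at most one, so a downward closed `J` suffices. -/
theorem pderiv_mem_polyModule (hn : 3 ≤ n) {J : Set ℕ} (hJ : ∀ k, k + 1 ∈ J → k ∈ J) (b : Fin n)
    {f : MvPolynomial (Fin n) ℂ} (hf : f ∈ polyModule n J) : pderiv b f ∈ polyModule n J := by
  induction hf using Submodule.span_induction with
  | mem f hf =>
    obtain ⟨k, hk, l, h, hh, rfl⟩ := hf
    cases k with
    | zero =>
      have := rsq_pow_mul_pderiv_mem hk hh b
      simpa using this
    | succ k =>
      rw [pderiv_rsq_pow_succ_mul (l := l)]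
      exact Submodule.add_mem _
        (Submodule.smul_mem _ _ (rsq_pow_mul_mem (hJ k hk) (harmX_mem hn hh b)))
        (Submodule.smul_mem _ _ (rsq_pow_mul_pderiv_mem hk hh b))
  | zero => simp
  | add x y _ _ hx hy => rw [map_add]; exact Submodule.add_mem _ hx hy
  | smul t x _ hx => rw [Derivation.map_smul]; exact Submodule.smul_mem _ _ hx

theorem euler_rsq_pow_mul {k l : ℕ} {h : MvPolynomial (Fin n) ℂ} (hh : h ∈ harm n l) :
    euler n (rsq n ^ k * h) = (l + 2 * k : ℂ) • (rsq n ^ k * h) := by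
  rw [Derivation.leibniz, hh.1, euler_rsq_pow]
  simp only [smul_eq_mul, smul_eq_C_mul]
  simp [C_two]
  ring

theorem euler_mem_polyModule {J : Set ℕ}
    {f : MvPolynomial (Fin n) ℂ} (hf : f ∈ polyModule n J) : euler n f ∈ polyModule n J := by
  induction hf using Submodule.span_induction with
  | mem f hf =>
    obtain ⟨k, hk, l, h, hh, rfl⟩ := hf
    rw [euler_rsq_pow_mul hh]
    exact Submodule.smul_mem _ _ (rsq_pow_mul_mem hk hh)
  | zero => simp
  | add x y _ _ hx hy => rw [map_add]; exact Submodule.add_mem _ hx hy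
  | smul t x _ hx => rw [Derivation.map_smul]; exact Submodule.smul_mem _ _ hx

/-- The operator by which the special conformal transformations act. -/
noncomputable def conf (c : ℂ) (b : Fin n) :
    MvPolynomial (Fin n) ℂ →ₗ[ℂ] MvPolynomial (Fin n) ℂ :=
  (2 : ℂ) • (LinearMap.mulLeft ℂ (X b)).comp ((euler n).toLinearMap + c • LinearMap.id) -
    (LinearMap.mulLeft ℂ (rsq n)).comp (pderiv b).toLinearMap

theorem conf_apply (c : ℂ) (b : Fin n) (f : MvPolynomial (Fin n) ℂ) :
    conf c b f = (2 : ℂ) • (X b * (euler n f + c • f)) - rsq n * pderiv b f := by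
  simp [conf]

/-- This formula is the source of the dichotomy. By Euler and Leibniz the left side is `2(k + l + c)
r^{2k} X_b h - r^{2k+2} ∂_b h`; splitting `X_b h` into its harmonic projection and its `r²`-part
gives the two coefficients. Whether the second one vanishes depends on `k` and `c` but not on `l`,
so an entire row is cut off from the next. -/
theorem conf_rsq_pow_mul (hn : 3 ≤ n) (c : ℂ) (b : Fin n) {k l : ℕ} {h : MvPolynomial (Fin n) ℂ}
    (hh : h ∈ harm n l) :
    conf c b (rsq n ^ k * h) = (2 * (k + l + c) : ℂ) • (rsq n ^ k * harmX l b h) +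
      ((2 * k + 2 * c + 2 - n) * (n + 2 * l - 2 : ℂ)⁻¹) • (rsq n ^ (k + 1) * pderiv b h) := by
  have hc := harm_coeff_ne_zero hn l
  have e : (2 * k + 2 * c + 2 - n) * (n + 2 * l - 2 : ℂ)⁻¹ =
      2 * (k + l + c) * (n + 2 * l - 2 : ℂ)⁻¹ - 1 := by
    field_simp
    ring
  rw [conf_apply, euler_rsq_pow_mul hh, e, harmX, pderiv_mul, pderiv_pow, pderiv_rsq]
  cases k with
  | zero =>
    simp only [smul_eq_C_mul, map_mul, map_add, map_sub]
    simp [C_two]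
    ring
  | succ k =>
    simp only [smul_eq_C_mul, map_mul, map_add, map_sub, Nat.add_sub_cancel]
    simp [C_two]
    ring

theorem conf_mem_polyModule (hn : 3 ≤ n) {J : Set ℕ} (c : ℂ)
    (hJ : ∀ k ∈ J, 2 * (k : ℂ) + 2 * c + 2 - n ≠ 0 → k + 1 ∈ J) (b : Fin n)
    {f : MvPolynomial (Fin n) ℂ} (hf : f ∈ polyModule n J) : conf c b f ∈ polyModule n J := by
  induction hf using Submodule.span_induction with
  | mem f hf =>
    obtain ⟨k, hk, l, h, hh, rfl⟩ := hf
    rw [conf_rsq_pow_mul hn c b hh]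
    refine Submodule.add_mem _
      (Submodule.smul_mem _ _ (rsq_pow_mul_mem hk (harmX_mem hn hh b))) ?_
    by_cases h0 : 2 * (k : ℂ) + 2 * c + 2 - n = 0
    · rw [h0, zero_mul, zero_smul]
      exact Submodule.zero_mem _
    · exact Submodule.smul_mem _ _ (rsq_pow_mul_pderiv_mem (hJ k hk h0) hh b)
  | zero => simp
  | add x y _ _ hx hy => rw [map_add]; exact Submodule.add_mem _ hx hy
  | smul t x _ hx => rw [map_smul]; exact Submodule.smul_mem _ _ hx

end HarmonicPolynomials

/-! ### Irreducibility of the polynomial module and independence of its layers -/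

section PolyModule

open MvPolynomial

variable {n : ℕ}

/-- Euler's formula; the `r²`-corrections add up to a multiple of `r² Δh = 0`. It shows that
`H_{l+1}` is reached from `H_l` by harmonic projections of `X_b h`. -/
theorem sum_harmX_pderiv {l : ℕ} {h : MvPolynomial (Fin n) ℂ}
    (hh : h ∈ harm n (l + 1)) : ∑ b, harmX l b (pderiv b h) = (l + 1 : ℂ) • h := by
  simp_rw [harmX, Finset.sum_sub_distrib, ← euler_apply, ← Finset.smul_sum, ← Finset.mul_sum,
    ← lap_apply, hh.2, mul_zero, smul_zero, sub_zero]
  rw [hh.1]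
  push_cast
  rfl

/-- Contracting with `X_b` isolates the invariant part: this is how `r^{2(k+1)}` itself is reached
from the layer `r^{2k} H_1`, unless row `k` is the last one. -/
theorem sum_conf_rsq_pow_mul_X (c : ℂ) (k : ℕ) :
    ∑ b, conf c b (rsq n ^ k * X b) = (2 * k + 2 * c + 2 - n : ℂ) • rsq n ^ (k + 1) := by
  have h : ∀ b : Fin n, conf c b (rsq n ^ k * X b) =
      (4 * k + 2 * c + 2 : ℂ) • (rsq n ^ k * (X b * X b)) -
        (rsq n ^ (k + 1) + (2 * k : ℂ) • (rsq n ^ k * (X b * X b))) := by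
    intro b
    rw [conf_apply, Derivation.leibniz, euler_rsq_pow, pderiv_mul, pderiv_pow, pderiv_rsq,
      pderiv_X_self, euler_X]
    cases k with
    | zero =>
      simp only [smul_eq_C_mul, map_mul, map_add]
      simp [C_two]
      ring
    | succ k =>
      simp only [smul_eq_C_mul, map_mul, map_add, Nat.add_sub_cancel, smul_eq_mul]
      simp [C_two, show (C 4 : MvPolynomial (Fin n) ℂ) = 4 from map_ofNat C 4]
      ring
  simp_rw [h, Finset.sum_sub_distrib, Finset.sum_add_distrib, ← Finset.smul_sum, ← Finset.mul_sum]
  rw [show (∑ b : Fin n, X b * X b : MvPolynomial (Fin n) ℂ) = rsq n from rfl]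
  simp only [smul_eq_C_mul, map_add, map_mul, map_sub]
  simp [C_two, show (C 4 : MvPolynomial (Fin n) ℂ) = 4 from map_ofNat C 4]
  ring

theorem X_mem_harm (b : Fin n) : (X b : MvPolynomial (Fin n) ℂ) ∈ harm n 1 := by
  constructor
  · simp
  · have := lap_X_mul b (1 : MvPolynomial (Fin n) ℂ)
    simpa [lap_apply] using this

/-- A submodule containing `1` and stable under the special conformal transformations contains
every `|x|^{2k} H_l` that can be reached. -/
theorem rsq_pow_mul_mem_of_one_mem (hn : 3 ≤ n) {J : Set ℕ} (c : ℂ) (hc : ∀ m : ℕ, (m : ℂ) + c ≠ 0)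
    (hJ : ∀ k, k + 1 ∈ J → k ∈ J)
    (hJ' : ∀ k ∈ J, k + 1 ∈ J ↔ 2 * (k : ℂ) + 2 * c + 2 - n ≠ 0)
    {N : Submodule ℂ (MvPolynomial (Fin n) ℂ)} (hN : ∀ b, ∀ f ∈ N, conf c b f ∈ N)
    (h1 : 1 ∈ N) (d : ℕ) : ∀ l k : ℕ, l + 2 * k = d → k ∈ J → ∀ h ∈ harm n l,
      rsq n ^ k * h ∈ N := by
  -- Outer induction on the degree `l + 2k`, inner induction on `l`: `conf` applied one degree lower
  -- yields the wanted element up to an error with the same degree but larger `k` and smaller `l`.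
  induction d using Nat.strong_induction_on with
  | _ d ihd =>
  intro l
  induction l using Nat.strong_induction_on with
  | _ l ihl =>
  intro k hd hk h hh
  cases l with
  | zero =>
    rw [eq_C_of_euler_zero (f := h) (by simpa using hh.1), mul_comm, ← smul_eq_C_mul]
    refine N.smul_mem _ ?_
    cases k with
    | zero => simpa using h1
    | succ k =>
      have hk' := hJ k hk
      have h0 := (hJ' k hk').1 hk
      have hmem : ∑ b, conf c b (rsq n ^ k * X b) ∈ N :=
        N.sum_mem fun b _ => hN b _ (ihd (1 + 2 * k) (by omega) 1 k rfl hk' _ (X_mem_harm b))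
      rw [sum_conf_rsq_pow_mul_X] at hmem
      exact (N.smul_mem_iff h0).1 hmem
  | succ l =>
    have hl1 : ((l : ℂ) + 1) ≠ 0 := Nat.cast_add_one_ne_zero l
    rw [← N.smul_mem_iff hl1, ← mul_smul_comm, ← sum_harmX_pderiv hh, Finset.mul_sum]
    refine N.sum_mem fun b _ => ?_
    have hb := pderiv_mem_harm hh b
    have e := conf_rsq_pow_mul hn c b (k := k) hb
    have hα : (2 * (k + l + c) : ℂ) ≠ 0 := by
      have := hc (k + l)
      push_cast at this
      exact mul_ne_zero two_ne_zero this
    rw [← N.smul_mem_iff hα, ← sub_eq_of_eq_add e]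
    refine N.sub_mem (hN b _ (ihd (l + 2 * k) (by omega) l k rfl hk _ hb)) ?_
    -- On the last row the error term has coefficient zero; otherwise `k + 1 ∈ J` and the inner
    -- induction covers it.
    by_cases h0 : 2 * (k : ℂ) + 2 * c + 2 - n = 0
    · rw [h0, zero_mul, zero_smul]
      exact N.zero_mem
    · refine N.smul_mem _ ?_
      cases l with
      | zero => rw [pderiv_harm_zero hb, mul_zero]; exact N.zero_mem
      | succ l =>
        exact ihl l (by omega) (k + 1) (by omega) ((hJ' k hk).2 h0) _ (pderiv_mem_harm hb b)

/-- A nonzero polynomial whose derivatives all vanish is a nonzero constant, and any other has a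
nonzero derivative of smaller degree. -/
theorem one_mem_of_pderiv_mem {N : Submodule ℂ (MvPolynomial (Fin n) ℂ)}
    (hN : ∀ b, ∀ f ∈ N, pderiv b f ∈ N) (h0 : N ≠ ⊥) : 1 ∈ N := by
  obtain ⟨f, hf, hf0⟩ := N.exists_mem_ne_zero_of_ne_bot h0
  induction hd : f.totalDegree using Nat.strong_induction_on generalizing f with
  | _ d ih =>
  by_cases hz : ∀ b, pderiv b f = 0
  · have hC := eq_C_of_euler_zero (f := f) (by simp [euler_apply, hz])
    rw [hC] at hf
    have hc : coeff 0 f ≠ 0 := by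
      intro h
      rw [h, C_0] at hC
      exact hf0 hC
    rw [← N.smul_mem_iff hc, smul_eq_C_mul, mul_one]
    exact hf
  · push Not at hz
    obtain ⟨b, hb⟩ := hz
    refine ih _ ?_ (pderiv b f) (hN b f hf) hb rfl
    have : (pderiv b f).totalDegree < f.totalDegree := by
      obtain ⟨m, hm, hmd⟩ := (pderiv b f).support.exists_mem_eq_sup
        (support_nonempty.2 hb) (fun s => s.sum fun _ e => e)
      rw [totalDegree, hmd]
      rw [mem_support_iff, coeff_pderiv] at hm
      have := le_totalDegree (mem_support_iff.2 (left_ne_zero_of_mul hm))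
      rw [Finsupp.sum_add_index' (by simp) (by simp)] at this
      simp at this
      omega
    omega

theorem polyModule_irreducible (hn : 3 ≤ n) {J : Set ℕ} (c : ℂ) (hc : ∀ m : ℕ, (m : ℂ) + c ≠ 0)
    (hJ : ∀ k, k + 1 ∈ J → k ∈ J)
    (hJ' : ∀ k ∈ J, k + 1 ∈ J ↔ 2 * (k : ℂ) + 2 * c + 2 - n ≠ 0)
    {N : Submodule ℂ (MvPolynomial (Fin n) ℂ)} (hle : N ≤ polyModule n J)
    (hN : ∀ b, ∀ f ∈ N, conf c b f ∈ N) (hN' : ∀ b, ∀ f ∈ N, pderiv b f ∈ N) (h0 : N ≠ ⊥) :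
    N = polyModule n J := by
  refine le_antisymm hle (Submodule.span_le.2 ?_)
  rintro _ ⟨k, hk, l, h, hh, rfl⟩
  exact rsq_pow_mul_mem_of_one_mem hn c hc hJ hJ' hN (one_mem_of_pderiv_mem hN' h0) _ l k rfl hk h hh

/-- The space `|x|^{2k} H_l`. -/
noncomputable def layer (n l k : ℕ) : Submodule ℂ (MvPolynomial (Fin n) ℂ) :=
  (harm n l).map (LinearMap.mulLeft ℂ (rsq n ^ k))

theorem mem_layer {l k : ℕ} {f : MvPolynomial (Fin n) ℂ} :
    f ∈ layer n l k ↔ ∃ h ∈ harm n l, rsq n ^ k * h = f := Iff.rfl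

theorem iSup_layer {κ : Type} (g : κ → ℕ) :
    ⨆ p : ℕ × κ, layer n p.1 (g p.2) = polyModule n (Set.range g) := by
  apply le_antisymm
  · refine iSup_le ?_
    rintro ⟨l, i⟩ _ ⟨h, hh, rfl⟩
    exact rsq_pow_mul_mem (Set.mem_range_self i) hh
  · refine Submodule.span_le.2 ?_
    rintro _ ⟨_, ⟨i, rfl⟩, l, h, hh, rfl⟩
    exact Submodule.mem_iSup_of_mem (l, i) (mem_layer.2 ⟨h, hh, rfl⟩)

/-- An operator that separates the spaces `|x|^{2k} H_l`. -/
noncomputable def sepOp (n : ℕ) : Module.End ℂ (MvPolynomial (Fin n) ℂ) :=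
  (euler n).toLinearMap + Complex.I • ((euler n).toLinearMap.comp (euler n).toLinearMap +
    (n - 2 : ℂ) • (euler n).toLinearMap - (LinearMap.mulLeft ℂ (rsq n)).comp (lap n))

/-- The operator is, up to sign, the Casimir operator of `so(n)`. It commutes with `r²`, so the
eigenvalue on `H_l` does not change with `k`. -/
theorem casimir_rsq_pow_mul {l : ℕ} (k : ℕ) {h : MvPolynomial (Fin n) ℂ} (hh : h ∈ harm n l) :
    euler n (euler n (rsq n ^ k * h)) + (n - 2 : ℂ) • euler n (rsq n ^ k * h) -
      rsq n * lap n (rsq n ^ k * h) = (l * (l + n - 2) : ℂ) • (rsq n ^ k * h) := by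
  induction k with
  | zero =>
    rw [pow_zero, one_mul, hh.1, Derivation.map_smul, hh.1, hh.2, mul_zero, sub_zero, smul_smul,
      smul_smul, ← add_smul]
    congr 1
    ring
  | succ k ih =>
    have e := euler_rsq_pow_mul (k := k) hh
    have e' := euler_rsq_pow_mul (k := k + 1) hh
    rw [e, Derivation.map_smul, e] at ih
    rw [e', Derivation.map_smul, e', pow_succ', mul_assoc, lap_rsq_mul, e]
    rw [sub_eq_iff_eq_add] at ih
    rw [mul_add, mul_add, ← sub_eq_of_eq_add' ih]
    push_cast
    simp only [smul_eq_C_mul, map_add, map_mul, map_sub]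
    simp [C_two]
    ring

theorem layer_le_eigenspace (l k : ℕ) :
    layer n l k ≤ (sepOp n).eigenspace ((l + 2 * k : ℂ) + Complex.I * (l * (l + n - 2))) := by
  rintro _ ⟨h, hh, rfl⟩
  rw [Module.End.mem_eigenspace_iff, LinearMap.mulLeft_apply, add_smul, mul_smul,
    ← casimir_rsq_pow_mul k hh, ← euler_rsq_pow_mul hh]
  rfl

/-- The eigenvalues of `sepOp` are pairwise distinct: the imaginary part `l(l + n - 2)` determines
`l ≥ 0`, and the real part `l + 2k` then determines `k`. The factor `i` packs two real invariants
into a single operator. -/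
theorem iSupIndep_layer (hn : 3 ≤ n) {κ : Type} {g : κ → ℕ} (hg : Function.Injective g) :
    iSupIndep fun p : ℕ × κ => layer n p.1 (g p.2) := by
  have hinj : Function.Injective fun p : ℕ × κ =>
      ((p.1 + 2 * g p.2 : ℂ) + Complex.I * (p.1 * (p.1 + n - 2))) := by
    rintro ⟨l, i⟩ ⟨l', i'⟩ h
    have hn' : (3 : ℝ) ≤ n := by exact_mod_cast hn
    have hre := congrArg Complex.re h
    have him := congrArg Complex.im h
    simp at hre him
    have hl : (l : ℝ) = l' := by
      have h0 : (0 : ℝ) ≤ l := Nat.cast_nonneg l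
      have h0' : (0 : ℝ) ≤ l' := Nat.cast_nonneg l'
      have : ((l : ℝ) - l') * (l + l' + n - 2) = 0 := by linear_combination him
      rcases mul_eq_zero.1 this with h | h
      · linarith
      · linarith
    rw [hl] at hre
    have hk : (g i : ℝ) = g i' := by linarith
    exact Prod.ext (Nat.cast_injective hl) (hg (Nat.cast_injective hk))
  exact ((sepOp n).eigenspaces_iSupIndep.comp hinj).mono fun p => layer_le_eigenspace _ _

end PolyModule

/-! ### The Fischer inner product and two linear algebra tools -/

section Fischer

open MvPolynomial ComplexConjugate

variable {n : ℕ}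

/-- The weight `m!` of a monomial in the Fischer inner product. -/
def fischerWeight (m : Fin n →₀ ℕ) : ℕ := ∏ i, (m i).factorial

theorem fischerWeight_pos (m : Fin n →₀ ℕ) : 0 < fischerWeight m :=
  Finset.prod_pos fun _ _ => Nat.factorial_pos _

theorem fischerWeight_add_single (m : Fin n →₀ ℕ) (b : Fin n) :
    fischerWeight (m + Finsupp.single b 1) = fischerWeight m * (m b + 1) := by
  rw [fischerWeight, fischerWeight, ← Finset.mul_prod_erase _ _ (Finset.mem_univ b),
    ← Finset.mul_prod_erase _ (fun i => (m i).factorial) (Finset.mem_univ b)]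
  have : ∀ i ∈ Finset.univ.erase b,
      ((m + Finsupp.single b 1 : Fin n →₀ ℕ) i).factorial = (m i).factorial := by
    intro i hi
    rw [Finsupp.add_apply, Finsupp.single_eq_of_ne (Finset.ne_of_mem_erase hi), add_zero]
  rw [Finset.prod_congr rfl this, Finsupp.add_apply, Finsupp.single_eq_same, Nat.factorial_succ]
  ring

/-- The Fischer inner product, for which `X_b` and `∂_b` are adjoint. -/
noncomputable def fischer (f g : MvPolynomial (Fin n) ℂ) : ℂ :=
  ∑ m ∈ f.support, (fischerWeight m : ℂ) * (conj (coeff m f) * coeff m g)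

theorem fischer_eq_sum {f : MvPolynomial (Fin n) ℂ} {s : Finset (Fin n →₀ ℕ)}
    (hs : f.support ⊆ s) (g : MvPolynomial (Fin n) ℂ) :
    fischer f g = ∑ m ∈ s, (fischerWeight m : ℂ) * (conj (coeff m f) * coeff m g) := by
  refine Finset.sum_subset hs fun m _ hm => ?_
  rw [notMem_support_iff.1 hm]
  simp

theorem fischer_conj (f g : MvPolynomial (Fin n) ℂ) : conj (fischer g f) = fischer f g := by
  classical
  rw [fischer_eq_sum (f := g) (Finset.subset_union_right (s₁ := f.support)),
    fischer_eq_sum (f := f) (Finset.subset_union_left (s₂ := g.support)), map_sum]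
  refine Finset.sum_congr rfl fun m _ => ?_
  rw [map_mul, map_mul, Complex.conj_conj, map_natCast]
  ring

theorem fischer_add_right (f g h : MvPolynomial (Fin n) ℂ) :
    fischer f (g + h) = fischer f g + fischer f h := by
  simp [fischer, mul_add, Finset.sum_add_distrib]

theorem fischer_smul_right (f g : MvPolynomial (Fin n) ℂ) (c : ℂ) :
    fischer f (c • g) = c * fischer f g := by
  rw [fischer, fischer, Finset.mul_sum]
  refine Finset.sum_congr rfl fun m _ => ?_
  simp
  ring

/-- The linear form `fischer f`. -/
noncomputable def fischerₗ (f : MvPolynomial (Fin n) ℂ) : MvPolynomial (Fin n) ℂ →ₗ[ℂ] ℂ where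
  toFun := fischer f
  map_add' := fischer_add_right f
  map_smul' c g := fischer_smul_right f g c

theorem fischerₗ_apply (f g : MvPolynomial (Fin n) ℂ) : fischerₗ f g = fischer f g := rfl

theorem fischer_add_left (f g h : MvPolynomial (Fin n) ℂ) :
    fischer (f + g) h = fischer f h + fischer g h := by
  rw [← fischer_conj, fischer_add_right, map_add, fischer_conj, fischer_conj]

theorem fischer_smul_left (f g : MvPolynomial (Fin n) ℂ) (c : ℂ) :
    fischer (c • f) g = conj c * fischer f g := by
  rw [← fischer_conj, fischer_smul_right, map_mul, fischer_conj]

/-- The ratio of the weights of `m + e_b` and `m` is `m_b + 1`, exactly the factor produced by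
differentiation. -/
theorem fischer_X_mul_left (b : Fin n) (f g : MvPolynomial (Fin n) ℂ) :
    fischer (X b * f) g = fischer f (pderiv b g) := by
  rw [fischer, fischer, support_X_mul, Finset.sum_map]
  refine Finset.sum_congr rfl fun m _ => ?_
  rw [addLeftEmbedding_apply, add_comm, coeff_pderiv, fischerWeight_add_single, mul_comm (X b),
    coeff_mul_X]
  push_cast
  ring

theorem fischer_X_mul_right (b : Fin n) (f g : MvPolynomial (Fin n) ℂ) :
    fischer f (X b * g) = fischer (pderiv b f) g := by
  rw [← fischer_conj, fischer_X_mul_left, fischer_conj]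

theorem fischer_self (f : MvPolynomial (Fin n) ℂ) :
    fischer f f = ((∑ m ∈ f.support, (fischerWeight m : ℝ) * Complex.normSq (coeff m f) : ℝ) : ℂ) := by
  rw [fischer, Complex.ofReal_sum]
  refine Finset.sum_congr rfl fun m _ => ?_
  rw [← Complex.normSq_eq_conj_mul_self]
  push_cast
  rfl

theorem fischer_self_re_nonneg (f : MvPolynomial (Fin n) ℂ) : 0 ≤ (fischer f f).re := by
  rw [fischer_self, Complex.ofReal_re]
  exact Finset.sum_nonneg fun m _ => mul_nonneg (Nat.cast_nonneg _) (Complex.normSq_nonneg _)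

theorem eq_zero_of_fischer_self_re {f : MvPolynomial (Fin n) ℂ} (hf : (fischer f f).re = 0) :
    f = 0 := by
  rw [fischer_self, Complex.ofReal_re, Finset.sum_eq_zero_iff_of_nonneg fun m _ =>
    mul_nonneg (Nat.cast_nonneg _) (Complex.normSq_nonneg _)] at hf
  ext m
  by_contra hm
  rw [coeff_zero] at hm
  rcases mul_eq_zero.1 (hf m (mem_support_iff.2 hm)) with h | h
  · rw [Nat.cast_eq_zero] at h
    exact (fischerWeight_pos m).ne' h
  · exact hm (Complex.normSq_eq_zero.1 h)

/-- The Fischer inner product as an inner product space structure. -/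
noncomputable abbrev fischerCore (n : ℕ) : InnerProductSpace.Core ℂ (MvPolynomial (Fin n) ℂ) where
  inner := fischer
  conj_inner_symm := fischer_conj
  re_inner_nonneg := fischer_self_re_nonneg
  add_left := fischer_add_left
  smul_left f g c := fischer_smul_left f g c
  definite f hf := eq_zero_of_fischer_self_re (by
    change fischer f f = 0 at hf
    rw [hf, Complex.zero_re])

/-- Orthogonal projection onto `N`, which exists without completeness of `V` because `N` is finite
dimensional. The norm is installed only inside the proof. -/
theorem InnerProductSpace.Core.exists_orthogonal_sub {V : Type} [AddCommGroup V] [Module ℂ V]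
    (c : InnerProductSpace.Core ℂ V) (N : Submodule ℂ V) [FiniteDimensional ℂ N] (f : V) :
    ∃ g ∈ N, ∀ x ∈ N, c.inner x (f - g) = 0 := by
  let _ := c.toNormedAddCommGroup
  let _ := InnerProductSpace.ofCore c.toCore
  refine ⟨N.starProjection f, N.starProjection_apply_mem f, fun x hx => ?_⟩
  exact N.sub_starProjection_mem_orthogonal f x hx

/-- Otherwise `μ, μ + 1, μ + 2, …` would all be eigenvalues on a finite-dimensional space. Any
operator preserving `N` and raising eigenvalues by one must kill the vector `g`, so it serves as a
highest weight vector. -/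
theorem exists_maximal_eigenvector {V : Type} [AddCommGroup V] [Module ℂ V] (T : Module.End ℂ V)
    (N : Submodule ℂ V) [FiniteDimensional ℂ N] (hN : N ≠ ⊥) (hT : ∀ x ∈ N, T x ∈ N) :
    ∃ (μ : ℂ) (g : V), g ∈ N ∧ g ≠ 0 ∧ T g = μ • g ∧ ∀ x ∈ N, T x = (μ + 1) • x → x = 0 := by
  by_contra hcon
  push Not at hcon
  have : Nontrivial N := Submodule.nontrivial_iff_ne_bot.2 hN
  let S : Module.End ℂ N := T.restrict hT
  obtain ⟨μ, hμ⟩ := Module.End.exists_eigenvalue S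
  have hstep : ∀ ν, S.HasEigenvalue ν → S.HasEigenvalue (ν + 1) := by
    intro ν hν
    obtain ⟨g, hg⟩ := hν.exists_hasEigenvector
    obtain ⟨x, hx, hTx, hx0⟩ := hcon ν g g.2 (fun h => hg.2 (Subtype.ext h))
      (congrArg Subtype.val hg.apply_eq_smul)
    exact Module.End.hasEigenvalue_of_hasEigenvector (x := ⟨x, hx⟩)
      ⟨Module.End.mem_eigenspace_iff.2 (Subtype.ext hTx), fun h => hx0 (congrArg Subtype.val h)⟩
  have hall : ∀ k : ℕ, S.HasEigenvalue (μ + k) := by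
    intro k
    induction k with
    | zero => simpa using hμ
    | succ k ih =>
      have := hstep _ ih
      push_cast
      rwa [← add_assoc]
  refine Set.infinite_of_injective_forall_mem (f := fun k : ℕ => μ + (k : ℂ)) ?_ hall
    (Module.End.finite_hasEigenvalue S)
  intro a b hab
  exact Nat.cast_injective (add_left_cancel hab)

end Fischer

/-! ### Irreducibility of the harmonic polynomials under rotations -/

section HarmonicIrreducible

open MvPolynomial ComplexConjugate

variable {n : ℕ}

/-- Infinitesimal rotations. -/
noncomputable def rot (a b : Fin n) :
    Derivation ℂ (MvPolynomial (Fin n) ℂ) (MvPolynomial (Fin n) ℂ) :=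
  (X b : MvPolynomial (Fin n) ℂ) • pderiv a - (X a : MvPolynomial (Fin n) ℂ) • pderiv b

theorem rot_apply (a b : Fin n) (f : MvPolynomial (Fin n) ℂ) :
    rot a b f = X b * pderiv a f - X a * pderiv b f := rfl

/-- Rotations are skew because `X_b` and `∂_b` are adjoint; hence the orthogonal complement of a
rotation-stable space is rotation-stable. -/
theorem fischer_rot (a b : Fin n) (f g : MvPolynomial (Fin n) ℂ) :
    fischer f (rot a b g) = - fischer (rot a b f) g := by
  have h : ∀ a b, fischer f (X b * pderiv a g) = fischer (X a * pderiv b f) g := by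
    intro a b
    rw [fischer_X_mul_right, fischer_X_mul_left]
  have e : rot a b f = X b * pderiv a f + (-1 : ℂ) • (X a * pderiv b f) := by
    rw [rot_apply, neg_one_smul]
    ring
  have e' : rot a b g = X b * pderiv a g + (-1 : ℂ) • (X a * pderiv b g) := by
    rw [rot_apply, neg_one_smul]
    ring
  rw [e, e', fischer_add_right, fischer_smul_right, fischer_add_left, fischer_smul_left, h, h]
  simp

theorem rot_mem_harm {l : ℕ} {h : MvPolynomial (Fin n) ℂ} (hh : h ∈ harm n l) (a b : Fin n) :
    rot a b h ∈ harm n l := by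
  constructor
  · rw [rot_apply, map_sub, Derivation.leibniz, Derivation.leibniz, euler_pderiv_harm hh,
      euler_pderiv_harm hh, euler_X, euler_X]
    simp only [smul_eq_mul, smul_eq_C_mul, map_sub]
    simp
    ring
  · rw [rot_apply, map_sub, lap_X_mul, lap_X_mul, lap_pderiv, lap_pderiv, hh.2, map_zero,
      map_zero, pderiv_pderiv_comm a b]
    ring

theorem rot_rsq_pow (a b : Fin n) (k : ℕ) : rot a b (rsq n ^ k) = 0 := by
  rw [rot_apply, pderiv_pow, pderiv_pow, pderiv_rsq, pderiv_rsq]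
  ring

theorem rot_rsq_pow_mul (a b : Fin n) (k : ℕ) (h : MvPolynomial (Fin n) ℂ) :
    rot a b (rsq n ^ k * h) = rsq n ^ k * rot a b h := by
  rw [Derivation.leibniz, rot_rsq_pow, smul_zero, add_zero, smul_eq_mul]

variable (i₀ i₁ : Fin n)

/-- The isotropic linear form `X_0 + i X_1`. -/
noncomputable def isoForm : MvPolynomial (Fin n) ℂ := X i₀ + Complex.I • X i₁

/-- The derivative in the direction `e_0 + i e_1`. -/
noncomputable def isoDeriv : Derivation ℂ (MvPolynomial (Fin n) ℂ) (MvPolynomial (Fin n) ℂ) :=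
  pderiv i₀ + Complex.I • pderiv i₁

/-- The derivative in the direction `e_0 - i e_1`. -/
noncomputable def isoDeriv' : Derivation ℂ (MvPolynomial (Fin n) ℂ) (MvPolynomial (Fin n) ℂ) :=
  pderiv i₀ - Complex.I • pderiv i₁

theorem isoDeriv_apply (f : MvPolynomial (Fin n) ℂ) :
    isoDeriv i₀ i₁ f = pderiv i₀ f + Complex.I • pderiv i₁ f := rfl

theorem isoDeriv'_apply (f : MvPolynomial (Fin n) ℂ) :
    isoDeriv' i₀ i₁ f = pderiv i₀ f - Complex.I • pderiv i₁ f := rfl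

theorem C_I_mul_C_I : (C Complex.I * C Complex.I : MvPolynomial (Fin n) ℂ) = -1 := by
  rw [← C_mul, Complex.I_mul_I, C_neg, C_1]

/-- The adjoint of multiplication by `X_0 + i X_1` carries the conjugate coefficient `-i`. -/
theorem fischer_isoForm_mul (f g : MvPolynomial (Fin n) ℂ) :
    fischer f (isoForm i₀ i₁ * g) = fischer (isoDeriv' i₀ i₁ f) g := by
  have e : isoDeriv' i₀ i₁ f = pderiv i₀ f + (-Complex.I) • pderiv i₁ f := by
    rw [isoDeriv'_apply, neg_smul, sub_eq_add_neg]
  rw [e, isoForm, add_mul, smul_mul_assoc, fischer_add_right, fischer_smul_right,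
    fischer_X_mul_right, fischer_X_mul_right, fischer_add_left, fischer_smul_left]
  simp

variable {i₀ i₁}

theorem sum_eq_add_add_sum_sdiff {M : Type} [AddCommMonoid M] (h : i₀ ≠ i₁) (f : Fin n → M) :
    ∑ b, f b = f i₀ + f i₁ + ∑ b ∈ Finset.univ \ {i₀, i₁}, f b := by
  rw [← Finset.sum_pair h, add_comm, Finset.sum_sdiff (Finset.subset_univ _)]

theorem isoDeriv_isoForm (h : i₀ ≠ i₁) : isoDeriv i₀ i₁ (isoForm i₀ i₁) = 0 := by
  rw [isoDeriv_apply, isoForm, map_add, map_add, Derivation.map_smul, Derivation.map_smul,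
    pderiv_X_self, pderiv_X_self, pderiv_X_of_ne h, pderiv_X_of_ne h.symm]
  simp [smul_smul]

theorem isoForm_ne_zero (h : i₀ ≠ i₁) : isoForm i₀ i₁ ≠ (0 : MvPolynomial (Fin n) ℂ) := by
  intro h0
  have := congrArg (pderiv i₀) h0
  rw [isoForm, map_add, Derivation.map_smul, pderiv_X_self, pderiv_X_of_ne h.symm] at this
  simp at this

/-- The form is isotropic: its gradient direction `e_0 + i e_1` annihilates it, so the cross term of
the Laplacian vanishes. -/
theorem isoForm_pow_mem_harm (h : i₀ ≠ i₁) (l : ℕ) : isoForm i₀ i₁ ^ l ∈ harm n l := by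
  have hE : euler n (isoForm i₀ i₁) = isoForm i₀ i₁ := by
    rw [isoForm, map_add, Derivation.map_smul, euler_X, euler_X]
  induction l with
  | zero => simpa using one_mem_harm
  | succ l ih =>
    constructor
    · rw [pow_succ, Derivation.leibniz, ih.1, hE]
      simp only [smul_eq_C_mul, smul_eq_mul]
      simp
      ring
    · rw [pow_succ', isoForm, add_mul, smul_mul_assoc, map_add, map_smul, lap_X_mul, lap_X_mul]
      rw [← isoForm, ih.2]
      have : isoDeriv i₀ i₁ (isoForm i₀ i₁ ^ l) = 0 := by
        rw [Derivation.leibniz_pow, isoDeriv_isoForm h, smul_zero, smul_zero]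
      rw [isoDeriv_apply] at this
      rw [mul_zero, mul_zero, zero_add, zero_add, ← mul_smul_comm, ← mul_add, this, mul_zero]

/-- A polynomial that only depends on `X_0 + i X_1`. -/
theorem eq_smul_isoForm_pow (h : i₀ ≠ i₁) (l : ℕ) {g : MvPolynomial (Fin n) ℂ}
    (hg : euler n g = (l : ℂ) • g) (hd : isoDeriv i₀ i₁ g = 0)
    (hb : ∀ b, b ≠ i₀ → b ≠ i₁ → pderiv b g = 0) : ∃ c : ℂ, g = c • isoForm i₀ i₁ ^ l := by
  induction l generalizing g with
  | zero =>
    refine ⟨coeff 0 g, ?_⟩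
    rw [pow_zero, smul_eq_C_mul, mul_one]
    exact eq_C_of_euler_zero (by simpa using hg)
  | succ l ih =>
    have hd0 : pderiv i₀ g = - (Complex.I • pderiv i₁ g) := by
      rw [isoDeriv_apply] at hd
      exact eq_neg_of_add_eq_zero_left hd
    -- Euler's formula has only the terms for `i₀` and `i₁`, and `∂_1 g = i ∂_0 g` merges them; the
    -- induction then applies to `∂_0 g`.
    have hE : ((l + 1 : ℕ) : ℂ) • g = isoForm i₀ i₁ * pderiv i₀ g := by
      rw [← hg, euler_apply, sum_eq_add_add_sum_sdiff h, Finset.sum_eq_zero, add_zero, isoForm, hd0]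
      · simp only [smul_eq_C_mul]
        linear_combination (X i₁ * pderiv i₁ g) * C_I_mul_C_I
      · intro b hb'
        simp only [Finset.mem_sdiff, Finset.mem_univ, true_and, Finset.mem_insert,
          Finset.mem_singleton, not_or] at hb'
        rw [hb b hb'.1 hb'.2, mul_zero]
    obtain ⟨c, hc⟩ := ih (g := pderiv i₀ g) (by
        have := pderiv_euler i₀ g
        rw [hg, Derivation.map_smul, ← sub_eq_iff_eq_add] at this
        rw [← this]
        push_cast
        rw [add_smul, one_smul, add_sub_cancel_right]) (by
        rw [isoDeriv_apply, pderiv_pderiv_comm i₁ i₀, ← Derivation.map_smul, ← map_add,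
          ← isoDeriv_apply, hd, map_zero]) (by
        intro b h0 h1
        rw [pderiv_pderiv_comm, hb b h0 h1, map_zero])
    have hl : ((l + 1 : ℕ) : ℂ) ≠ 0 := Nat.cast_ne_zero.2 (Nat.succ_ne_zero l)
    refine ⟨((l + 1 : ℕ) : ℂ)⁻¹ * c, ?_⟩
    rw [mul_smul, pow_succ', ← mul_smul_comm, ← hc, ← hE, smul_smul, inv_mul_cancel₀ hl, one_smul]

/-- A harmonic polynomial killed by the operators `rot b 0 + i rot b 1` only depends on
`X_0 + i X_1`. -/
theorem isoDeriv_eq_zero_of_raising (hn : 3 ≤ n) (h : i₀ ≠ i₁) {g : MvPolynomial (Fin n) ℂ}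
    (hg : lap n g = 0)
    (hb : ∀ b, b ≠ i₀ → b ≠ i₁ → isoForm i₀ i₁ * pderiv b g = X b * isoDeriv i₀ i₁ g) :
    isoDeriv i₀ i₁ g = 0 := by
  set G := isoDeriv i₀ i₁ g with hG
  -- The two-dimensional Laplacian factors as `(∂_0 - i ∂_1)(∂_0 + i ∂_1)`.
  have hL : pderiv i₀ (pderiv i₀ g) + pderiv i₁ (pderiv i₁ g) = isoDeriv' i₀ i₁ G := by
    rw [hG, isoDeriv_apply, isoDeriv'_apply, map_add, map_add, Derivation.map_smul,
      Derivation.map_smul, pderiv_pderiv_comm i₁ i₀]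
    simp only [smul_eq_C_mul]
    linear_combination (pderiv i₁ (pderiv i₁ g)) * C_I_mul_C_I
  have hz : ∀ b, b ≠ i₀ → b ≠ i₁ → pderiv b (isoForm i₀ i₁) = 0 := by
    intro b h0 h1
    rw [isoForm, map_add, Derivation.map_smul, pderiv_X_of_ne h0.symm, pderiv_X_of_ne h1.symm,
      smul_zero, add_zero]
  have hs : ∀ b ∈ Finset.univ \ {i₀, i₁}, isoForm i₀ i₁ * pderiv b (pderiv b g) =
      G + X b * pderiv b G := by
    intro b hb'
    simp only [Finset.mem_sdiff, Finset.mem_univ, true_and, Finset.mem_insert,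
      Finset.mem_singleton, not_or] at hb'
    have := congrArg (pderiv b) (hb b hb'.1 hb'.2)
    rw [pderiv_mul, pderiv_mul, hz b hb'.1 hb'.2, pderiv_X_self, zero_mul, zero_add, one_mul] at this
    exact this
  -- This is `(X_0 + i X_1) Δg = 0`, the other second derivatives being rewritten by differentiating
  -- `hb`. Pairing with `G` gives `‖isoDeriv' G‖² + ∑_b (‖G‖² + ‖∂_b G‖²) = 0`; since `n ≥ 3` the
  -- sum is not empty and `G = 0`.
  have key : isoForm i₀ i₁ * isoDeriv' i₀ i₁ G +
      ∑ b ∈ Finset.univ \ {i₀, i₁}, (G + X b * pderiv b G) = 0 := by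
    rw [← Finset.sum_congr rfl hs, ← Finset.mul_sum, ← mul_add, ← hL, ← sum_eq_add_add_sum_sdiff h
      (fun b => pderiv b (pderiv b g)), ← lap_apply, hg, mul_zero]
  have hF := congrArg (fun F => (fischerₗ G F).re) key
  simp only [map_add, map_sum, map_zero, fischerₗ_apply, fischer_isoForm_mul, fischer_X_mul_right,
    Complex.add_re, Complex.re_sum, Complex.zero_re] at hF
  have hcard : 0 < (Finset.univ \ {i₀, i₁} : Finset (Fin n)).card := by
    rw [Finset.card_sdiff_of_subset (Finset.subset_univ _), Finset.card_pair h, Finset.card_univ,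
      Fintype.card_fin]
    omega
  obtain ⟨b, hb'⟩ := Finset.card_pos.1 hcard
  have h1 : (fischer G G).re + (fischer (pderiv b G) (pderiv b G)).re ≤
      ∑ b ∈ Finset.univ \ {i₀, i₁}, ((fischer G G).re + (fischer (pderiv b G) (pderiv b G)).re) :=
    Finset.single_le_sum (f := fun b => (fischer G G).re + (fischer (pderiv b G) (pderiv b G)).re)
      (fun c _ => add_nonneg (fischer_self_re_nonneg _) (fischer_self_re_nonneg _)) hb'
  have h2 := fischer_self_re_nonneg (isoDeriv' i₀ i₁ G)
  have h3 := fischer_self_re_nonneg (pderiv b G)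
  have h4 := fischer_self_re_nonneg G
  exact eq_zero_of_fischer_self_re (by linarith)

/-- The operators `rot b 0 + i rot b 1` raise the eigenvalue of `i rot 0 1` by one, so they kill an
eigenvector of maximal eigenvalue; harmonicity then leaves only multiples of `(X_0 + i X_1)^l`. -/
theorem isoForm_pow_mem (hn : 3 ≤ n) (h : i₀ ≠ i₁) {l : ℕ}
    {N : Submodule ℂ (MvPolynomial (Fin n) ℂ)} (hle : N ≤ harm n l) (h0 : N ≠ ⊥)
    (hrot : ∀ a b, ∀ f ∈ N, rot a b f ∈ N) : isoForm i₀ i₁ ^ l ∈ N := by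
  have := finiteDimensional_of_le_harm hle
  obtain ⟨μ, g, hgN, hg0, hgμ, hmax⟩ := exists_maximal_eigenvector
    (Complex.I • (rot i₀ i₁).toLinearMap) N h0 (fun x hx => N.smul_mem _ (hrot _ _ x hx))
  change Complex.I • rot i₀ i₁ g = μ • g at hgμ
  have hraise : ∀ b, b ≠ i₀ → b ≠ i₁ → rot b i₀ g + Complex.I • rot b i₁ g = 0 := by
    intro b hb0 hb1
    refine hmax _ (N.add_mem (hrot _ _ _ hgN) (N.smul_mem _ (hrot _ _ _ hgN))) ?_
    have hc : ⁅Complex.I • rot i₀ i₁, rot b i₀ + Complex.I • rot b i₁⁆ =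
        rot b i₀ + Complex.I • rot b i₁ := by
      refine derivation_ext fun c => ?_
      rw [Derivation.commutator_apply]
      simp only [Derivation.add_apply, Derivation.smul_apply, rot_apply, map_add, map_sub,
        Derivation.map_smul, Derivation.leibniz, pderiv_X, Pi.single_apply, smul_eq_mul]
      by_cases hc0 : c = i₀
      · subst hc0
        simp [h, hb0, hb1, h.symm, hb0.symm, hb1.symm, smul_smul]
      · by_cases hc1 : c = i₁
        · subst hc1
          simp [h, hb0, hb1, h.symm, hb0.symm, hb1.symm]
        · by_cases hcb : c = b
          · subst hcb
            simp [h, h.symm, hb0, hb1, hb0.symm, hb1.symm, smul_smul]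
            exact add_comm _ _
          · simp [hc0, hc1, hcb]
    have hc' := congrArg (fun D => D g) hc
    rw [Derivation.commutator_apply] at hc'
    simp only [Derivation.add_apply, Derivation.smul_apply, hgμ, Derivation.map_smul] at hc'
    change Complex.I • rot i₀ i₁ (rot b i₀ g + Complex.I • rot b i₁ g) = _
    rw [← sub_eq_zero] at hc' ⊢
    rw [← hc']
    module
  have hgh := hle hgN
  have hb : ∀ b, b ≠ i₀ → b ≠ i₁ → isoForm i₀ i₁ * pderiv b g = X b * isoDeriv i₀ i₁ g := by
    intro b hb0 hb1
    have := hraise b hb0 hb1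
    rw [rot_apply, rot_apply] at this
    rw [isoForm, isoDeriv_apply]
    simp only [smul_eq_C_mul] at this ⊢
    linear_combination this
  have hd := isoDeriv_eq_zero_of_raising hn h hgh.2 hb
  obtain ⟨c, rfl⟩ := eq_smul_isoForm_pow h l hgh.1 hd (fun b hb0 hb1 => by
    have := hb b hb0 hb1
    rw [hd, mul_zero] at this
    exact (mul_eq_zero.1 this).resolve_left (isoForm_ne_zero h))
  exact (N.smul_mem_iff (fun hc => hg0 (by rw [hc, zero_smul]))).1 hgN

/-- The harmonic polynomials of degree `l` form an irreducible representation of the rotations. -/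
theorem harm_irreducible (hn : 3 ≤ n) {l : ℕ}
    {N : Submodule ℂ (MvPolynomial (Fin n) ℂ)} (hle : N ≤ harm n l) (h0 : N ≠ ⊥)
    (hrot : ∀ a b, ∀ f ∈ N, rot a b f ∈ N) : N = harm n l := by
  refine le_antisymm hle fun f hf => ?_
  by_contra hfN
  have := finiteDimensional_of_le_harm hle
  obtain ⟨g, hg, hort⟩ := (fischerCore n).exists_orthogonal_sub N f
  have h : (⟨0, by omega⟩ : Fin n) ≠ ⟨1, by omega⟩ := by simp
  -- The orthogonal complement of `N` in the harmonic space. If it were nonzero, `N` and `N'` would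
  -- both contain the power of the isotropic form, which would then be orthogonal to itself.
  let N' : Submodule ℂ (MvPolynomial (Fin n) ℂ) :=
    harm n l ⊓ ⨅ x : N, LinearMap.ker (fischerₗ (x : MvPolynomial (Fin n) ℂ))
  have hN' : ∀ y, y ∈ N' ↔ y ∈ harm n l ∧ ∀ x ∈ N, fischer x y = 0 := by
    intro y
    simp [N', fischerₗ_apply]
  have hne : N' ≠ ⊥ := by
    rw [Submodule.ne_bot_iff]
    refine ⟨f - g, (hN' _).2 ⟨Submodule.sub_mem _ hf (hle hg), hort⟩, fun he => hfN ?_⟩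
    rw [sub_eq_zero.1 he]
    exact hg
  have h1 := isoForm_pow_mem hn h hle h0 hrot
  have h2 := isoForm_pow_mem hn h (N := N') inf_le_left hne (by
    intro a b y hy
    rw [hN'] at hy ⊢
    refine ⟨rot_mem_harm hy.1 a b, fun x hx => ?_⟩
    rw [fischer_rot, hy.2 _ (hrot a b x hx), neg_zero])
  have h3 := ((hN' _).1 h2).2 _ h1
  exact pow_ne_zero l (isoForm_ne_zero h)
    (eq_zero_of_fischer_self_re (by rw [h3, Complex.zero_re]))

end HarmonicIrreducible

/-! ### The conformal action of the orthogonal Lie algebra on polynomials -/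

section ConformalRepresentation

open MvPolynomial

variable {n : ℕ}

/-- The diagonal entries of the form `η`. -/
def etaSign (n : ℕ) : Fin 2 ⊕ Fin n → ℂ := Sum.elim 1 (-1)

theorem etaSign_mul_self (i : Fin 2 ⊕ Fin n) : etaSign n i * etaSign n i = 1 := by
  rcases i with i | i <;> simp [etaSign]

theorem indefiniteDiagonal_eq :
    LieAlgebra.Orthogonal.indefiniteDiagonal (Fin 2) (Fin n) ℂ = Matrix.diagonal (etaSign n) := rfl

theorem soC_skew (A : soC n) : A.1.transpose * Matrix.diagonal (etaSign n) =
    -(Matrix.diagonal (etaSign n) * A.1) := by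
  have h : A.1 ∈ skewAdjointMatricesLieSubalgebra _ := A.2
  rw [mem_skewAdjointMatricesLieSubalgebra, mem_skewAdjointMatricesSubmodule,
    Matrix.IsSkewAdjoint, Matrix.IsAdjointPair] at h
  rw [← indefiniteDiagonal_eq, h, mul_neg]

theorem soC_skew_apply (A : soC n) (i j : Fin 2 ⊕ Fin n) :
    etaSign n i * A.1 i j = -(etaSign n j * A.1 j i) := by
  have := congrFun (congrFun (soC_skew A) i) j
  rw [Matrix.mul_diagonal, Matrix.neg_apply, Matrix.diagonal_mul, Matrix.transpose_apply] at this
  linear_combination this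

/-- The parametrization of the null cone of `η` by `z ∈ ℂ^n`. -/
noncomputable def nullVec (n : ℕ) : Fin 2 ⊕ Fin n → MvPolynomial (Fin n) ℂ :=
  Sum.elim ![(1 / 2 : ℂ) • (1 + rsq n), (Complex.I / 2) • (rsq n - 1)] X

/-- A complex matrix applied to `nullVec`. -/
noncomputable def actNull (A : Matrix (Fin 2 ⊕ Fin n) (Fin 2 ⊕ Fin n) ℂ) (i : Fin 2 ⊕ Fin n) :
    MvPolynomial (Fin n) ℂ := ∑ j, A i j • nullVec n j

theorem actNull_add (A B : Matrix (Fin 2 ⊕ Fin n) (Fin 2 ⊕ Fin n) ℂ) (i : Fin 2 ⊕ Fin n) :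
    actNull (A + B) i = actNull A i + actNull B i := by
  simp [actNull, add_smul, Finset.sum_add_distrib]

theorem actNull_smul (c : ℂ) (A : Matrix (Fin 2 ⊕ Fin n) (Fin 2 ⊕ Fin n) ℂ) (i : Fin 2 ⊕ Fin n) :
    actNull (c • A) i = c • actNull A i := by
  simp [actNull, mul_smul, Finset.smul_sum]

theorem actNull_sub (A B : Matrix (Fin 2 ⊕ Fin n) (Fin 2 ⊕ Fin n) ℂ) (i : Fin 2 ⊕ Fin n) :
    actNull (A - B) i = actNull A i - actNull B i := by
  simp [actNull, sub_smul, Finset.sum_sub_distrib]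

theorem actNull_mul (A B : Matrix (Fin 2 ⊕ Fin n) (Fin 2 ⊕ Fin n) ℂ) (i : Fin 2 ⊕ Fin n) :
    actNull (A * B) i = ∑ j, A i j • actNull B j := by
  simp_rw [actNull, Matrix.mul_apply, Finset.sum_smul, Finset.smul_sum, mul_smul]
  exact Finset.sum_comm

theorem sum_etaSign_nullVec_actNull (A : soC n) :
    ∑ i, etaSign n i • (nullVec n i * actNull A.1 i) = 0 := by
  have h : ∑ i, etaSign n i • (nullVec n i * actNull A.1 i) =
      ∑ i, ∑ j, (etaSign n i * A.1 i j) • (nullVec n i * nullVec n j) := by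
    simp_rw [actNull, Finset.mul_sum, Finset.smul_sum, mul_smul_comm, smul_smul]
  have h2 : ∑ i, ∑ j, (etaSign n i * A.1 i j) • (nullVec n i * nullVec n j) =
      -∑ i, ∑ j, (etaSign n i * A.1 i j) • (nullVec n i * nullVec n j) := by
    conv_lhs => rw [Finset.sum_comm]
    rw [← Finset.sum_neg_distrib]
    refine Finset.sum_congr rfl fun i _ => ?_
    rw [← Finset.sum_neg_distrib]
    refine Finset.sum_congr rfl fun j _ => ?_
    rw [soC_skew_apply A j i, neg_smul, mul_comm (nullVec n j)]
  rw [h]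
  exact self_eq_neg.1 h2

/-- The linear form `w ↦ w_{-1} + i w_0` at the vector `A nullVec`. -/
noncomputable def cocyc (A : Matrix (Fin 2 ⊕ Fin n) (Fin 2 ⊕ Fin n) ℂ) : MvPolynomial (Fin n) ℂ :=
  actNull A (Sum.inl 0) + Complex.I • actNull A (Sum.inl 1)

/-- The conformal vector field of a matrix. -/
noncomputable def confDer (A : Matrix (Fin 2 ⊕ Fin n) (Fin 2 ⊕ Fin n) ℂ) :
    Derivation ℂ (MvPolynomial (Fin n) ℂ) (MvPolynomial (Fin n) ℂ) :=
  mkDerivation ℂ fun b => actNull A (Sum.inr b) - cocyc A * X b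

theorem derivation_eq_sum (D : Derivation ℂ (MvPolynomial (Fin n) ℂ) (MvPolynomial (Fin n) ℂ))
    (f : MvPolynomial (Fin n) ℂ) : D f = ∑ b, D (X b) * pderiv b f := by
  have h : D = ∑ b, D (X b) • pderiv b := by
    refine derivation_ext fun c => ?_
    rw [sum_derivation_apply]
    simp [pderiv_X, Pi.single_apply]
  conv_lhs => rw [h, sum_derivation_apply]
  rfl

theorem confDer_X (A : Matrix (Fin 2 ⊕ Fin n) (Fin 2 ⊕ Fin n) ℂ) (b : Fin n) :
    confDer A (X b) = actNull A (Sum.inr b) - cocyc A * X b := mkDerivation_X _ _ _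

theorem confDer_rsq (A : soC n) : confDer A.1 (rsq n) =
    (1 - rsq n) * actNull A.1 (Sum.inl 0) -
      Complex.I • ((1 + rsq n) * actNull A.1 (Sum.inl 1)) := by
  have h := sum_etaSign_nullVec_actNull A
  rw [Fintype.sum_sum_type, Fin.sum_univ_two] at h
  simp only [etaSign, nullVec, Sum.elim_inl, Sum.elim_inr, Pi.one_apply, Pi.neg_apply, one_smul,
    neg_smul, Finset.sum_neg_distrib, Matrix.cons_val_zero, Matrix.cons_val_one] at h
  have h2 : confDer A.1 (rsq n) =
      2 * ∑ b, X b * actNull A.1 (Sum.inr b) - 2 * cocyc A.1 * rsq n := by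
    rw [rsq, map_sum, Finset.mul_sum, Finset.mul_sum, ← Finset.sum_sub_distrib]
    refine Finset.sum_congr rfl fun b _ => ?_
    rw [Derivation.leibniz, confDer_X, smul_eq_mul]
    ring
  have h3 : (C (1 / 2) : MvPolynomial (Fin n) ℂ) * 2 = 1 := by
    rw [← C_two, ← C_mul, ← C_1]
    norm_num
  have h4 : (C (Complex.I / 2) : MvPolynomial (Fin n) ℂ) * 2 = C Complex.I := by
    rw [← C_two, ← C_mul]
    congr 1
    ring
  rw [h2, cocyc]
  simp only [smul_eq_C_mul] at h ⊢
  linear_combination -2 * h + (1 + rsq n) * actNull A.1 (Sum.inl 0) * h3 +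
    (rsq n - 1) * actNull A.1 (Sum.inl 1) * h4

/-- The form `w_{-1} + i w_0` equals `1` along `nullVec`, so the linear field `v ↦ A v` has to be
corrected by `cocyc A` times `v` to stay on this section of the cone. For the two time coordinates
this needs `confDer_rsq`, that is, the skewness of `A`. -/
theorem confDer_nullVec (A : soC n) (i : Fin 2 ⊕ Fin n) :
    confDer A.1 (nullVec n i) = actNull A.1 i - cocyc A.1 * nullVec n i := by
  have h3 : (C (1 / 2) : MvPolynomial (Fin n) ℂ) + C (1 / 2) = 1 := by
    rw [← C_add, ← C_1]
    norm_num
  have h4 : (C (Complex.I / 2) : MvPolynomial (Fin n) ℂ) = C Complex.I * C (1 / 2) := by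
    rw [← C_mul]
    congr 1
    ring
  rcases i with i | b
  · fin_cases i
    · change confDer A.1 ((1 / 2 : ℂ) • (1 + rsq n)) = actNull A.1 (Sum.inl 0) -
        cocyc A.1 * ((1 / 2 : ℂ) • (1 + rsq n))
      rw [Derivation.map_smul, map_add, Derivation.map_one_eq_zero, zero_add, confDer_rsq, cocyc]
      simp only [smul_eq_C_mul]
      linear_combination actNull A.1 (Sum.inl 0) * h3
    · change confDer A.1 ((Complex.I / 2 : ℂ) • (rsq n - 1)) = actNull A.1 (Sum.inl 1) -
        cocyc A.1 * ((Complex.I / 2 : ℂ) • (rsq n - 1))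
      rw [Derivation.map_smul, map_sub, Derivation.map_one_eq_zero, sub_zero, confDer_rsq, cocyc]
      simp only [smul_eq_C_mul]
      rw [h4]
      linear_combination actNull A.1 (Sum.inl 1) * h3 +
        (-2 * C (1 / 2) * actNull A.1 (Sum.inl 1)) * C_I_mul_C_I (n := n)
  · exact confDer_X _ _

theorem confDer_actNull (A : soC n) (B : Matrix (Fin 2 ⊕ Fin n) (Fin 2 ⊕ Fin n) ℂ)
    (i : Fin 2 ⊕ Fin n) :
    confDer A.1 (actNull B i) = actNull (B * A.1) i - cocyc A.1 * actNull B i := by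
  rw [actNull_mul, actNull, map_sum, Finset.mul_sum, ← Finset.sum_sub_distrib]
  refine Finset.sum_congr rfl fun j _ => ?_
  rw [Derivation.map_smul, confDer_nullVec, smul_sub, mul_smul_comm]

theorem confDer_cocyc (A : soC n) (B : Matrix (Fin 2 ⊕ Fin n) (Fin 2 ⊕ Fin n) ℂ) :
    confDer A.1 (cocyc B) = cocyc (B * A.1) - cocyc A.1 * cocyc B := by
  rw [cocyc, map_add, Derivation.map_smul, confDer_actNull, confDer_actNull, cocyc, cocyc]
  simp only [smul_eq_C_mul]
  ring

theorem cocyc_sub (A B : Matrix (Fin 2 ⊕ Fin n) (Fin 2 ⊕ Fin n) ℂ) :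
    cocyc (A - B) = cocyc A - cocyc B := by
  simp only [cocyc, actNull_sub, smul_sub]
  ring

/-- Linear vector fields reverse brackets, which is why `confRep` subtracts `confDer`. -/
theorem confDer_lie (A B : soC n) : confDer (A.1 * B.1 - B.1 * A.1) = ⁅confDer B.1, confDer A.1⁆ := by
  refine derivation_ext fun b => ?_
  rw [Derivation.commutator_apply, confDer_X, confDer_X, confDer_X, map_sub, map_sub,
    Derivation.leibniz, Derivation.leibniz, confDer_actNull, confDer_actNull, confDer_cocyc,
    confDer_cocyc, confDer_X, confDer_X, actNull_sub, cocyc_sub]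
  simp only [smul_eq_mul]
  ring

/-- The conformal representation of `so(2,n)` of weight `E` on polynomials. -/
noncomputable def confRep (n : ℕ) (E : ℂ) : soC n →ₗ⁅ℂ⁆ Module.End ℂ (MvPolynomial (Fin n) ℂ) where
  -- If `F` extends `f` to the cone with degree `-E`, then `-dF(A v)` is this expression: `A v` is
  -- the value of `confDer A` plus `cocyc A` times `v`, and the radial derivative of `F` is `-E F`.
  toFun A := E • LinearMap.mulLeft ℂ (cocyc A.1) - (confDer A.1).toLinearMap
  map_add' A B := by
    have h : confDer (A.1 + B.1) = confDer A.1 + confDer B.1 := by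
      refine derivation_ext fun b => ?_
      rw [Derivation.add_apply, confDer_X, confDer_X, confDer_X, cocyc, cocyc, cocyc]
      simp only [actNull_add, smul_add]
      ring
    refine LinearMap.ext fun f => ?_
    change E • (cocyc (A.1 + B.1) * f) - confDer (A.1 + B.1) f =
      (E • (cocyc A.1 * f) - confDer A.1 f) + (E • (cocyc B.1 * f) - confDer B.1 f)
    rw [h, Derivation.add_apply, cocyc, cocyc, cocyc]
    simp only [actNull_add, smul_eq_C_mul]
    ring
  map_smul' c A := by
    have h : confDer (c • A.1) = c • confDer A.1 := by
      refine derivation_ext fun b => ?_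
      rw [Derivation.smul_apply, confDer_X, confDer_X, cocyc, cocyc]
      simp only [actNull_smul, smul_eq_C_mul]
      ring
    refine LinearMap.ext fun f => ?_
    change E • (cocyc (c • A.1) * f) - confDer (c • A.1) f =
      c • (E • (cocyc A.1 * f) - confDer A.1 f)
    rw [h, Derivation.smul_apply, cocyc, cocyc]
    simp only [actNull_smul, smul_eq_C_mul]
    ring
  map_lie' {A B} := by
    refine LinearMap.ext fun f => ?_
    rw [Ring.lie_def]
    change E • (cocyc (A.1 * B.1 - B.1 * A.1) * f) - confDer (A.1 * B.1 - B.1 * A.1) f =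
      (E • (cocyc A.1 * (E • (cocyc B.1 * f) - confDer B.1 f)) -
        confDer A.1 (E • (cocyc B.1 * f) - confDer B.1 f)) -
      (E • (cocyc B.1 * (E • (cocyc A.1 * f) - confDer A.1 f)) -
        confDer B.1 (E • (cocyc A.1 * f) - confDer A.1 f))
    rw [confDer_lie, Derivation.commutator_apply, cocyc_sub, map_sub, map_sub, Derivation.map_smul,
      Derivation.map_smul, Derivation.leibniz, Derivation.leibniz, confDer_cocyc, confDer_cocyc]
    simp only [smul_eq_C_mul, smul_eq_mul]
    ring

theorem confRep_apply (E : ℂ) (A : soC n) (f : MvPolynomial (Fin n) ℂ) :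
    confRep n E A f = E • (cocyc A.1 * f) - confDer A.1 f := rfl

/-- The bilinear form `η`. -/
noncomputable def etaForm : (Fin 2 ⊕ Fin n → ℂ) →ₗ[ℂ] (Fin 2 ⊕ Fin n → ℂ) →ₗ[ℂ] ℂ :=
  LinearMap.mk₂ ℂ (fun u v => ∑ i, etaSign n i * (u i * v i))
    (by intro u u' v; simp [add_mul, mul_add, Finset.sum_add_distrib])
    (by intro c u v; simp only [Pi.smul_apply, smul_eq_mul, Finset.mul_sum]
        exact Finset.sum_congr rfl fun i _ => by ring)
    (by intro u v v'; simp [mul_add, Finset.sum_add_distrib])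
    (by intro c u v; simp only [Pi.smul_apply, smul_eq_mul, Finset.mul_sum]
        exact Finset.sum_congr rfl fun i _ => by ring)

theorem etaForm_apply (u v : Fin 2 ⊕ Fin n → ℂ) :
    etaForm u v = ∑ i, etaSign n i * (u i * v i) := rfl

/-- The bilinear map `(u, v) ↦ u ∧ v`. -/
noncomputable def wedgeSo : (Fin 2 ⊕ Fin n → ℂ) →ₗ[ℂ] (Fin 2 ⊕ Fin n → ℂ) →ₗ[ℂ] soC n :=
  LinearMap.mk₂ ℂ (fun u v => ⟨wedge u v, wedge_mem u v⟩)
    (by intro u u' v; apply Subtype.ext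
        simp [wedge, Matrix.add_vecMulVec, Matrix.vecMulVec_add]
        noncomm_ring)
    (by intro c u v; apply Subtype.ext
        simp [wedge, Matrix.smul_vecMulVec, Matrix.vecMulVec_smul, ← smul_sub])
    (by intro u v v'; apply Subtype.ext
        simp [wedge, Matrix.add_vecMulVec, Matrix.vecMulVec_add]
        noncomm_ring)
    (by intro c u v; apply Subtype.ext
        simp [wedge, Matrix.smul_vecMulVec, Matrix.vecMulVec_smul, ← smul_sub])

theorem wedge_apply (u v : Fin 2 ⊕ Fin n → ℂ) (i j : Fin 2 ⊕ Fin n) :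
    wedge u v i j = (u i * v j - v i * u j) * etaSign n j := by
  rw [wedge, indefiniteDiagonal_eq, Matrix.mul_diagonal, Matrix.sub_apply, Matrix.vecMulVec_apply,
    Matrix.vecMulVec_apply]

theorem wedgeSo_apply (u v : Fin 2 ⊕ Fin n → ℂ) (i j : Fin 2 ⊕ Fin n) :
    (wedgeSo u v).1 i j = (u i * v j - v i * u j) * etaSign n j := wedge_apply u v i j

theorem Xel_eq (j k : ℤ) : Xel n j k = wedgeSo (isoVec n j) (isoVec n k) := rfl

theorem wedgeSo_swap (u v : Fin 2 ⊕ Fin n → ℂ) : wedgeSo v u = -wedgeSo u v := by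
  apply Subtype.ext
  ext i j
  rw [wedgeSo_apply]
  change _ = -((wedgeSo u v).1 i j)
  rw [wedgeSo_apply]
  ring

theorem wedgeSo_self (u : Fin 2 ⊕ Fin n → ℂ) : wedgeSo u u = 0 := by
  apply Subtype.ext
  ext i j
  rw [wedgeSo_apply, sub_self, zero_mul]
  rfl

theorem wedge_mulVec (u v w : Fin 2 ⊕ Fin n → ℂ) :
    (wedgeSo u v).1.mulVec w = etaForm v w • u - etaForm u w • v := by
  ext i
  simp only [Matrix.mulVec, dotProduct, wedgeSo_apply, Pi.sub_apply, Pi.smul_apply, smul_eq_mul,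
    etaForm_apply, Finset.sum_mul, ← Finset.sum_sub_distrib]
  exact Finset.sum_congr rfl fun j _ => by ring

theorem lie_wedgeSo (A : soC n) (u v : Fin 2 ⊕ Fin n → ℂ) :
    ⁅A, wedgeSo u v⁆ = wedgeSo (A.1.mulVec u) v + wedgeSo u (A.1.mulVec v) := by
  apply Subtype.ext
  ext i j
  change (A.1 * (wedgeSo u v).1 - (wedgeSo u v).1 * A.1) i j =
    (wedgeSo (A.1.mulVec u) v).1 i j + (wedgeSo u (A.1.mulVec v)).1 i j
  simp only [Matrix.sub_apply, Matrix.mul_apply, wedgeSo_apply, Matrix.mulVec, dotProduct]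
  have h : ∀ k, (u i * v k - v i * u k) * etaSign n k * A.1 k j =
      -((u i * v k - v i * u k) * (A.1 j k * etaSign n j)) := by
    intro k
    linear_combination (u i * v k - v i * u k) * soC_skew_apply A k j
  simp_rw [h]
  rw [Finset.sum_neg_distrib, sub_neg_eq_add, ← Finset.sum_add_distrib, Finset.sum_mul,
    Finset.mul_sum, Finset.mul_sum, Finset.sum_mul, ← Finset.sum_sub_distrib,
    ← Finset.sum_sub_distrib, Finset.sum_mul, Finset.sum_mul, ← Finset.sum_add_distrib]
  exact Finset.sum_congr rfl fun k _ => by ring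

/-- `soC n` is spanned by the wedge products of basis vectors. -/
theorem mem_of_wedgeSo_single_mem (A : soC n) (p : Submodule ℂ (soC n))
    (h : ∀ i j, A.1 i j ≠ 0 → wedgeSo (Pi.single i 1) (Pi.single j 1) ∈ p) : A ∈ p := by
  -- The factor `1/2` is there because each unordered pair of indices occurs twice, with equal
  -- contributions by skewness.
  have hA : A = ∑ i, ∑ j, ((1 / 2 : ℂ) * (A.1 i j * etaSign n j)) •
      wedgeSo (Pi.single i 1) (Pi.single j 1) := by
    apply Subtype.ext
    ext k l
    rw [AddSubmonoidClass.coe_finsetSum, Matrix.sum_apply]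
    simp_rw [AddSubmonoidClass.coe_finsetSum, Matrix.sum_apply]
    have e : ∀ i j : Fin 2 ⊕ Fin n, (((1 / 2 : ℂ) * (A.1 i j * etaSign n j)) •
        wedgeSo (Pi.single i 1) (Pi.single j 1)).1 k l =
        (if k = i then (if l = j then (1 / 2 : ℂ) * (A.1 i j * etaSign n j) * etaSign n l else 0)
          else 0) -
        (if k = j then (if l = i then (1 / 2 : ℂ) * (A.1 i j * etaSign n j) * etaSign n l else 0)
          else 0) := by
      intro i j
      change ((1 / 2 : ℂ) * (A.1 i j * etaSign n j)) * _ = _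
      rw [wedgeSo_apply]
      simp only [Pi.single_apply]
      split_ifs <;> ring
    refine Eq.trans ?_ (Finset.sum_congr rfl fun i _ => Finset.sum_congr rfl fun j _ =>
      (e i j).symm)
    simp only [Finset.sum_sub_distrib]
    simp
    have h1 := soC_skew_apply A k l
    have h2 := etaSign_mul_self l
    have h3 := etaSign_mul_self k
    linear_combination (1 / 2 * etaSign n k) * h1 - 1 / 2 * A.1 k l * h2 - 1 / 2 * A.1 k l * h3
  rw [hA]
  refine p.sum_mem fun i _ => p.sum_mem fun j _ => ?_
  by_cases h0 : A.1 i j = 0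
  · rw [h0, zero_mul, mul_zero, zero_smul]
    exact p.zero_mem
  · exact p.smul_mem _ (h i j h0)

theorem wedgeSo_mem_of_mem_span {S T : Set (Fin 2 ⊕ Fin n → ℂ)} {p : Submodule ℂ (soC n)}
    (h : ∀ u ∈ S, ∀ v ∈ T, wedgeSo u v ∈ p) {u v : Fin 2 ⊕ Fin n → ℂ}
    (hu : u ∈ Submodule.span ℂ S) (hv : v ∈ Submodule.span ℂ T) : wedgeSo u v ∈ p := by
  have h1 := Submodule.apply_mem_map₂ wedgeSo hu hv
  rw [Submodule.map₂_span_span] at h1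
  refine Submodule.span_le.2 ?_ h1
  rintro _ ⟨u, hu, v, hv, rfl⟩
  exact h u hu v hv

/-- The linear polynomial `η(u, nullVec)`. -/
noncomputable def evNull (u : Fin 2 ⊕ Fin n → ℂ) : MvPolynomial (Fin n) ℂ :=
  ∑ i, (etaSign n i * u i) • nullVec n i

/-- The directional derivative along the `ℂ^n`-component of a vector. -/
noncomputable def dirDer (u : Fin 2 ⊕ Fin n → ℂ) :
    Derivation ℂ (MvPolynomial (Fin n) ℂ) (MvPolynomial (Fin n) ℂ) :=
  ∑ b, u (Sum.inr b) • pderiv b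

theorem dirDer_apply (u : Fin 2 ⊕ Fin n → ℂ) (f : MvPolynomial (Fin n) ℂ) :
    dirDer u f = ∑ b, u (Sum.inr b) • pderiv b f := by
  rw [dirDer, sum_derivation_apply]
  rfl

/-- The linear form `w ↦ w_{-1} + i w_0`. -/
def timeForm (u : Fin 2 ⊕ Fin n → ℂ) : ℂ := u (Sum.inl 0) + Complex.I * u (Sum.inl 1)

theorem actNull_wedgeSo (u v : Fin 2 ⊕ Fin n → ℂ) (i : Fin 2 ⊕ Fin n) :
    actNull (wedgeSo u v).1 i = u i • evNull v - v i • evNull u := by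
  simp only [actNull, wedgeSo_apply, evNull, Finset.smul_sum, ← Finset.sum_sub_distrib, smul_smul,
    ← sub_smul]
  exact Finset.sum_congr rfl fun j _ => by congr 1; ring

theorem cocyc_wedgeSo (u v : Fin 2 ⊕ Fin n → ℂ) :
    cocyc (wedgeSo u v).1 = timeForm u • evNull v - timeForm v • evNull u := by
  rw [cocyc, actNull_wedgeSo, actNull_wedgeSo, timeForm, timeForm]
  module

/-- The explicit actions of translations, special conformal fields, the dilation and rotations are
all specialisations of this formula. -/
theorem confRep_wedgeSo (E : ℂ) (u v : Fin 2 ⊕ Fin n → ℂ) (f : MvPolynomial (Fin n) ℂ) :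
    confRep n E (wedgeSo u v) f =
      evNull u * (dirDer v f - timeForm v • (euler n f + E • f)) -
        evNull v * (dirDer u f - timeForm u • (euler n f + E • f)) := by
  have h : confDer (wedgeSo u v).1 f = evNull v * (dirDer u f - timeForm u • euler n f) -
      evNull u * (dirDer v f - timeForm v • euler n f) := by
    rw [derivation_eq_sum, dirDer_apply, dirDer_apply, euler_apply, Finset.smul_sum,
      Finset.smul_sum, ← Finset.sum_sub_distrib, ← Finset.sum_sub_distrib, Finset.mul_sum,
      Finset.mul_sum, ← Finset.sum_sub_distrib]
    refine Finset.sum_congr rfl fun b _ => ?_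
    rw [confDer_X, actNull_wedgeSo, cocyc_wedgeSo]
    simp only [smul_eq_C_mul]
    ring
  rw [confRep_apply, h, cocyc_wedgeSo]
  simp only [smul_eq_C_mul]
  ring

end ConformalRepresentation

/-! ### The isotropic basis, root vectors and a grading element -/

section IsotropicBasis

variable {n : ℕ}

/-- The labels of the isotropic basis. -/
def IsoLabel (n : ℕ) (j : ℤ) : Prop := j.natAbs ≤ soRank n ∧ (j = 0 → Odd n)

theorem isoLabel_neg {j : ℤ} (hj : IsoLabel n j) : IsoLabel n (-j) :=
  ⟨by rw [Int.natAbs_neg]; exact hj.1, fun h => hj.2 (neg_eq_zero.1 h)⟩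

/-- The standard basis vectors of `ℂ^{2+n}`. -/
def stdVec (i : Fin 2 ⊕ Fin n) : Fin 2 ⊕ Fin n → ℂ := Pi.single i 1

/-- The constant `i / √2`. -/
noncomputable def timeConst : ℂ := Complex.I / (Real.sqrt 2 : ℂ)

/-- The constant `1 / √2`. -/
noncomputable def spaceConst : ℂ := 1 / (Real.sqrt 2 : ℂ)

theorem sqrt_two_mul_self : ((Real.sqrt 2 : ℝ) : ℂ) * ((Real.sqrt 2 : ℝ) : ℂ) = 2 := by
  rw [← Complex.ofReal_mul, Real.mul_self_sqrt (by norm_num)]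
  norm_num

theorem sqrt_two_ne_zero : ((Real.sqrt 2 : ℝ) : ℂ) ≠ 0 := by
  intro h
  have := sqrt_two_mul_self
  rw [h, mul_zero] at this
  norm_num at this

theorem timeConst_mul_self : timeConst * timeConst = -1 / 2 := by
  rw [timeConst, div_mul_div_comm, Complex.I_mul_I, sqrt_two_mul_self]

theorem timeConst_ne_zero : timeConst ≠ 0 :=
  div_ne_zero Complex.I_ne_zero sqrt_two_ne_zero

theorem spaceConst_mul_self : spaceConst * spaceConst = 1 / 2 := by
  rw [spaceConst, div_mul_div_comm, one_mul, sqrt_two_mul_self]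

theorem spaceConst_ne_zero : spaceConst ≠ 0 := div_ne_zero one_ne_zero sqrt_two_ne_zero

theorem isoVec_inl (j : ℤ) (hj : j.natAbs ≠ 1) (a : Fin 2) : isoVec n j (Sum.inl a) = 0 := by
  simp [isoVec, hj]

theorem isoVec_inr (j : ℤ) (hj : j.natAbs = 1) (b : Fin n) : isoVec n j (Sum.inr b) = 0 := by
  have h : j ≠ 0 := by omega
  simp [isoVec, hj, h]

theorem isoVec_inl_zero {j : ℤ} (hj : j.natAbs = 1) :
    isoVec n j (Sum.inl 0) = timeConst := by
  simp [isoVec, hj, timeConst]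

theorem isoVec_inl_one {j : ℤ} (hj : j.natAbs = 1) :
    isoVec n j (Sum.inl 1) = timeConst * (j * Complex.I) := by
  simp [isoVec, hj, timeConst]

theorem isoVec_eq_time {j : ℤ} (hj : j.natAbs = 1) :
    isoVec n j = timeConst • (stdVec (Sum.inl 0) + (j * Complex.I) • stdVec (Sum.inl 1)) := by
  funext i
  rcases i with a | b
  · fin_cases a
    · change isoVec n j (Sum.inl 0) = _
      rw [isoVec_inl_zero hj]
      simp [stdVec]
    · change isoVec n j (Sum.inl 1) = _
      rw [isoVec_inl_one hj]
      simp [stdVec]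
  · rw [isoVec_inr j hj]
    simp [stdVec]

theorem isoVec_zero_eq (hn : Odd n) : isoVec n 0 =
    stdVec (Sum.inr ⟨n - 1, Nat.sub_lt hn.pos one_pos⟩) := by
  have hpos := hn.pos
  funext i
  rcases i with a | b
  · rw [isoVec_inl _ (by simp)]
    simp [stdVec]
  · simp only [isoVec, stdVec, Pi.single_apply, Sum.inr.injEq, Fin.ext_iff]
    simp only [Int.natAbs_zero, hn, true_and]
    have : (b : ℕ) + 1 = n ↔ (b : ℕ) = n - 1 := by omega
    simp [this]

theorem label_fst_lt {j : ℤ} (hj : IsoLabel n j) (h2 : 2 ≤ j.natAbs) : 2 * j.natAbs - 4 < n := by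
  have := hj.1
  simp only [soRank] at this
  omega

theorem label_snd_lt {j : ℤ} (hj : IsoLabel n j) (h2 : 2 ≤ j.natAbs) : 2 * j.natAbs - 3 < n := by
  have := hj.1
  simp only [soRank] at this
  omega

theorem isoVec_eq_space {j : ℤ} (hj : IsoLabel n j) (h2 : 2 ≤ j.natAbs) :
    isoVec n j = spaceConst • (stdVec (Sum.inr ⟨2 * j.natAbs - 4, label_fst_lt hj h2⟩) +
      (j.sign * Complex.I) • stdVec (Sum.inr ⟨2 * j.natAbs - 3, label_snd_lt hj h2⟩)) := by
  funext i
  rcases i with a | b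
  · rw [isoVec_inl _ (by omega)]
    simp [stdVec]
  · simp only [isoVec, h2, stdVec, Pi.single_apply, Pi.smul_apply, Pi.add_apply, smul_eq_mul,
      Sum.inr.injEq, Fin.ext_iff, if_true, spaceConst]
    congr 1
    have e1 : (b : ℕ) + 4 = 2 * j.natAbs ↔ (b : ℕ) = 2 * j.natAbs - 4 := by omega
    have e2 : (b : ℕ) + 3 = 2 * j.natAbs ↔ (b : ℕ) = 2 * j.natAbs - 3 := by omega
    simp only [e1, e2]
    split_ifs <;> first | omega | simp

theorem etaForm_stdVec (u : Fin 2 ⊕ Fin n → ℂ) (i : Fin 2 ⊕ Fin n) :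
    etaForm u (stdVec i) = etaSign n i * u i := by
  rw [etaForm_apply]
  simp [stdVec, Pi.single_apply]

theorem etaForm_isoVec {j k : ℤ} (hj : IsoLabel n j) (hk : IsoLabel n k) :
    etaForm (isoVec n j) (isoVec n k) = if j = -k then -1 else 0 := by
  have hjr := hj.1
  have hkr := hk.1
  simp only [soRank] at hjr hkr
  rcases (by omega : k = 0 ∨ k.natAbs = 1 ∨ 2 ≤ k.natAbs) with rfl | h1 | h2
  · have hodd := hk.2 rfl
    obtain ⟨m, hm⟩ := hodd
    rw [isoVec_zero_eq ⟨m, hm⟩, etaForm_stdVec]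
    simp only [isoVec, etaSign, Sum.elim_inr, Pi.neg_apply, Pi.one_apply]
    by_cases hj0 : j = 0
    · subst hj0
      have : n - 1 + 1 = n := by omega
      have hodd : Odd n := ⟨m, hm⟩
      simp [this, hodd]
    · have e1 : ¬ (n - 1 + 4 = 2 * j.natAbs) := by omega
      have e2 : ¬ (n - 1 + 3 = 2 * j.natAbs) := by omega
      simp [hj0, e1, e2]
  · rw [isoVec_eq_time h1, map_smul, map_add, map_smul, etaForm_stdVec, etaForm_stdVec]
    by_cases hj1 : j.natAbs = 1
    · rw [isoVec_inl_zero hj1, isoVec_inl_one hj1]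
      simp only [etaSign, Sum.elim_inl, Pi.one_apply, one_mul, smul_eq_mul]
      have e : timeConst * (timeConst + k * Complex.I * (timeConst * (j * Complex.I))) =
          -1 / 2 * (1 - k * j) := by
        rw [← timeConst_mul_self]
        linear_combination (timeConst * timeConst * k * j) * Complex.I_mul_I
      rw [e]
      rcases (by omega : j = 1 ∨ j = -1) with rfl | rfl <;>
        rcases (by omega : k = 1 ∨ k = -1) with rfl | rfl <;> norm_num
    · rw [isoVec_inl _ hj1, isoVec_inl _ hj1, if_neg (by omega)]
      simp
  · rw [isoVec_eq_space hk h2, map_smul, map_add, map_smul, etaForm_stdVec, etaForm_stdVec]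
    simp only [isoVec, etaSign, Sum.elim_inr, Pi.neg_apply, Pi.one_apply, smul_eq_mul]
    -- For odd `n` the last coordinate belongs to `x_0` alone and lies in none of the pairs used by
    -- `x_k`.
    have e0 : ¬ (j = 0 ∧ Odd n ∧ 2 * k.natAbs - 4 + 1 = n) := by
      rintro ⟨-, ⟨m, hm⟩, h⟩
      omega
    have e0' : ¬ (j = 0 ∧ Odd n ∧ 2 * k.natAbs - 3 + 1 = n) := by
      rintro ⟨-, ⟨m, hm⟩, h⟩
      omega
    rw [if_neg e0, if_neg e0']
    by_cases hj2 : 2 ≤ j.natAbs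
    · by_cases hjk : j.natAbs = k.natAbs
      · have e1 : 2 * k.natAbs - 4 + 4 = 2 * j.natAbs := by omega
        have e2 : ¬ (2 * k.natAbs - 3 + 4 = 2 * j.natAbs) := by omega
        have e3 : 2 * k.natAbs - 3 + 3 = 2 * j.natAbs := by omega
        rw [if_pos hj2, if_pos e1, if_pos hj2, if_neg e2, if_pos e3, ← spaceConst]
        have e : spaceConst * (-1 * (spaceConst * 1) +
            k.sign * Complex.I * (-1 * (spaceConst * (j.sign * Complex.I)))) =
            1 / 2 * (k.sign * j.sign - 1) := by
          rw [← spaceConst_mul_self]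
          linear_combination (-spaceConst * spaceConst * k.sign * j.sign) * Complex.I_mul_I
        rw [e]
        rcases Int.natAbs_eq_natAbs_iff.1 hjk with rfl | rfl
        · have : j.sign * j.sign = 1 := by
            rcases lt_or_gt_of_ne (show j ≠ 0 by omega) with h | h
            · rw [Int.sign_eq_neg_one_of_neg h]; rfl
            · rw [Int.sign_eq_one_of_pos h]; rfl
          have h' : (j.sign : ℂ) * j.sign = 1 := by exact_mod_cast this
          rw [if_neg (by omega), h']
          norm_num
        · have : k.sign * (-k).sign = -1 := by
            rcases lt_or_gt_of_ne (show k ≠ 0 by omega) with h | h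
            · rw [Int.sign_eq_neg_one_of_neg h, Int.sign_eq_one_of_pos (by omega)]; rfl
            · rw [Int.sign_eq_one_of_pos h, Int.sign_eq_neg_one_of_neg (by omega)]; rfl
          have h' : (k.sign : ℂ) * (-k).sign = -1 := by exact_mod_cast this
          rw [if_pos rfl, h']
          norm_num
      · have e1 : ¬ (2 * k.natAbs - 4 + 4 = 2 * j.natAbs) := by omega
        have e2 : ¬ (2 * k.natAbs - 3 + 4 = 2 * j.natAbs) := by omega
        have e3 : ¬ (2 * k.natAbs - 3 + 3 = 2 * j.natAbs) := by omega
        have e4 : ¬ (2 * k.natAbs - 4 + 3 = 2 * j.natAbs) := by omega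
        rw [if_neg e1, if_neg e2, if_neg e3, if_neg e4, if_neg (by omega : ¬ j = -k)]
        simp
    · rw [if_neg hj2, if_neg hj2, if_neg (by omega : ¬ j = -k)]
      simp

theorem stdVec_inl_mem_span (a : Fin 2) :
    stdVec (Sum.inl a) ∈ Submodule.span ℂ {isoVec n 1, isoVec n (-1)} := by
  rw [Submodule.mem_span_pair]
  have hc := timeConst_ne_zero
  have h1 := isoVec_eq_time (n := n) (j := 1) rfl
  have h2 := isoVec_eq_time (n := n) (j := -1) rfl
  fin_cases a
  · refine ⟨(2 * timeConst)⁻¹, (2 * timeConst)⁻¹, ?_⟩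
    change _ = stdVec (Sum.inl 0)
    have e : (2 * timeConst)⁻¹ * timeConst = 1 / 2 := by
      field_simp
    rw [h1, h2, smul_smul, smul_smul, e]
    push_cast
    module
  · refine ⟨(2 * timeConst * Complex.I)⁻¹, -(2 * timeConst * Complex.I)⁻¹, ?_⟩
    change _ = stdVec (Sum.inl 1)
    rw [h1, h2]
    have e : (2 * timeConst * Complex.I)⁻¹ * timeConst = -Complex.I / 2 := by
      field_simp
      rw [Complex.I_sq, neg_neg]
    rw [smul_smul, smul_smul, neg_mul, e]
    simp only [smul_add, smul_smul]
    push_cast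
    have e1 : -Complex.I / 2 * (1 * Complex.I) = 1 / 2 := by
      linear_combination (-1 / 2 : ℂ) * Complex.I_mul_I
    have e2 : -(-Complex.I / 2) * (-1 * Complex.I) = 1 / 2 := by
      linear_combination (-1 / 2 : ℂ) * Complex.I_mul_I
    rw [e1, e2]
    module

theorem stdVec_inr_mem_span (hn : 3 ≤ n) (b : Fin n) : stdVec (Sum.inr b) ∈
    Submodule.span ℂ {u | ∃ j : ℤ, IsoLabel n j ∧ j.natAbs ≠ 1 ∧ u = isoVec n j} := by
  set S := Submodule.span ℂ {u | ∃ j : ℤ, IsoLabel n j ∧ j.natAbs ≠ 1 ∧ u = isoVec n j}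
  have hmem : ∀ j : ℤ, IsoLabel n j → j.natAbs ≠ 1 → isoVec n j ∈ S := fun j hj h1 =>
    Submodule.subset_span ⟨j, hj, h1, rfl⟩
  have hb := b.2
  by_cases hlast : Odd n ∧ (b : ℕ) + 1 = n
  · have h0 := hmem 0 ⟨by simp, fun _ => hlast.1⟩ (by simp)
    rw [isoVec_zero_eq hlast.1] at h0
    have : (⟨n - 1, Nat.sub_lt hlast.1.pos one_pos⟩ : Fin n) = b := by
      apply Fin.ext
      change n - 1 = b
      omega
    rwa [this] at h0
  -- Coordinate `b` is one of the pair `2J - 4, 2J - 3` occupied by `x_J` and `x_{-J}`.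
  · obtain ⟨J, hJ⟩ : ∃ J : ℕ, J = (b : ℕ) / 2 + 2 := ⟨_, rfl⟩
    have hJr : J ≤ soRank n := by
      simp only [soRank]
      rcases Nat.even_or_odd n with ⟨m, hm⟩ | ⟨m, hm⟩
      · omega
      · have : ¬ ((b : ℕ) + 1 = n) := fun h => hlast ⟨⟨m, hm⟩, h⟩
        omega
    have hlab : IsoLabel n J := ⟨by simpa using hJr, by omega⟩
    have hlab' := isoLabel_neg hlab
    have h2 : 2 ≤ (J : ℤ).natAbs := by omega
    have h2' : 2 ≤ (-(J : ℤ)).natAbs := by omega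
    have m1 := hmem _ hlab (by omega)
    have m2 := hmem _ hlab' (by omega)
    have e1 := isoVec_eq_space hlab h2
    have e2 := isoVec_eq_space hlab' h2'
    simp only [Int.natAbs_neg, Int.natAbs_natCast] at e1 e2
    have s1 : (J : ℤ).sign = 1 := Int.sign_eq_one_of_pos (by omega)
    have s2 : (-(J : ℤ)).sign = -1 := Int.sign_eq_neg_one_of_neg (by omega)
    rw [s1] at e1
    rw [s2] at e2
    have hc := spaceConst_ne_zero
    rcases (by omega : (b : ℕ) = 2 * J - 4 ∨ (b : ℕ) = 2 * J - 3) with h | h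
    · have hfin : (⟨2 * J - 4, by omega⟩ : Fin n) = b := Fin.ext h.symm
      rw [hfin] at e1 e2
      have : stdVec (Sum.inr b) =
          (2 * spaceConst)⁻¹ • (isoVec n (J : ℤ) + isoVec n (-(J : ℤ))) := by
        rw [e1, e2, ← smul_add, smul_smul, mul_inv, mul_assoc, inv_mul_cancel₀ hc]
        push_cast
        module
      rw [this]
      exact S.smul_mem _ (S.add_mem m1 m2)
    · have hfin : (⟨2 * J - 3, by omega⟩ : Fin n) = b := Fin.ext h.symm
      rw [hfin] at e1 e2
      have : stdVec (Sum.inr b) =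
          (2 * spaceConst * Complex.I)⁻¹ • (isoVec n (J : ℤ) - isoVec n (-(J : ℤ))) := by
        have e : (2 * spaceConst * Complex.I)⁻¹ * spaceConst = (2 * Complex.I)⁻¹ := by
          field_simp
        rw [e1, e2, ← smul_sub, smul_smul, e]
        push_cast
        have : (stdVec (Sum.inr ⟨2 * J - 4, by omega⟩) + (1 * Complex.I) • stdVec (Sum.inr b) -
            (stdVec (Sum.inr ⟨2 * J - 4, by omega⟩) + (-1 * Complex.I) • stdVec (Sum.inr b)) :
              Fin 2 ⊕ Fin n → ℂ) = (2 * Complex.I) • stdVec (Sum.inr b) := by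
          module
        rw [this, smul_smul, inv_mul_cancel₀ (mul_ne_zero two_ne_zero Complex.I_ne_zero),
          one_smul]
      rw [this]
      exact S.smul_mem _ (S.sub_mem m1 m2)

/-- The values of a strictly dominant grading element on the isotropic basis. -/
def labelGrade (n : ℕ) (j : ℤ) : ℤ := j.sign * (soRank n + 1 - j.natAbs)

/-- The grading element as a combination of the basis of the Cartan subalgebra. -/
noncomputable def gradeEl (n : ℕ) : soC n := ∑ i : Fin (soRank n), ((soRank n - i : ℤ) : ℂ) • Hel n i

theorem Hel_mulVec (i : Fin (soRank n)) {k : ℤ} (hk : IsoLabel n k) :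
    (Hel n i).1.mulVec (isoVec n k) =
      ((if k = (i : ℤ) + 1 then 1 else 0) - (if k = -((i : ℤ) + 1) then 1 else 0) : ℂ) •
        isoVec n k := by
  have hi := i.2
  have hlab : IsoLabel n ((i : ℤ) + 1) := ⟨by omega, by omega⟩
  rw [Hel, Xel_eq, wedge_mulVec, etaForm_isoVec hlab hk, etaForm_isoVec (isoLabel_neg hlab) hk]
  by_cases h1 : k = (i : ℤ) + 1
  · subst h1
    rw [if_neg (by omega), if_pos rfl, if_pos rfl, if_neg (by omega)]
    module
  · by_cases h2 : k = -((i : ℤ) + 1)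
    · subst h2
      rw [if_pos (by omega), if_neg (by omega), if_neg (by omega), if_pos rfl]
      module
    · rw [if_neg (by omega), if_neg (by omega), if_neg h1, if_neg h2]
      module

theorem gradeEl_mulVec {k : ℤ} (hk : IsoLabel n k) :
    (gradeEl n).1.mulVec (isoVec n k) = (labelGrade n k : ℂ) • isoVec n k := by
  have h : (gradeEl n).1 = ∑ i : Fin (soRank n), ((soRank n - i : ℤ) : ℂ) • (Hel n i).1 := by
    rw [gradeEl, AddSubmonoidClass.coe_finsetSum]
    rfl
  have hkr := hk.1
  rw [h, Matrix.sum_mulVec]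
  simp_rw [Matrix.smul_mulVec, Hel_mulVec _ hk, smul_smul]
  rw [← Finset.sum_smul]
  congr 1
  rcases lt_trichotomy k 0 with hneg | rfl | hpos
  · rw [Finset.sum_eq_single ⟨k.natAbs - 1, by omega⟩]
    · rw [if_neg (by simp only []; omega), if_pos (by simp only []; omega), labelGrade,
        Int.sign_eq_neg_one_of_neg hneg]
      have : ((k.natAbs - 1 : ℕ) : ℤ) = k.natAbs - 1 := by omega
      simp only [this]
      push_cast
      ring
    · intro i _ hi
      have : ¬ (k = -((i : ℤ) + 1)) := fun h => hi (Fin.ext (by simp only []; omega))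
      rw [if_neg (by omega), if_neg this]
      ring
    · exact fun h => absurd (Finset.mem_univ _) h
  · rw [Finset.sum_eq_zero]
    · simp [labelGrade]
    · intro i _
      rw [if_neg (by omega), if_neg (by omega)]
      ring
  · rw [Finset.sum_eq_single ⟨k.natAbs - 1, by omega⟩]
    · rw [if_pos (by simp only []; omega), if_neg (by simp only []; omega), labelGrade,
        Int.sign_eq_one_of_pos hpos]
      have : ((k.natAbs - 1 : ℕ) : ℤ) = k.natAbs - 1 := by omega
      simp only [this]
      push_cast
      ring
    · intro i _ hi
      have : ¬ (k = (i : ℤ) + 1) := fun h => hi (Fin.ext (by simp only []; omega))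
      rw [if_neg this, if_neg (by omega)]
      ring
    · exact fun h => absurd (Finset.mem_univ _) h

theorem lie_gradeEl_Xel {j k : ℤ} (hj : IsoLabel n j) (hk : IsoLabel n k) :
    ⁅gradeEl n, Xel n j k⁆ = ((labelGrade n j + labelGrade n k : ℤ) : ℂ) • Xel n j k := by
  rw [Xel_eq, lie_wedgeSo, gradeEl_mulVec hj, gradeEl_mulVec hk, map_smul, map_smul,
    LinearMap.smul_apply, ← add_smul]
  push_cast
  rfl

theorem lie_gradeEl_Xel_of_neg {j k : ℤ} (hj : IsoLabel n j) (hk : IsoLabel n k)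
    (h : labelGrade n j + labelGrade n k < 0) :
    ∃ m : ℕ, 1 ≤ m ∧ ⁅gradeEl n, Xel n j k⁆ = -(m : ℂ) • Xel n j k := by
  obtain ⟨m, hm⟩ := Int.eq_ofNat_of_zero_le (neg_nonneg.2 h.le)
  refine ⟨m, by omega, ?_⟩
  rw [lie_gradeEl_Xel hj hk, ← neg_neg (labelGrade n j + labelGrade n k), hm, Int.cast_neg]
  rfl

theorem Xel_swap (j k : ℤ) : Xel n k j = -Xel n j k := wedgeSo_swap _ _

theorem Xel_self (j : ℤ) : Xel n j j = 0 := wedgeSo_self _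

theorem Xel_neg_mem_span (S : Set (soC n)) (hS : ∀ i, Hel n i ∈ S) {j : ℤ} (hj : IsoLabel n j) :
    Xel n j (-j) ∈ Submodule.span ℂ S := by
  have hjr := hj.1
  have hmem : ∀ k : ℤ, 1 ≤ k → k ≤ soRank n → Xel n (-k) k ∈ Submodule.span ℂ S := by
    intro k h1 h2
    have := hS ⟨(k - 1).toNat, by omega⟩
    rw [Hel] at this
    have e : (((k - 1).toNat : ℕ) : ℤ) + 1 = k := by omega
    simp only [e] at this
    exact Submodule.subset_span this
  rcases lt_trichotomy j 0 with h | rfl | h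
  · have := hmem (-j) (by omega) (by omega)
    rwa [neg_neg] at this
  · rw [neg_zero, Xel_self]
    exact Submodule.zero_mem _
  · rw [Xel_swap]
    exact Submodule.neg_mem _ (hmem j (by omega) (by omega))

theorem labelGrade_neg (j : ℤ) : labelGrade n (-j) = -labelGrade n j := by
  simp [labelGrade]

theorem labelGrade_pos {j : ℤ} (h : 0 < j) : labelGrade n j = soRank n + 1 - j := by
  rw [labelGrade, Int.sign_eq_one_of_pos h]
  omega

/-- Among nonzero labels the one of smaller absolute value has the larger grade in absolute value,
so its sign decides the sign of the sum. A label `0` has grade `0` and leaves the decision to the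
other. -/
theorem Xel_mem_nPos_of_lt {j k : ℤ} (hj : IsoLabel n j) (hk : IsoLabel n k)
    (h : j.natAbs < k.natAbs) (hg : 0 < labelGrade n j + labelGrade n k) :
    Xel n j k ∈ nPos n := by
  have hjr := hj.1
  have hkr := hk.1
  have hpos : ∀ m : ℤ, IsoLabel n m → m < 0 → labelGrade n m = -(soRank n + 1 + m) := by
    intro m hm h
    have := labelGrade_pos (n := n) (j := -m) (by omega)
    rw [labelGrade_neg] at this
    omega
  rcases lt_trichotomy j 0 with hjn | rfl | hjp
  · exfalso
    rw [hpos j hj hjn] at hg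
    rcases lt_or_gt_of_ne (show k ≠ 0 by omega) with hkn | hkp
    · rw [hpos k hk hkn] at hg
      omega
    · rw [labelGrade_pos hkp] at hg
      omega
  · rcases lt_or_gt_of_ne (show k ≠ 0 by omega) with hkn | hkp
    · rw [hpos k hk hkn] at hg
      rw [show labelGrade n 0 = 0 by simp [labelGrade]] at hg
      omega
    · exact Submodule.subset_span (Or.inr ⟨hj.2 rfl, k, by omega, by omega, rfl⟩)
  · rcases lt_or_gt_of_ne (show k ≠ 0 by omega) with hkn | hkp
    · exact Submodule.subset_span (Or.inl ⟨j, -k, by omega, by omega, by omega,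
        Or.inr (by rw [neg_neg])⟩)
    · exact Submodule.subset_span (Or.inl ⟨j, k, by omega, by omega, by omega, Or.inl rfl⟩)

/-- Each `X_{jk}` is a positive root vector, a negative one, or in the Cartan subalgebra. -/
theorem Xel_trichotomy {j k : ℤ} (hj : IsoLabel n j) (hk : IsoLabel n k) :
    Xel n j k ∈ nPos n ∨ Xel n j k ∈ Submodule.span ℂ (Set.range (Hel n)) ∨
      labelGrade n j + labelGrade n k < 0 := by
  have hjr := hj.1
  have hkr := hk.1
  by_cases h1 : j = k
  · subst h1
    rw [Xel_self]
    exact Or.inl (Submodule.zero_mem _)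
  by_cases h2 : k = -j
  · subst h2
    exact Or.inr (Or.inl (Xel_neg_mem_span _ (fun i => Set.mem_range_self i) hj))
  by_cases h3 : labelGrade n j + labelGrade n k < 0
  · exact Or.inr (Or.inr h3)
  left
  -- The grade is odd and injective on labels, so opposite grades would force `k = -j`.
  have hne : labelGrade n j + labelGrade n k ≠ 0 := by
    simp only [labelGrade]
    rcases lt_trichotomy j 0 with a | a | a <;> rcases lt_trichotomy k 0 with b | b | b <;>
      simp only [Int.sign_eq_neg_one_of_neg, Int.sign_eq_one_of_pos, a, b, Int.sign_zero] <;>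
      omega
  rcases lt_or_gt_of_ne (show j.natAbs ≠ k.natAbs by omega) with h | h
  · exact Xel_mem_nPos_of_lt hj hk h (by omega)
  · rw [Xel_swap]
    exact Submodule.neg_mem _ (Xel_mem_nPos_of_lt hk hj h (by omega))

end IsotropicBasis

/-! ### Explicit action, invariant layers and highest weight vectors -/

section KTypes

open MvPolynomial

variable {n : ℕ}

theorem evNull_eq (u : Fin 2 ⊕ Fin n → ℂ) : evNull u =
    u (Sum.inl 0) • ((1 / 2 : ℂ) • (1 + rsq n)) + u (Sum.inl 1) • ((Complex.I / 2) • (rsq n - 1)) -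
      ∑ b, u (Sum.inr b) • X b := by
  rw [evNull, Fintype.sum_sum_type, Fin.sum_univ_two, sub_eq_add_neg, ← Finset.sum_neg_distrib]
  simp [etaSign, nullVec]

theorem evNull_space {u : Fin 2 ⊕ Fin n → ℂ} (hu : ∀ a, u (Sum.inl a) = 0) :
    evNull u = -∑ b, u (Sum.inr b) • X b := by
  rw [evNull_eq, hu, hu]
  simp

theorem timeForm_space {u : Fin 2 ⊕ Fin n → ℂ} (hu : ∀ a, u (Sum.inl a) = 0) :
    timeForm u = 0 := by
  rw [timeForm, hu, hu]
  simp

theorem stdVec_inr_inl (b : Fin n) (a : Fin 2) : stdVec (Sum.inr b) (Sum.inl a) = 0 := by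
  simp [stdVec]

theorem evNull_stdVec (b : Fin n) : evNull (stdVec (Sum.inr b)) = -X b := by
  rw [evNull_space (stdVec_inr_inl b)]
  simp [stdVec, Pi.single_apply]

theorem dirDer_stdVec (b : Fin n) (f : MvPolynomial (Fin n) ℂ) :
    dirDer (stdVec (Sum.inr b)) f = pderiv b f := by
  rw [dirDer_apply]
  simp [stdVec, Pi.single_apply]

theorem dirDer_time {j : ℤ} (hj : j.natAbs = 1) (f : MvPolynomial (Fin n) ℂ) :
    dirDer (isoVec n j) f = 0 := by
  rw [dirDer_apply]
  simp [isoVec_inr j hj]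

theorem evNull_isoVec_one : evNull (isoVec n 1) = C timeConst := by
  rw [evNull_eq, isoVec_inl_zero rfl, isoVec_inl_one rfl]
  simp only [isoVec_inr (1 : ℤ) rfl, zero_smul, Finset.sum_const_zero, sub_zero, smul_smul]
  have e : timeConst * (((1 : ℤ) : ℂ) * Complex.I) * (Complex.I / 2) = -(timeConst / 2) := by
    push_cast
    linear_combination (timeConst / 2) * Complex.I_mul_I
  rw [e, ← mul_one (C timeConst), ← smul_eq_C_mul]
  module

theorem evNull_isoVec_neg_one : evNull (isoVec n (-1)) = timeConst • rsq n := by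
  rw [evNull_eq, isoVec_inl_zero rfl, isoVec_inl_one rfl]
  simp only [isoVec_inr (-1 : ℤ) rfl, zero_smul, Finset.sum_const_zero, sub_zero, smul_smul]
  have e : timeConst * (((-1 : ℤ) : ℂ) * Complex.I) * (Complex.I / 2) = timeConst / 2 := by
    push_cast
    linear_combination (-timeConst / 2) * Complex.I_mul_I
  rw [e]
  module

theorem timeForm_isoVec_one : timeForm (isoVec n 1) = 0 := by
  rw [timeForm, isoVec_inl_zero rfl, isoVec_inl_one rfl]
  push_cast
  linear_combination timeConst * Complex.I_mul_I

theorem timeForm_isoVec_neg_one : timeForm (isoVec n (-1)) = 2 * timeConst := by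
  rw [timeForm, isoVec_inl_zero rfl, isoVec_inl_one rfl]
  push_cast
  linear_combination (-timeConst) * Complex.I_mul_I

/-- Translations: `η(x_1, ·)` is constant along `nullVec`, whereas `η(x_{-1}, ·)` is a multiple of
`r²` and yields the special conformal fields. -/
theorem confRep_one_space (E : ℂ) {u : Fin 2 ⊕ Fin n → ℂ} (hu : ∀ a, u (Sum.inl a) = 0)
    (f : MvPolynomial (Fin n) ℂ) :
    confRep n E (wedgeSo (isoVec n 1) u) f = timeConst • dirDer u f := by
  rw [confRep_wedgeSo, timeForm_space hu, timeForm_isoVec_one, dirDer_time rfl, evNull_isoVec_one]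
  simp [smul_eq_C_mul]

theorem confRep_neg_one_std (E : ℂ) (b : Fin n) (f : MvPolynomial (Fin n) ℂ) :
    confRep n E (wedgeSo (isoVec n (-1)) (stdVec (Sum.inr b))) f = -timeConst • conf E b f := by
  rw [confRep_wedgeSo, timeForm_space (stdVec_inr_inl b), timeForm_isoVec_neg_one, dirDer_time rfl,
    evNull_isoVec_neg_one, evNull_stdVec, dirDer_stdVec, conf_apply]
  simp only [smul_eq_C_mul, map_mul, map_neg]
  simp
  ring

theorem confRep_neg_one_one (E : ℂ) (f : MvPolynomial (Fin n) ℂ) :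
    confRep n E (wedgeSo (isoVec n (-1)) (isoVec n 1)) f = -(euler n f + E • f) := by
  rw [confRep_wedgeSo, timeForm_isoVec_one, timeForm_isoVec_neg_one, dirDer_time rfl,
    dirDer_time rfl, evNull_isoVec_one, zero_smul, sub_zero, mul_zero, zero_sub, zero_sub,
    ← smul_eq_C_mul, smul_neg, neg_neg, smul_smul,
    show timeConst * (2 * timeConst) = -1 by linear_combination 2 * timeConst_mul_self,
    neg_one_smul]

theorem confRep_space (E : ℂ) {u v : Fin 2 ⊕ Fin n → ℂ} (hu : ∀ a, u (Sum.inl a) = 0)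
    (hv : ∀ a, v (Sum.inl a) = 0) (f : MvPolynomial (Fin n) ℂ) :
    confRep n E (wedgeSo u v) f = evNull u * dirDer v f - evNull v * dirDer u f := by
  rw [confRep_wedgeSo, timeForm_space hu, timeForm_space hv, zero_smul, sub_zero, sub_zero]

theorem confRep_std_std (E : ℂ) (a b : Fin n) (f : MvPolynomial (Fin n) ℂ) :
    confRep n E (wedgeSo (stdVec (Sum.inr a)) (stdVec (Sum.inr b))) f = rot a b f := by
  rw [confRep_space E (stdVec_inr_inl a) (stdVec_inr_inl b), evNull_stdVec, evNull_stdVec,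
    dirDer_stdVec, dirDer_stdVec, rot_apply]
  ring

/-- The elements of a Lie algebra that stabilize a subspace. -/
def stabilizerOf {L P : Type} [LieRing L] [LieAlgebra ℂ L] [AddCommGroup P] [Module ℂ P]
    (ρ : L →ₗ⁅ℂ⁆ Module.End ℂ P) (N : Submodule ℂ P) : Submodule ℂ L where
  carrier := {x | ∀ f ∈ N, ρ x f ∈ N}
  add_mem' := by
    intro x y hx hy f hf
    rw [map_add]
    exact N.add_mem (hx f hf) (hy f hf)
  zero_mem' := by
    intro f _
    rw [map_zero]
    exact N.zero_mem
  smul_mem' := by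
    intro c x hx f hf
    rw [map_smul]
    exact N.smul_mem c (hx f hf)

theorem wedgeSo_time_mem {p : Submodule ℂ (soC n)}
    (h : wedgeSo (isoVec n (-1)) (isoVec n 1) ∈ p) (a a' : Fin 2) :
    wedgeSo (stdVec (Sum.inl a)) (stdVec (Sum.inl a')) ∈ p := by
  refine wedgeSo_mem_of_mem_span ?_ (stdVec_inl_mem_span a) (stdVec_inl_mem_span a')
  rintro u (rfl | rfl) v (rfl | rfl)
  · rw [wedgeSo_self]; exact p.zero_mem
  · rw [wedgeSo_swap]; exact p.neg_mem h
  · exact h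
  · rw [wedgeSo_self]; exact p.zero_mem

theorem polyModule_stable (hn : 3 ≤ n) {J : Set ℕ} (E : ℂ) (hJ : ∀ k, k + 1 ∈ J → k ∈ J)
    (hJ' : ∀ k ∈ J, 2 * (k : ℂ) + 2 * E + 2 - n ≠ 0 → k + 1 ∈ J) (A : soC n)
    {f : MvPolynomial (Fin n) ℂ} (hf : f ∈ polyModule n J) :
    confRep n E A f ∈ polyModule n J := by
  have hone : ∀ b, wedgeSo (isoVec n 1) (stdVec (Sum.inr b)) ∈
      stabilizerOf (confRep n E) (polyModule n J) := fun b f hf => by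
    rw [confRep_one_space E (stdVec_inr_inl b), dirDer_stdVec]
    exact Submodule.smul_mem _ _ (pderiv_mem_polyModule hn hJ b hf)
  have hneg : ∀ b, wedgeSo (isoVec n (-1)) (stdVec (Sum.inr b)) ∈
      stabilizerOf (confRep n E) (polyModule n J) := fun b f hf => by
    rw [confRep_neg_one_std]
    exact Submodule.smul_mem _ _ (conf_mem_polyModule hn E hJ' b hf)
  have hmix : ∀ a b, wedgeSo (stdVec (Sum.inl a)) (stdVec (Sum.inr b)) ∈
      stabilizerOf (confRep n E) (polyModule n J) := by
    intro a b
    refine wedgeSo_mem_of_mem_span (T := {stdVec (Sum.inr b)}) ?_ (stdVec_inl_mem_span a)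
      (Submodule.mem_span_singleton_self _)
    rintro u (rfl | rfl) v rfl
    exacts [hone b, hneg b]
  suffices A ∈ stabilizerOf (confRep n E) (polyModule n J) from this f hf
  refine mem_of_wedgeSo_single_mem A _ fun i j _ => ?_
  change wedgeSo (stdVec i) (stdVec j) ∈ _
  rcases i with a | a <;> rcases j with b | b
  · refine wedgeSo_time_mem (fun f hf => ?_) a b
    rw [confRep_neg_one_one]
    exact Submodule.neg_mem _ (Submodule.add_mem _ (euler_mem_polyModule hf)
      (Submodule.smul_mem _ _ hf))
  · exact hmix a b
  · rw [wedgeSo_swap]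
    exact Submodule.neg_mem _ (hmix b a)
  · intro f hf
    rw [confRep_std_std, rot_apply]
    induction hf using Submodule.span_induction with
    | mem f hf =>
      obtain ⟨k, hk, l, h, hh, rfl⟩ := hf
      rw [← rot_apply, rot_rsq_pow_mul]
      exact rsq_pow_mul_mem hk (rot_mem_harm hh a b)
    | zero => simp
    | add x y hx hy ihx ihy =>
      have e : X b * pderiv a (x + y) - X a * pderiv b (x + y) =
          (X b * pderiv a x - X a * pderiv b x) + (X b * pderiv a y - X a * pderiv b y) := by
        rw [map_add, map_add]
        ring
      rw [e]
      exact Submodule.add_mem _ ihx ihy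
    | smul t x hx ihx =>
      have e : X b * pderiv a (t • x) - X a * pderiv b (t • x) =
          t • (X b * pderiv a x - X a * pderiv b x) := by
        rw [Derivation.map_smul, Derivation.map_smul, mul_smul_comm, mul_smul_comm, smul_sub]
      rw [e]
      exact Submodule.smul_mem _ _ ihx

/-- `kC n` is spanned by the wedge products of two time-like or two space-like basis vectors. -/
theorem kC_mem_of_wedgeSo_mem {A : soC n} (hA : A ∈ kC n) {p : Submodule ℂ (soC n)}
    (h : wedgeSo (isoVec n (-1)) (isoVec n 1) ∈ p)
    (h' : ∀ a b, wedgeSo (stdVec (Sum.inr a)) (stdVec (Sum.inr b)) ∈ p) : A ∈ p := by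
  refine mem_of_wedgeSo_single_mem A _ fun i j hij => ?_
  change wedgeSo (stdVec i) (stdVec j) ∈ _
  rcases i with a | a <;> rcases j with b | b
  · exact wedgeSo_time_mem h a b
  · exact absurd (hA a b).1 hij
  · exact absurd (hA b a).2 hij
  · exact h' a b

theorem wedgeSo_mem_kC_of_time {u v : Fin 2 ⊕ Fin n → ℂ} (hu : ∀ b, u (Sum.inr b) = 0)
    (hv : ∀ b, v (Sum.inr b) = 0) : wedgeSo u v ∈ kC n := by
  intro a b
  rw [wedgeSo_apply, wedgeSo_apply, hu, hv]
  simp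

theorem wedgeSo_mem_kC_of_space {u v : Fin 2 ⊕ Fin n → ℂ} (hu : ∀ a, u (Sum.inl a) = 0)
    (hv : ∀ a, v (Sum.inl a) = 0) : wedgeSo u v ∈ kC n := by
  intro a b
  rw [wedgeSo_apply, wedgeSo_apply, hu, hv]
  simp

theorem layer_stable (E : ℂ) (l k : ℕ) {A : soC n} (hA : A ∈ kC n) {f : MvPolynomial (Fin n) ℂ}
    (hf : f ∈ layer n l k) : confRep n E A f ∈ layer n l k := by
  suffices A ∈ stabilizerOf (confRep n E) (layer n l k) from this f hf
  refine kC_mem_of_wedgeSo_mem hA ?_ fun a b => ?_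
  · rintro f ⟨h, hh, rfl⟩
    rw [confRep_neg_one_one, LinearMap.mulLeft_apply, euler_rsq_pow_mul hh, ← add_smul]
    exact Submodule.neg_mem _ (Submodule.smul_mem _ _ (mem_layer.2 ⟨h, hh, rfl⟩))
  · rintro f ⟨h, hh, rfl⟩
    rw [confRep_std_std, LinearMap.mulLeft_apply, rot_rsq_pow_mul]
    exact mem_layer.2 ⟨_, rot_mem_harm hh a b, rfl⟩

theorem layer_irreducible (hn : 3 ≤ n) (E : ℂ) (l k : ℕ) {N : Submodule ℂ (MvPolynomial (Fin n) ℂ)}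
    (hle : N ≤ layer n l k) (hN : ∀ A ∈ kC n, ∀ f ∈ N, confRep n E A f ∈ N) (h0 : N ≠ ⊥) :
    N = layer n l k := by
  -- Multiplication by `r^{2k}` commutes with rotations, so the claim is transported to `H_l`.
  let M := harm n l ⊓ N.comap (LinearMap.mulLeft ℂ (rsq n ^ k))
  have hmap : M.map (LinearMap.mulLeft ℂ (rsq n ^ k)) = N := by
    apply le_antisymm
    · rintro _ ⟨h, ⟨-, hh⟩, rfl⟩
      exact hh
    · intro f hf
      obtain ⟨h, hh, rfl⟩ := hle hf
      exact ⟨h, ⟨hh, hf⟩, rfl⟩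
  have hM : M = harm n l := by
    refine harm_irreducible hn inf_le_left ?_ ?_
    · intro h
      rw [h, Submodule.map_bot] at hmap
      exact h0 hmap.symm
    · rintro a b f ⟨hf, hf'⟩
      refine ⟨rot_mem_harm hf a b, ?_⟩
      have h1 := hN _ (wedgeSo_mem_kC_of_space (stdVec_inr_inl a) (stdVec_inr_inl b)) _ hf'
      rwa [confRep_std_std, LinearMap.mulLeft_apply, rot_rsq_pow_mul] at h1
  rw [← hmap, hM]
  rfl

theorem two_isoLabel (hn : 3 ≤ n) : IsoLabel n 2 := by
  refine ⟨?_, by norm_num⟩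
  change 2 ≤ (n + 2) / 2
  omega

theorem isoVec_space {j : ℤ} (hj : j.natAbs ≠ 1) (a : Fin 2) : isoVec n j (Sum.inl a) = 0 :=
  isoVec_inl j hj a

/-- The highest weight vector of `|x|^{2k} H_l`. -/
noncomputable def hwVec (n l k : ℕ) : MvPolynomial (Fin n) ℂ := rsq n ^ k * evNull (isoVec n 2) ^ l

theorem evNull_isoVec_two (hn : 3 ≤ n) : evNull (isoVec n 2) =
    (-spaceConst) • isoForm ⟨0, by omega⟩ ⟨1, by omega⟩ := by
  rw [evNull_space (isoVec_space (by norm_num)),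
    isoVec_eq_space (two_isoLabel hn) (by norm_num), isoForm, neg_smul, smul_add]
  congr 1
  have h1 : (2 : ℤ).sign = 1 := rfl
  simp only [Pi.smul_apply, Pi.add_apply, stdVec, Pi.single_apply, Sum.inr.injEq, h1]
  simp only [smul_eq_mul, add_smul, Finset.sum_add_distrib]
  simp [smul_smul]

theorem hwVec_mem (hn : 3 ≤ n) (l k : ℕ) : hwVec n l k ∈ layer n l k := by
  refine mem_layer.2 ⟨_, ?_, rfl⟩
  rw [evNull_isoVec_two hn, smul_pow]
  exact Submodule.smul_mem _ _ (isoForm_pow_mem_harm (by simp) l)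

theorem hwVec_ne_zero (hn : 3 ≤ n) (l k : ℕ) : hwVec n l k ≠ 0 := by
  refine mul_ne_zero (pow_ne_zero _ (rsq_ne_zero (by omega))) (pow_ne_zero _ ?_)
  rw [evNull_isoVec_two hn]
  exact smul_ne_zero (neg_ne_zero.2 spaceConst_ne_zero) (isoForm_ne_zero (by simp))

theorem dirDer_rsq {u : Fin 2 ⊕ Fin n → ℂ} (hu : ∀ a, u (Sum.inl a) = 0) :
    dirDer u (rsq n) = -2 * evNull u := by
  rw [dirDer_apply, evNull_space hu, neg_mul_neg, Finset.mul_sum]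
  refine Finset.sum_congr rfl fun b _ => ?_
  rw [pderiv_rsq, mul_smul_comm]

theorem dirDer_evNull {u v : Fin 2 ⊕ Fin n → ℂ} (hv : ∀ a, v (Sum.inl a) = 0) :
    dirDer u (evNull v) = C (etaForm u v) := by
  have h : ∀ b, pderiv b (evNull v) = C (-v (Sum.inr b)) := by
    intro b
    rw [evNull_space hv, map_neg, map_sum, C_neg]
    simp [pderiv_X, Pi.single_apply, smul_eq_C_mul]
  rw [dirDer_apply, etaForm_apply, Fintype.sum_sum_type]
  simp only [h, hv, etaSign, smul_eq_C_mul, ← C_mul, ← map_sum]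
  simp

/-- The field annihilates `r²`, so only the power of `η(x_2, ·)` is differentiated; the hypothesis
says that this linear form is an eigenvector of eigenvalue `c`. -/
theorem confRep_space_hwVec (E : ℂ) {u v : Fin 2 ⊕ Fin n → ℂ}
    (hu : ∀ a, u (Sum.inl a) = 0) (hv : ∀ a, v (Sum.inl a) = 0) (l k : ℕ) {c : ℂ}
    (h : etaForm v (isoVec n 2) • evNull u - etaForm u (isoVec n 2) • evNull v =
      c • evNull (isoVec n 2)) :
    confRep n E (wedgeSo u v) (hwVec n l k) = (c * l) • hwVec n l k := by
  have h2 : ∀ a, isoVec n 2 (Sum.inl a) = 0 := isoVec_space (by norm_num)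
  have hd : ∀ {w : Fin 2 ⊕ Fin n → ℂ}, (∀ a, w (Sum.inl a) = 0) → dirDer w (hwVec n l k) =
      ((k : MvPolynomial (Fin n) ℂ) * rsq n ^ (k - 1) * evNull (isoVec n 2) ^ l) * (-2 * evNull w) +
        (rsq n ^ k * ((l : MvPolynomial (Fin n) ℂ) * evNull (isoVec n 2) ^ (l - 1))) * C (etaForm w (isoVec n 2)) := by
    intro w hw
    rw [hwVec, Derivation.leibniz, Derivation.leibniz_pow, Derivation.leibniz_pow, dirDer_rsq hw,
      dirDer_evNull h2]
    simp only [smul_eq_mul, nsmul_eq_mul]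
    ring
  rw [confRep_space E hu hv, hd hu, hd hv]
  have e : evNull u * ((k : MvPolynomial (Fin n) ℂ) * rsq n ^ (k - 1) * evNull (isoVec n 2) ^ l * (-2 * evNull v) +
      rsq n ^ k * ((l : MvPolynomial (Fin n) ℂ) * evNull (isoVec n 2) ^ (l - 1)) * C (etaForm v (isoVec n 2))) -
      evNull v * ((k : MvPolynomial (Fin n) ℂ) * rsq n ^ (k - 1) * evNull (isoVec n 2) ^ l * (-2 * evNull u) +
      rsq n ^ k * ((l : MvPolynomial (Fin n) ℂ) * evNull (isoVec n 2) ^ (l - 1)) * C (etaForm u (isoVec n 2))) =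
      rsq n ^ k * ((l : MvPolynomial (Fin n) ℂ) * evNull (isoVec n 2) ^ (l - 1)) *
        (etaForm v (isoVec n 2) • evNull u - etaForm u (isoVec n 2) • evNull v) := by
    simp only [smul_eq_C_mul]
    ring
  rw [e, h, hwVec]
  cases l with
  | zero => simp
  | succ l =>
    rw [smul_eq_C_mul, smul_eq_C_mul, C_mul, map_natCast, Nat.add_sub_cancel]
    ring

theorem confRep_Hel_hwVec (hn : 3 ≤ n) (E : ℂ) (l k : ℕ) (i : Fin (soRank n)) :
    confRep n E (Hel n i) (hwVec n l k) = twoWt n (-(E + l + 2 * k)) l i • hwVec n l k := by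
  obtain ⟨h, hh, hhw⟩ := mem_layer.1 (hwVec_mem hn l k)
  by_cases hi : (i : ℕ) = 0
  · rw [Hel, hi]
    change confRep n E (wedgeSo (isoVec n (-1)) (isoVec n 1)) _ = _
    rw [confRep_neg_one_one, twoWt, if_pos hi, ← hhw, euler_rsq_pow_mul hh, ← add_smul, ← neg_smul]
    congr 1
    ring
  · have hir := i.2
    have hlab : IsoLabel n ((i : ℤ) + 1) := ⟨by omega, by omega⟩
    have hc : etaForm (isoVec n ((i : ℤ) + 1)) (isoVec n 2) = 0 := by
      rw [etaForm_isoVec hlab (two_isoLabel hn), if_neg (by omega)]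
    rw [Hel, Xel_eq, confRep_space_hwVec E (c := if (i : ℕ) = 1 then 1 else 0)
      (isoVec_space (by omega)) (isoVec_space (by omega)), twoWt, if_neg hi]
    · congr 1
      split_ifs <;> simp
    · rw [hc, etaForm_isoVec (isoLabel_neg hlab) (two_isoLabel hn), zero_smul, zero_sub]
      by_cases h1 : (i : ℕ) = 1
      · rw [if_pos (by omega), if_pos h1, neg_smul, neg_neg, h1]
        rfl
      · rw [if_neg (by omega), if_neg h1, zero_smul, zero_smul, neg_zero]

/-- Positive root vectors not involving `x_1` kill the vector, since among the `x_j` only `x_{-2}`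
pairs with `x_2`; those involving `x_1` differentiate. This common form serves both the constant `1`
and the compact highest weight vectors. -/
theorem nPos_hwVec (hn : 3 ≤ n) (E : ℂ) (l k : ℕ) {x : soC n} (hx : x ∈ nPos n) :
    ∃ u : Fin 2 ⊕ Fin n → ℂ, confRep n E x (hwVec n l k) = dirDer u (hwVec n l k) := by
  have key : ∀ i j : ℤ, IsoLabel n i → IsoLabel n j → i.natAbs ≠ 1 → j.natAbs ≠ 1 → i ≠ -2 →
      j ≠ -2 → confRep n E (Xel n i j) (hwVec n l k) = 0 := by
    intro i j hi hj hi1 hj1 hi2 hj2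
    rw [Xel_eq, confRep_space_hwVec E (c := 0) (isoVec_space hi1) (isoVec_space hj1), zero_mul,
      zero_smul]
    rw [etaForm_isoVec hi (two_isoLabel hn), etaForm_isoVec hj (two_isoLabel hn), if_neg hi2,
      if_neg hj2]
    simp
  have key1 : ∀ j : ℤ, j.natAbs ≠ 1 → confRep n E (Xel n 1 j) (hwVec n l k) =
      dirDer (timeConst • isoVec n j) (hwVec n l k) := by
    intro j hj
    rw [Xel_eq, confRep_one_space E (isoVec_space hj), dirDer_apply, dirDer_apply, Finset.smul_sum]
    exact Finset.sum_congr rfl fun b _ => by rw [Pi.smul_apply, smul_assoc]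
  have hzero : dirDer (0 : Fin 2 ⊕ Fin n → ℂ) (hwVec n l k) = 0 := by
    simp [dirDer_apply]
  induction hx using Submodule.span_induction with
  | mem x hx =>
    rcases hx with ⟨i, j, h1, h2, h3, h⟩ | ⟨hodd, j, h1, h2, rfl⟩
    · by_cases hi : i = 1
      · subst hi
        rcases h with rfl | rfl
        · exact ⟨_, key1 j (by omega)⟩
        · exact ⟨_, key1 (-j) (by omega)⟩
      · have hli : IsoLabel n i := ⟨by omega, by omega⟩
        have hlj : IsoLabel n j := ⟨by omega, by omega⟩
        refine ⟨0, ?_⟩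
        rw [hzero]
        rcases h with rfl | rfl
        · exact key i j hli hlj (by omega) (by omega) (by omega) (by omega)
        · exact key i (-j) hli (isoLabel_neg hlj) (by omega) (by omega) (by omega) (by omega)
    · have hl0 : IsoLabel n 0 := ⟨by simp, fun _ => hodd⟩
      by_cases hj : j = 1
      · subst hj
        refine ⟨-(timeConst • isoVec n 0), ?_⟩
        rw [Xel_swap, map_neg, LinearMap.neg_apply, key1 0 (by norm_num), dirDer_apply,
          dirDer_apply, ← Finset.sum_neg_distrib]
        exact Finset.sum_congr rfl fun b _ => by rw [Pi.neg_apply, neg_smul]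
      · refine ⟨0, ?_⟩
        rw [hzero]
        exact key 0 j hl0 ⟨by omega, by omega⟩ (by norm_num) (by omega) (by norm_num) (by omega)
  | zero => exact ⟨0, by rw [map_zero, hzero]; rfl⟩
  | add x y _ _ hx hy =>
    obtain ⟨u, hu⟩ := hx
    obtain ⟨v, hv⟩ := hy
    refine ⟨u + v, ?_⟩
    rw [map_add, LinearMap.add_apply, hu, hv, dirDer_apply, dirDer_apply, dirDer_apply,
      ← Finset.sum_add_distrib]
    exact Finset.sum_congr rfl fun b _ => by rw [Pi.add_apply, add_smul]
  | smul t x _ hx =>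
    obtain ⟨u, hu⟩ := hx
    refine ⟨t • u, ?_⟩
    rw [map_smul, LinearMap.smul_apply, hu, dirDer_apply, dirDer_apply, Finset.smul_sum]
    exact Finset.sum_congr rfl fun b _ => by rw [Pi.smul_apply, smul_assoc]

/-- As an element of `kC n`, `x` preserves the degree; as an element of `nPos n`, it acts on this
vector as a derivative and lowers the degree by one. So the image is zero, and no basis of the
intersection is needed. -/
theorem nPos_kC_hwVec (hn : 3 ≤ n) (E : ℂ) (l k : ℕ) {x : soC n} (hx : x ∈ nPos n)
    (hk : x ∈ kC n) : confRep n E x (hwVec n l k) = 0 := by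
  obtain ⟨u, hu⟩ := nPos_hwVec hn E l k hx
  obtain ⟨h, hh, hhw⟩ := mem_layer.1 (hwVec_mem hn l k)
  obtain ⟨h', hh', hhw'⟩ := mem_layer.1 (layer_stable E l k hk (hwVec_mem hn l k))
  have e1 : euler n (confRep n E x (hwVec n l k)) =
      (l + 2 * k : ℂ) • confRep n E x (hwVec n l k) := by
    rw [← hhw', euler_rsq_pow_mul hh']
  have e2 : euler n (confRep n E x (hwVec n l k)) =
      (l + 2 * k - 1 : ℂ) • confRep n E x (hwVec n l k) := by
    rw [hu, dirDer_apply, map_sum, Finset.smul_sum]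
    refine Finset.sum_congr rfl fun b _ => ?_
    rw [Derivation.map_smul, smul_comm _ (u _), ← sub_eq_of_eq_add (pderiv_euler b _), ← hhw,
      euler_rsq_pow_mul hh, Derivation.map_smul, sub_smul, one_smul]
  rw [e1, sub_smul, one_smul] at e2
  exact sub_eq_self.1 e2.symm

theorem nPos_one (hn : 3 ≤ n) (E : ℂ) {x : soC n} (hx : x ∈ nPos n) : confRep n E x 1 = 0 := by
  have h1 : hwVec n 0 0 = 1 := by simp [hwVec]
  obtain ⟨u, hu⟩ := nPos_hwVec hn E 0 0 hx
  rw [h1] at hu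
  rw [hu, Derivation.map_one_eq_zero]

/-! ### Polynomial models of the abstract modules and the direct sum -/

theorem span_iso_eq_top (hn : 3 ≤ n) {p : Submodule ℂ (soC n)}
    (h : ∀ j k, IsoLabel n j → IsoLabel n k → Xel n j k ∈ p) : p = ⊤ := by
  have h1 : IsoLabel n 1 := ⟨by change 1 ≤ (n + 2) / 2; omega, by norm_num⟩
  have hall : ∀ i, stdVec i ∈ Submodule.span ℂ {u | ∃ j : ℤ, IsoLabel n j ∧ u = isoVec n j} := by
    rintro (a | b)
    · refine Submodule.span_mono ?_ (stdVec_inl_mem_span a)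
      rintro u (rfl | rfl)
      exacts [⟨1, h1, rfl⟩, ⟨-1, isoLabel_neg h1, rfl⟩]
    · refine Submodule.span_mono ?_ (stdVec_inr_mem_span hn b)
      rintro u ⟨j, hj, -, rfl⟩
      exact ⟨j, hj, rfl⟩
  rw [eq_top_iff]
  intro A _
  refine mem_of_wedgeSo_single_mem A p fun i j _ => ?_
  refine wedgeSo_mem_of_mem_span ?_ (hall i) (hall j)
  rintro u ⟨j, hj, rfl⟩ v ⟨k, hk, rfl⟩
  exact h j k hj hk

/-- `J` must be an initial segment that ends exactly where the coefficient of `conf` vanishes: one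
direction of `hJ'` gives stability, the other irreducibility. Positivity of `E` keeps the
coefficients `m + E` nonzero. -/
theorem Dmod_model (hn : 3 ≤ n) (E : ℝ) (hE : 0 < E) {J : Set ℕ} (h0 : 0 ∈ J)
    (hJ : ∀ k, k + 1 ∈ J → k ∈ J)
    (hJ' : ∀ k ∈ J, k + 1 ∈ J ↔ 2 * (k : ℂ) + 2 * E + 2 - n ≠ 0) :
    ∃ e : Dmod n E →ₗ[ℂ] MvPolynomial (Fin n) ℂ, Function.Injective e ∧
      LinearMap.range e = polyModule n J ∧ ∀ (x : soC n) m, e ⁅x, m⁆ = confRep n E x (e m) := by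
  have hE' : ∀ m : ℕ, (m : ℂ) + E ≠ 0 := by
    intro m h
    have h2 : ((m + E : ℝ) : ℂ) = 0 := by push_cast; exact h
    rw [Complex.ofReal_eq_zero] at h2
    have : (0 : ℝ) ≤ m := Nat.cast_nonneg m
    linarith
  have h1 : hwVec n 0 0 = 1 := by simp [hwVec]
  refine IrrHW.exists_linearMap_of_highestWeight (twoWt n (-(E : ℂ)) 0)
    (npos := nPos n) (H := Hel n)
    (Y := {x | ∃ j k : ℤ, IsoLabel n j ∧ IsoLabel n k ∧ labelGrade n j + labelGrade n k < 0 ∧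
      x = Xel n j k}) ?_ (δ := gradeEl n) ?_ ?_ (confRep n E) (polyModule n J) ?_ ?_ (v := 1)
      ?_ one_ne_zero ?_ ?_
  · refine span_iso_eq_top hn fun j k hj hk => ?_
    rcases Xel_trichotomy hj hk with h | h | h
    · exact Submodule.subset_span (Or.inl (Or.inl h))
    · exact Submodule.span_mono (fun x hx => Or.inl (Or.inr hx)) h
    · exact Submodule.subset_span (Or.inr ⟨j, k, hj, hk, h, rfl⟩)
  · exact Submodule.sum_mem _ fun i _ => Submodule.smul_mem _ _
      (Submodule.subset_span (Set.mem_range_self i))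
  · rintro _ ⟨j, k, hj, hk, h, rfl⟩
    exact lie_gradeEl_Xel_of_neg hj hk h
  · exact fun x m hm => polyModule_stable hn E hJ (fun k hk => (hJ' k hk).2) x hm
  · intro N hle hN hne
    refine polyModule_irreducible hn (E : ℂ) hE' hJ hJ' hle ?_ ?_ hne
    · intro b f hf
      have := hN (wedgeSo (isoVec n (-1)) (stdVec (Sum.inr b))) f hf
      rw [confRep_neg_one_std] at this
      exact (N.smul_mem_iff (neg_ne_zero.2 timeConst_ne_zero)).1 this
    · intro b f hf
      have := hN (wedgeSo (isoVec n 1) (stdVec (Sum.inr b))) f hf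
      rw [confRep_one_space _ (stdVec_inr_inl b), dirDer_stdVec] at this
      exact (N.smul_mem_iff timeConst_ne_zero).1 this
  · simpa using rsq_pow_mul_mem (n := n) h0 one_mem_harm
  · exact fun x hx => nPos_one hn _ hx
  · intro i
    have := confRep_Hel_hwVec hn E 0 0 i
    rw [h1] at this
    simpa using this

theorem gradeEl_mem_kC : gradeEl n ∈ kC n :=
  sum_mem fun i _ => (kC n).smul_mem _ (Hel_mem_kC n i)

theorem span_iso_kC_eq_top (hn : 3 ≤ n) {p : Submodule ℂ (kC n)}
    (h : ∀ j k, IsoLabel n j → IsoLabel n k → ∀ hm : Xel n j k ∈ kC n,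
      (⟨Xel n j k, hm⟩ : kC n) ∈ p) : p = ⊤ := by
  have h1 : IsoLabel n 1 := ⟨by change 1 ≤ (n + 2) / 2; omega, by norm_num⟩
  rw [eq_top_iff]
  rintro ⟨A, hA⟩ _
  have hmap : ∀ j k, IsoLabel n j → IsoLabel n k → Xel n j k ∈ kC n →
      Xel n j k ∈ p.map (kC n).incl.toLinearMap := fun j k hj hk hm => ⟨_, h j k hj hk hm, rfl⟩
  suffices A ∈ p.map (kC n).incl.toLinearMap by
    obtain ⟨B, hB, hBA⟩ := this
    have : B = ⟨A, hA⟩ := Subtype.ext hBA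
    rwa [← this]
  refine kC_mem_of_wedgeSo_mem hA ?_ fun a b => ?_
  · exact hmap (-1) 1 (isoLabel_neg h1) h1
      (wedgeSo_mem_kC_of_time (isoVec_inr _ rfl) (isoVec_inr _ rfl))
  · refine wedgeSo_mem_of_mem_span ?_ (stdVec_inr_mem_span hn a) (stdVec_inr_mem_span hn b)
    rintro u ⟨j, hj, hj1, rfl⟩ v ⟨k, hk, hk1, rfl⟩
    exact hmap j k hj hk (wedgeSo_mem_kC_of_space (isoVec_space hj1) (isoVec_space hk1))

/-- No condition on `E` is needed, since it enters the action of `kC n` only through the character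
of `so(2)`. -/
theorem KType_model (hn : 3 ≤ n) (E : ℝ) (l k : ℕ) :
    ∃ e : KType n E l k →ₗ[ℂ] MvPolynomial (Fin n) ℂ, Function.Injective e ∧
      LinearMap.range e = layer n l k ∧ ∀ (x : kC n) m, e ⁅x, m⁆ = confRep n E x.1 (e m) := by
  refine IrrHW.exists_linearMap_of_highestWeight (twoWt n (-((E : ℂ) + l + 2 * k)) l)
    (npos := (nPos n).comap (kC n).incl.toLinearMap)
    (H := fun i => (⟨Hel n i, Hel_mem_kC n i⟩ : kC n))
    (Y := {x | ∃ j k : ℤ, IsoLabel n j ∧ IsoLabel n k ∧ labelGrade n j + labelGrade n k < 0 ∧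
      x.1 = Xel n j k}) ?_ (δ := ⟨gradeEl n, gradeEl_mem_kC⟩) ?_ ?_
    ((confRep n E).comp (kC n).incl) (layer n l k) ?_ ?_ (v := hwVec n l k)
    (hwVec_mem hn l k) (hwVec_ne_zero hn l k) ?_ ?_
  · refine span_iso_kC_eq_top hn fun j k hj hk hm => ?_
    rcases Xel_trichotomy hj hk with h | h | h
    · exact Submodule.subset_span (Or.inl (Or.inl h))
    · have h2 : ∀ y ∈ Submodule.span ℂ (Set.range (Hel n)), ∃ z ∈ Submodule.span ℂ
          (Set.range fun i => (⟨Hel n i, Hel_mem_kC n i⟩ : kC n)), z.1 = y := by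
        intro y hy
        have hle : Submodule.span ℂ (Set.range (Hel n)) ≤ (Submodule.span ℂ
          (Set.range fun i => (⟨Hel n i, Hel_mem_kC n i⟩ : kC n))).map
            (kC n).incl.toLinearMap := by
          rw [Submodule.span_le]
          rintro _ ⟨i, rfl⟩
          exact ⟨_, Submodule.subset_span (Set.mem_range_self i), rfl⟩
        exact hle hy
      obtain ⟨z, hz, hzy⟩ := h2 _ h
      have : z = ⟨Xel n j k, hm⟩ := Subtype.ext hzy
      rw [← this]
      exact Submodule.span_mono (fun x hx => Or.inl (Or.inr hx)) hz
    · exact Submodule.subset_span (Or.inr ⟨j, k, hj, hk, h, rfl⟩)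
  · have : (⟨gradeEl n, gradeEl_mem_kC⟩ : kC n) = ∑ i : Fin (soRank n),
        ((soRank n - i : ℤ) : ℂ) • (⟨Hel n i, Hel_mem_kC n i⟩ : kC n) := by
      apply Subtype.ext
      rw [AddSubmonoidClass.coe_finsetSum]
      rfl
    rw [this]
    exact Submodule.sum_mem _ fun i _ => Submodule.smul_mem _ _
      (Submodule.subset_span (Set.mem_range_self i))
  · rintro ⟨y, hy⟩ ⟨j, k, hj, hk, h, rfl⟩
    obtain ⟨m, hm, e⟩ := lie_gradeEl_Xel_of_neg hj hk h
    exact ⟨m, hm, Subtype.ext e⟩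
  · exact fun x m hm => layer_stable E l k x.2 hm
  · exact fun N hle hN hne => layer_irreducible hn E l k hle
      (fun A hA f hf => hN ⟨A, hA⟩ f hf) hne
  · exact fun x hx => nPos_kC_hwVec hn E l k hx x.2
  · exact fun i => confRep_Hel_hwVec hn E l k i

/-- A module that embeds onto the sum of an independent family of embedded modules is their direct
sum. -/
theorem nonempty_lieModuleEquiv_directSum {L P M ι : Type} [LieRing L] [LieAlgebra ℂ L]
    [AddCommGroup P] [Module ℂ P] [AddCommGroup M] [Module ℂ M] [LieRingModule L M]
    {N : ι → Type} [∀ i, AddCommGroup (N i)] [∀ i, Module ℂ (N i)] [∀ i, LieRingModule L (N i)]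
    [∀ i, LieModule ℂ L (N i)] (ρ : L → Module.End ℂ P) {W : ι → Submodule ℂ P}
    (hW : iSupIndep W) (e : M →ₗ[ℂ] P) (hei : Function.Injective e)
    (her : LinearMap.range e = ⨆ i, W i) (hel : ∀ x m, e ⁅x, m⁆ = ρ x (e m))
    (ε : ∀ i, N i →ₗ[ℂ] P) (hεi : ∀ i, Function.Injective (ε i))
    (hεr : ∀ i, LinearMap.range (ε i) = W i) (hεl : ∀ i x m, ε i ⁅x, m⁆ = ρ x (ε i m)) :
    Nonempty (M ≃ₗ⁅ℂ, L⁆ ⨁ i, N i) := by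
  classical
  let F : (⨁ i, N i) →ₗ[ℂ] P := DirectSum.toModule ℂ ι P ε
  have hFof : ∀ i m, F (DirectSum.of _ i m) = ε i m := fun i m => DirectSum.toModule_lof ℂ i m
  have hFr : LinearMap.range F = ⨆ i, W i := by
    apply le_antisymm
    · rintro _ ⟨y, rfl⟩
      induction y using DirectSum.induction_on with
      | zero => rw [map_zero]; exact Submodule.zero_mem _
      | of i m =>
        rw [hFof]
        refine Submodule.mem_iSup_of_mem i ?_
        rw [← hεr i]
        exact LinearMap.mem_range_self _ m
      | add x y hx hy => rw [map_add]; exact Submodule.add_mem _ hx hy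
    · refine iSup_le fun i => ?_
      rw [← hεr i]
      rintro _ ⟨m, rfl⟩
      exact ⟨DirectSum.of _ i m, hFof i m⟩
  -- `F` factors through `⨁ W i`: injective componentwise, then injective by independence.
  have hFi : Function.Injective F := by
    let ε' : ∀ i, N i →ₗ[ℂ] W i := fun i =>
      (ε i).codRestrict (W i) fun m => hεr i ▸ LinearMap.mem_range_self _ m
    have hε' : ∀ i, Function.Injective (ε' i) := fun i a b h =>
      hεi i (congrArg Subtype.val h)
    have hcomp : ∀ y, F y = DirectSum.coeLinearMap W (DirectSum.lmap ε' y) := by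
      intro y
      induction y using DirectSum.induction_on with
      | zero => simp
      | of i m =>
        rw [hFof]
        have : DirectSum.lmap ε' (DirectSum.of _ i m) = DirectSum.of _ i (ε' i m) :=
          DirectSum.lmap_lof ε' i m
        rw [this, DirectSum.coeLinearMap_of]
        rfl
      | add x y hx hy => rw [map_add, hx, hy, map_add, map_add]
    intro y z hyz
    rw [hcomp, hcomp] at hyz
    exact (DirectSum.lmap_injective ε').2 hε' (hW.dfinsupp_lsum_injective hyz)
  have hFl : ∀ (x : L) y, F ⁅x, y⁆ = ρ x (F y) := by
    intro x y
    induction y using DirectSum.induction_on with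
    | zero => rw [lie_zero, map_zero, map_zero]
    | of i m =>
      have h2 : ⁅x, DirectSum.of N i m⁆ = DirectSum.of N i ⁅x, m⁆ :=
        ((DirectSum.lieModuleOf ℂ ι L N i).map_lie x m).symm
      rw [h2, hFof, hFof, hεl]
    | add y z hy hz => rw [lie_add, map_add, hy, hz, map_add, map_add]
  let Φ : M ≃ₗ[ℂ] ⨁ i, N i :=
    (LinearEquiv.ofInjective e hei).trans ((LinearEquiv.ofEq _ _ (her.trans hFr.symm)).trans
      (LinearEquiv.ofInjective F hFi).symm)
  have hΦ : ∀ m, F (Φ m) = e m := fun m =>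
    congrArg Subtype.val ((LinearEquiv.ofInjective F hFi).apply_symm_apply
      (LinearEquiv.ofEq _ _ (her.trans hFr.symm) (LinearEquiv.ofInjective e hei m)))
  exact ⟨{ Φ with
    map_lie' := by
      intro x m
      apply hFi
      change F (Φ ⁅x, m⁆) = F ⁅x, Φ m⁆
      rw [hFl, hΦ, hΦ, hel] }⟩

/-- The decomposition of `D(E)` under `kC n`, for any index set of powers of `|x|^2`. -/
theorem Dmod_decomposition (hn : 3 ≤ n) (E : ℝ) (hE : 0 < E) {κ : Type} {g : κ → ℕ}
    (hg : Function.Injective g) (h0 : 0 ∈ Set.range g)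
    (hJ : ∀ k, k + 1 ∈ Set.range g → k ∈ Set.range g)
    (hJ' : ∀ k ∈ Set.range g, k + 1 ∈ Set.range g ↔ 2 * (k : ℂ) + 2 * E + 2 - n ≠ 0) :
    Nonempty (Dmod n E ≃ₗ⁅ℂ, kC n⁆ ⨁ p : ℕ × κ, KType n E p.1 (g p.2)) := by
  obtain ⟨e, hei, her, hel⟩ := Dmod_model hn E hE h0 hJ hJ'
  choose ε hεi hεr hεl using fun p : ℕ × κ => KType_model hn E p.1 (g p.2)
  exact nonempty_lieModuleEquiv_directSum (fun x : kC n => confRep n E x.1) (iSupIndep_layer hn hg)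
    e hei (her.trans (iSup_layer g).symm) (fun x m => hel x.1 m) ε hεi hεr hεl

end KTypes

theorem mainTheorem6 (n : ℕ) (hn : 3 ≤ n) (E₀ : ℝ) (hE₀ : 0 < E₀) :
    ((¬ ∃ j : ℕ, 1 ≤ j ∧ j ≤ (n - 1) / 2 ∧ E₀ = (n : ℝ) / 2 - j) →
      Nonempty (Dmod n E₀ ≃ₗ⁅ℂ, kC n⁆ ⨁ p : ℕ × ℕ, KType n E₀ p.1 p.2)) ∧
    (∀ j : ℕ, 1 ≤ j → j ≤ (n - 1) / 2 → E₀ = (n : ℝ) / 2 - j →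
      Nonempty (Dmod n E₀ ≃ₗ⁅ℂ, kC n⁆ ⨁ p : ℕ × Fin j, KType n E₀ p.1 p.2)) := by
  -- Row `k` is the last one exactly when `j = k + 1`.
  have hcast : ∀ k : ℕ, 2 * (k : ℂ) + 2 * E₀ + 2 - n = 0 ↔ E₀ = (n : ℝ) / 2 - (k + 1 : ℕ) := by
    intro k
    have : 2 * (k : ℂ) + 2 * E₀ + 2 - n = ((2 * k + 2 * E₀ + 2 - n : ℝ) : ℂ) := by push_cast; rfl
    rw [this, Complex.ofReal_eq_zero]
    push_cast
    constructor <;> intro h <;> linarith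
  constructor
  · intro hE
    refine Dmod_decomposition hn E₀ hE₀ (g := id) Function.injective_id ⟨0, rfl⟩
      (fun k _ => ⟨k, rfl⟩) fun k _ => ?_
    refine ⟨fun _ h => hE ⟨k + 1, by omega, ?_, (hcast k).1 h⟩, fun _ => ⟨k + 1, rfl⟩⟩
    have h1 := (hcast k).1 h
    -- Positivity of `E₀` is what bounds `k + 1` by `(n - 1) / 2`, so the excluded values cover
    -- every vanishing coefficient.
    have h2 : ((2 * (k + 1) : ℕ) : ℝ) < n := by
      push_cast at h1 ⊢
      linarith
    have h3 : 2 * (k + 1) < n := by exact_mod_cast h2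
    omega
  · intro j hj1 hj2 hE
    have hrange : ∀ k, k ∈ Set.range (fun i : Fin j => (i : ℕ)) ↔ k < j := fun k =>
      ⟨fun ⟨i, hi⟩ => hi ▸ i.2, fun h => ⟨⟨k, h⟩, rfl⟩⟩
    refine Dmod_decomposition hn E₀ hE₀ (g := fun i : Fin j => (i : ℕ)) Fin.val_injective
      ((hrange 0).2 hj1) (fun k hk => (hrange k).2 (by have := (hrange _).1 hk; omega))
      fun k hk => ?_
    rw [hrange] at hk ⊢
    rw [ne_eq, hcast, hE]
    have : (n : ℝ) / 2 - j = n / 2 - (k + 1 : ℕ) ↔ j = k + 1 := by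
      rw [sub_right_inj, Nat.cast_inj]
    rw [this]
    omega
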